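/- **Notation.** For $L>0$ put $\mu=e^L$, $C_\mu=\mathbb R_+^*/\mu^{\mathbb Z}$ with the measure $d^*u=du/u$, and for $\xi\in L^2(C_\mu)$, $n\in\mathbb Z$, put $\mathcal F(\xi)(n)=L^{-1/2}\int_{C_\mu}\xi(u)\,u^{-2\pi i n/L}\,d^*u$; this identifies the family of Hilbert spaces $L^2(C_\mu)$, $L>0$, with the restriction to $(0,\infty)$ of the trivial bundle $[0,\infty)\times\ell^2(\mathbb Z)$. For $V=\mathbb C$ or $V=\ell^2(\mathbb Z)$, $C_0^\infty([0,\infty),V)$ is the space of smooth functions $[0,\infty)\to V$ which vanish together with all their derivatives at $0$ (no condition is imposed at infinity), with the Fréchet topology given by the seminorms $\max_{L\in K}L^{-a}\|\partial_L^b f(L)\|$, $K\subset[0,\infty)$ compact, $a,b\ge 0$. Through $\mathcal F$ one obtains the space $C_0^\infty([0,\infty),L^2)$ of smooth sections $\xi=(\xi(L))_{L}$, $\xi(L)\in L^2(C_{\exp L})$, with its Fréchet topology; write $\hat\xi(L,n)=\mathcal F(\xi(L))(n)$. This is the space of sections over $[0,\infty)$ of the sheaf $\mathcal L^2$ on the Scaling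 Site $\mathscr S=[0,\infty)\rtimes\mathbb N^\times$, on which $n\in\mathbb N^\times$ acts by $(n\cdot\xi)(L)=\sigma_n(\xi(nL))$, where $\sigma_n:L^2(C_{\mu^n})\to L^2(C_\mu)$, $\sigma_n(\eta)(u)=\sum_{j=1}^n\eta(\mu^j u)$. Let $H^0(\mathscr S,\mathcal L^2)$ be the space of those $\xi\in C_0^\infty([0,\infty),L^2)$ with $\sigma_n(\xi(nL))=\xi(L)$ for all $n\ge1$ and $L>0$. Let $\mathcal S_0^{\rm ev}$ be the space of real-valued even Schwartz functions $f$ on $\mathbb R$ with $f(0)=0=\int_{\mathbb R}f(x)\,dx$, and put $(\mathcal E f)(u)=u^{1/2}\sum_{n\ge1}f(nu)$ and $\Sigma\mathcal E(f)(L)(u)=\sum_{k\in\mathbb Z}(\mathcal E f)(\mu^k u)$. Let $H^0(\mathscr S,\overline{\Sigma\mathcal E})$ be the set of those $\xi\in H^0(\mathscr S,\mathcal L^2)$ which lie in the closure, in $C_0^\infty([0,\infty),L^2)$, of the space of finite sums $\sum_j h_j\,\Sigma\mathcal E(f_j)$ with $h_j\in C_0^\infty([0,\infty),\mathbb C)$,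 $f_j\in\mathcal S_0^{\rm ev}$. **Lemma.** (i) The map $$\gamma:H^0(\mathscr S,\mathcal L^2)\to C_0^\infty([0,\infty),\mathbb C)\times C_0^\infty([0,\infty),\mathbb C),\qquad \gamma(\xi)=\big(\hat\xi(\cdot,1),\hat\xi(\cdot,-1)\big),$$ is well defined and is an isomorphism of $\mathbb C$-vector spaces. (ii) One has $\gamma\big(H^0(\mathscr S,\overline{\Sigma\mathcal E})\big)=I_+\times I_-$, where $I_\pm$ is the closed ideal of $C_0^\infty([0,\infty),\mathbb C)$ generated by multiplication with the function $L\mapsto\zeta\left(\frac12\mp\frac{2\pi i}{L}\right)$ ($\zeta$ is the Riemann zeta function), i.e. the closure in the Fréchet topology of the set of functions $L\mapsto\zeta\left(\frac12\mp\frac{2\pi i}{L}\right)f(L)$, $f\in C_0^\infty([0,\infty),\mathbb C)$. -/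

import Mathlib

open MeasureTheory Set Filter Topology
open scoped ContDiff ENNReal NNReal

noncomputable section

namespace ScalingSite

/-! ## Smooth functions on `[0,∞)` that vanish with all derivatives at `0` -/

section Flat

variable {V W : Type*} [NormedAddCommGroup V] [NormedSpace ℂ V]
  [NormedAddCommGroup W] [NormedSpace ℂ W]

/-- The `m`-th derivative on the closed half-line `[0,∞)` (one-sided at `0`). The values of
`f ∘ Real.toNNReal` at negative numbers play no role, since the derivative is taken
within `Ici 0`. -/
def halfDeriv (m : ℕ) (f : ℝ≥0 → V) (L : ℝ≥0) : V :=
  iteratedDerivWithin m (f ∘ Real.toNNReal) (Ici (0 : ℝ)) (L : ℝ)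

/-- `f` is smooth on `[0,∞)`, and `f` and all its derivatives vanish at `0`. -/
def IsFlatSmooth (f : ℝ≥0 → V) : Prop :=
  ContDiffOn ℝ ∞ (f ∘ Real.toNNReal) (Ici (0 : ℝ)) ∧ ∀ m : ℕ, halfDeriv m f 0 = 0

theorem IsFlatSmooth.clm_comp {f : ℝ≥0 → V} (hf : IsFlatSmooth f) (A : V →L[ℝ] W) :
    IsFlatSmooth (fun L => A (f L)) := by
  refine ⟨A.contDiff.comp_contDiffOn hf.1, fun m => ?_⟩
  have h0 : (0 : ℝ) ∈ Ici (0 : ℝ) := by simp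
  have hc : ContDiffWithinAt ℝ (m : ℕ∞) (f ∘ Real.toNNReal) (Ici (0 : ℝ)) 0 :=
    (hf.1 0 h0).of_le (by exact_mod_cast le_top)
  have h1 := A.iteratedFDerivWithin_comp_left hc (uniqueDiffOn_Ici 0) h0 (i := m) le_rfl
  have h2 := hf.2 m
  simp only [halfDeriv, iteratedDerivWithin, NNReal.coe_zero] at h2 ⊢
  have h3 : ((fun L => A (f L)) ∘ Real.toNNReal) = A ∘ (f ∘ Real.toNNReal) := rfl
  rw [h3, h1, ContinuousLinearMap.compContinuousMultilinearMap_coe, Function.comp_apply, h2,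
    map_zero]

variable (V) in
/-- The space `C₀^∞([0,∞), V)`. -/
def C0inf : Submodule ℂ (ℝ≥0 → V) where
  carrier := {f | IsFlatSmooth f}
  zero_mem' := by
    have h : ((0 : ℝ≥0 → V) ∘ Real.toNNReal) = fun _ => (0 : V) := rfl
    refine ⟨by rw [h]; exact contDiffOn_const, fun m => ?_⟩
    rw [halfDeriv, h]
    simp [iteratedDerivWithin_fun_const_zero]
  add_mem' := by
    intro f g hf hg
    have h0 : (0 : ℝ) ∈ Ici (0 : ℝ) := by simp
    have h : ((f + g) ∘ Real.toNNReal) = (f ∘ Real.toNNReal) + (g ∘ Real.toNNReal) := rfl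
    refine ⟨by rw [h]; exact hf.1.add hg.1, fun m => ?_⟩
    have hf2 := hf.2 m
    have hg2 := hg.2 m
    simp only [halfDeriv, NNReal.coe_zero] at hf2 hg2 ⊢
    rw [h, iteratedDerivWithin_add h0 (uniqueDiffOn_Ici 0)
      ((hf.1 0 h0).of_le (by exact_mod_cast le_top))
      ((hg.1 0 h0).of_le (by exact_mod_cast le_top)), hf2, hg2, add_zero]
  smul_mem' := by
    intro c f hf
    exact hf.clm_comp (c • ContinuousLinearMap.id ℝ V)

/-- The Fréchet topology of `C₀^∞([0,∞), V)`: the one generated by the seminorms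
`p_K^{(n,m)}(f) = max_{L ∈ K} L^{-n} ‖∂^m f(L)‖`, with `K ⊂ [0,∞)` compact and `n, m ≥ 0`;
that is, the coarsest topology for which all the maps `f ↦ L^{-n} ∂^m f` are continuous into the
functions on `[0,∞)` with uniform convergence on compact sets.
(At `L = 0` the weighted derivative is read as its limit value `0`.) -/
abbrev frechetTopology : TopologicalSpace (C0inf V) :=
  ⨅ (n : ℕ) (m : ℕ), TopologicalSpace.induced
    (fun f : C0inf V => UniformOnFun.ofFun {K : Set ℝ≥0 | IsCompact K}
      (fun L : ℝ≥0 => (((L : ℝ)⁻¹ ^ n : ℝ) : ℂ) • halfDeriv m (f : ℝ≥0 → V) L))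
    inferInstance

end Flat

/-! ## The circles `C_μ`, `μ = exp L`, their `L²`-spaces and the covering maps -/

instance factPos (L : Ioi (0 : ℝ)) : Fact ((0 : ℝ) < (L : ℝ)) := ⟨L.2⟩

/-- The multiplication `L ↦ n L` on `(0,∞)`; if `μ = exp L` then `μ ^ n = exp (n L)`. -/
def scale (n : ℕ+) (L : Ioi (0 : ℝ)) : Ioi (0 : ℝ) :=
  ⟨(n : ℝ) * (L : ℝ), mul_pos (Nat.cast_pos.2 n.pos) (mem_Ioi.1 L.2)⟩

/-- The circle `C_μ = ℝ₊^* / μ^ℤ` of length `L = log μ`, in the logarithmic coordinate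
`x = log u`, in which it is `ℝ / Lℤ` and `d^*u = du / u` is the Lebesgue measure `dx`
(of total mass `L`). -/
abbrev Circ (L : Ioi (0 : ℝ)) : Type := AddCircle (L : ℝ)

/-- The Hilbert space `L²(C_μ)`, `μ = exp L`. -/
abbrev L2C (L : Ioi (0 : ℝ)) : Type := Lp ℂ 2 (volume : Measure (Circ L))

/-- The Hilbert space `ℓ²(ℤ)`. -/
abbrev ell2 : Type := lp (fun _ : ℤ => ℂ) 2

/-- The Fourier component `L^{-1/2} ∫_{C_μ} ξ(u) u^{-2πin/L} d^*u`; in the coordinate `x = log u`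
the character `u^{-2πin/L}` is `exp (-2πi n x / L) = fourier (-n) x`. -/
def fourierComp (L : Ioi (0 : ℝ)) (ξ : L2C L) (n : ℤ) : ℂ :=
  (((Real.sqrt (L : ℝ))⁻¹ : ℝ) : ℂ) * ∫ x : Circ L, fourier (-n) x * ξ x

theorem fourierComp_add (L : Ioi (0 : ℝ)) (ξ η : L2C L) (n : ℤ) :
    fourierComp L (ξ + η) n = fourierComp L ξ n + fourierComp L η n := by
  have hi : ∀ ζ : L2C L, Integrable (fun x : Circ L => fourier (-n) x * ζ x) := by
    intro ζ
    have h : Integrable (ζ : Circ L → ℂ) := (Lp.memLp ζ).integrable (by norm_num)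
    refine h.bdd_mul (c := 1) (map_continuous (fourier (-n))).aestronglyMeasurable ?_
    exact ae_of_all _ fun x => by simp only [fourier_apply, Circle.norm_coe, le_refl]
  rw [fourierComp, fourierComp, fourierComp, ← mul_add, ← integral_add (hi ξ) (hi η)]
  congr 1
  refine integral_congr_ae ?_
  filter_upwards [Lp.coeFn_add ξ η] with x hx
  rw [hx, Pi.add_apply, mul_add]

theorem fourierComp_smul (L : Ioi (0 : ℝ)) (c : ℂ) (ξ : L2C L) (n : ℤ) :
    fourierComp L (c • ξ) n = c * fourierComp L ξ n := by
  rw [fourierComp, fourierComp, mul_left_comm,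
    ← MeasureTheory.integral_const_mul c (fun x : Circ L => fourier (-n) x * ξ x)]
  congr 1
  refine integral_congr_ae ?_
  filter_upwards [Lp.coeFn_smul c ξ] with x hx
  rw [hx, Pi.smul_apply, smul_eq_mul, mul_left_comm]

theorem memℓp_fourierComp (L : Ioi (0 : ℝ)) (ξ : L2C L) : Memℓp (fourierComp L ξ) 2 := by
  have hm : MemLp (ξ : Circ L → ℂ) 2 (AddCircle.haarAddCircle) :=
    memLp_haarAddCircle_iff.2 (Lp.memLp ξ)
  have h1 : Memℓp (fun n => fourierBasis.repr hm.toLp n) 2 := lp.memℓp _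
  have hL : (0 : ℝ) < L := L.2
  have h2 : fourierComp L ξ
      = (((Real.sqrt (L : ℝ))⁻¹ * (L : ℝ) : ℝ) : ℂ) • (fun n => fourierBasis.repr hm.toLp n) := by
    funext n
    rw [Pi.smul_apply, fourierBasis_repr, fourierCoeff_congr_ae hm.coeFn_toLp, fourierCoeff,
      AddCircle.integral_haarAddCircle, fourierComp, Complex.real_smul, smul_eq_mul]
    simp only [smul_eq_mul]
    rw [← mul_assoc, ← Complex.ofReal_mul, mul_assoc, mul_inv_cancel₀ hL.ne', mul_one]
  rw [h2]
  exact h1.const_smul _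

/-- The multiplicative Fourier transform `L²(C_μ) → ℓ²(ℤ)`. -/
def fourierTransform (L : Ioi (0 : ℝ)) : L2C L →ₗ[ℂ] ell2 where
  toFun ξ := ⟨fourierComp L ξ, memℓp_fourierComp L ξ⟩
  map_add' ξ η := by
    ext n
    exact fourierComp_add L ξ η n
  map_smul' c ξ := by
    ext n
    exact fourierComp_smul L c ξ n

theorem sum_shift_periodic (n : ℕ+) (L : Ioi (0 : ℝ)) (g : Circ (scale n L) → ℂ) :
    Function.Periodic
      (fun y : ℝ => ∑ j ∈ Finset.Icc 1 (n : ℕ), g ((y + j * (L : ℝ) : ℝ) : Circ (scale n L)))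
      (L : ℝ) := by
  intro y
  have h1 : ∀ N : ℕ, ∀ G : ℕ → ℂ,
      ∑ j ∈ Finset.Icc 1 N, G j = ∑ j ∈ Finset.range N, G (j + 1) := by
    intro N G
    rw [Finset.range_eq_Ico, Finset.sum_Ico_add' G 0 N 1]
    rfl
  simp only [h1]
  have h2 : ∀ j : ℕ, y + (L : ℝ) + ((j + 1 : ℕ) : ℝ) * (L : ℝ)
      = y + (((j + 1) + 1 : ℕ) : ℝ) * (L : ℝ) := by
    intro j; push_cast; ring
  simp only [h2]
  have h3 := Finset.sum_range_succ
    (fun j : ℕ => g ((y + ((j + 1 : ℕ) : ℝ) * (L : ℝ) : ℝ) : Circ (scale n L))) (n : ℕ)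
  have h4 := Finset.sum_range_succ'
    (fun j : ℕ => g ((y + ((j + 1 : ℕ) : ℝ) * (L : ℝ) : ℝ) : Circ (scale n L))) (n : ℕ)
  have h5 : ((y + (((n : ℕ) + 1 : ℕ) : ℝ) * (L : ℝ) : ℝ) : Circ (scale n L))
      = ((y + ((0 + 1 : ℕ) : ℝ) * (L : ℝ) : ℝ) : Circ (scale n L)) := by
    have : y + (((n : ℕ) + 1 : ℕ) : ℝ) * (L : ℝ)
        = y + ((0 + 1 : ℕ) : ℝ) * (L : ℝ) + (scale n L : ℝ) := by
      simp only [scale]; push_cast; ring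
    rw [this, AddCircle.coe_add_period]
  rw [h3, h5] at h4
  exact (add_right_cancel h4).symm

/-- `σ_n(g)(u) = ∑_{j=1}^n g(μ^j u)` for a function `g` on `C_{μ^n}`, as a function on `C_μ`
(additively, `μ^j u` has logarithmic coordinate `y + j L`). -/
def sigmaFun (n : ℕ+) (L : Ioi (0 : ℝ)) (g : Circ (scale n L) → ℂ) : Circ L → ℂ :=
  (sum_shift_periodic n L g).lift

/-- A local inverse of the covering `C_{μ^n} → C_μ`. -/
def sheet (n : ℕ+) (L : Ioi (0 : ℝ)) (j : ℕ) (x : Circ L) : Circ (scale n L) :=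
  (((AddCircle.equivIoc (L : ℝ) 0 x : ℝ) + j * (L : ℝ) : ℝ) : Circ (scale n L))

theorem sigmaFun_eq (n : ℕ+) (L : Ioi (0 : ℝ)) (g : Circ (scale n L) → ℂ) (x : Circ L) :
    sigmaFun n L g x = ∑ j ∈ Finset.Icc 1 (n : ℕ), g (sheet n L j x) := by
  have hx : ((AddCircle.equivIoc (L : ℝ) 0 x : ℝ) : Circ L) = x :=
    (AddCircle.equivIoc (L : ℝ) 0).symm_apply_apply x
  conv_lhs => rw [← hx]
  rfl

theorem measurable_sheet (n : ℕ+) (L : Ioi (0 : ℝ)) (j : ℕ) : Measurable (sheet n L j) := by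
  have h1 : Measurable (AddCircle.equivIoc (L : ℝ) 0) :=
    (AddCircle.measurableEquivIoc (L : ℝ) 0).measurable
  exact AddCircle.measurable_mk'.comp ((measurable_subtype_coe.comp h1).add_const _)

theorem map_sheet_le (n : ℕ+) (L : Ioi (0 : ℝ)) (j : ℕ) :
    Measure.map (sheet n L j) volume ≤ (volume : Measure (Circ (scale n L))) := by
  have hL : (0 : ℝ) < L := L.2
  have hle : (L : ℝ) ≤ (scale n L : ℝ) := by
    have : (1 : ℝ) ≤ (n : ℝ) := by exact_mod_cast n.pos
    simp only [scale]; nlinarith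
  have e1 : Measurable (AddCircle.equivIoc (L : ℝ) 0) :=
    (AddCircle.measurableEquivIoc (L : ℝ) 0).measurable
  have h1 : MeasurePreserving (fun x : Circ L => (AddCircle.equivIoc (L : ℝ) 0 x : ℝ)) volume
      (volume.restrict (Ioc (0 : ℝ) (0 + L))) := by
    have a := AddCircle.measurePreserving_equivIoc (L : ℝ) (a := 0)
    have b : MeasurePreserving (Subtype.val : Ioc (0 : ℝ) (0 + L) → ℝ)
        (Measure.comap Subtype.val volume) (volume.restrict (Ioc (0 : ℝ) (0 + L))) :=
      ⟨measurable_subtype_coe, map_comap_subtype_coe measurableSet_Ioc _⟩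
    exact b.comp a
  have h2 : MeasurePreserving (fun y : ℝ => y + j * (L : ℝ))
      (volume.restrict (Ioc (0 : ℝ) (0 + L)))
      (volume.restrict (Ioc (j * (L : ℝ)) (j * (L : ℝ) + L))) := by
    have a := (measurePreserving_add_right (volume : Measure ℝ) (j * (L : ℝ))).restrict_preimage
      (measurableSet_Ioc (a := (j * (L : ℝ))) (b := (j * (L : ℝ) + L)))
    have : (fun y : ℝ => y + j * (L : ℝ)) ⁻¹' (Ioc (j * (L : ℝ)) (j * (L : ℝ) + L))
        = Ioc (0 : ℝ) (0 + L) := by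
      ext y
      simp only [mem_preimage, mem_Ioc]
      constructor <;> rintro ⟨h, h'⟩ <;> constructor <;> linarith
    rwa [this] at a
  have h3 := AddCircle.measurePreserving_mk (scale n L : ℝ) (j * (L : ℝ))
  have h12 := h2.comp h1
  have hs : sheet n L j = (fun y : ℝ => (y : Circ (scale n L)))
      ∘ ((fun y : ℝ => y + j * (L : ℝ)) ∘
        fun x : Circ L => (AddCircle.equivIoc (L : ℝ) 0 x : ℝ)) := rfl
  rw [hs, ← Measure.map_map AddCircle.measurable_mk' h12.measurable, h12.map_eq]
  calc Measure.map (fun y : ℝ => (y : Circ (scale n L)))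
        (volume.restrict (Ioc (j * (L : ℝ)) (j * (L : ℝ) + L)))
      ≤ Measure.map (fun y : ℝ => (y : Circ (scale n L)))
        (volume.restrict (Ioc (j * (L : ℝ)) (j * (L : ℝ) + (scale n L : ℝ)))) :=
        Measure.map_mono
          (Measure.restrict_mono (Ioc_subset_Ioc_right (by linarith)) le_rfl)
          AddCircle.measurable_mk'
    _ = volume := h3.map_eq

theorem sigmaFun_congr (n : ℕ+) (L : Ioi (0 : ℝ)) {g h : Circ (scale n L) → ℂ}
    (hgh : g =ᵐ[volume] h) : sigmaFun n L g =ᵐ[volume] sigmaFun n L h := by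
  have h1 : ∀ j : ℕ, ∀ᵐ x : Circ L, g (sheet n L j x) = h (sheet n L j x) := fun j =>
    ae_of_ae_map (measurable_sheet n L j).aemeasurable
      (Measure.absolutelyContinuous_of_le (map_sheet_le n L j) hgh)
  filter_upwards [ae_all_iff.2 h1] with x hx
  simp only [sigmaFun_eq, hx]

theorem memLp_sigmaFun (n : ℕ+) (L : Ioi (0 : ℝ)) {g : Circ (scale n L) → ℂ}
    (hg : MemLp g 2 volume) : MemLp (sigmaFun n L g) 2 volume := by
  have h1 : sigmaFun n L g = fun x => ∑ j ∈ Finset.Icc 1 (n : ℕ), (g ∘ sheet n L j) x :=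
    funext fun x => sigmaFun_eq n L g x
  rw [h1]
  refine memLp_finsetSum _ fun j _ => ?_
  exact (hg.mono_measure (map_sheet_le n L j)).comp_of_map (measurable_sheet n L j).aemeasurable

/-- The linear map `σ_n : L²(C_{μ^n}) → L²(C_μ)`, `σ_n(ξ)(u) = ∑_{j=1}^n ξ(μ^j u)`. -/
def sigma (n : ℕ+) (L : Ioi (0 : ℝ)) : L2C (scale n L) →ₗ[ℂ] L2C L where
  toFun ξ := (memLp_sigmaFun n L (Lp.memLp ξ)).toLp
  map_add' ξ η := by
    rw [← MemLp.toLp_add]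
    refine MemLp.toLp_congr _ _ ?_
    refine (sigmaFun_congr n L (Lp.coeFn_add ξ η)).trans (ae_of_all _ fun x => ?_)
    simp [sigmaFun_eq, Finset.sum_add_distrib]
  map_smul' c ξ := by
    rw [RingHom.id_apply, ← MemLp.toLp_const_smul]
    refine MemLp.toLp_congr _ _ ?_
    refine (sigmaFun_congr n L (Lp.coeFn_smul c ξ)).trans (ae_of_all _ fun x => ?_)
    simp [sigmaFun_eq, Finset.mul_sum]

/-! ## The global sections of `ℒ²` -/

/-- A family `ξ(L) ∈ L²(C_{exp L})`, `L > 0`, seen through the Fourier transform as a section over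
`[0,∞)` of the trivial bundle `[0,∞) × ℓ²(ℤ)`, with value `0` at `L = 0`. -/
def hat : (∀ L : Ioi (0 : ℝ), L2C L) →ₗ[ℂ] (ℝ≥0 → ell2) where
  toFun ξ L := if h : (0 : ℝ) < (L : ℝ) then fourierTransform ⟨L, h⟩ (ξ ⟨L, h⟩) else 0
  map_add' ξ η := by
    funext L
    by_cases h : (0 : ℝ) < (L : ℝ)
    · simp only [h, dif_pos, Pi.add_apply, map_add]
    · simp only [h, dif_neg, not_false_eq_true, Pi.add_apply, add_zero]
  map_smul' c ξ := by
    funext L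
    by_cases h : (0 : ℝ) < (L : ℝ)
    · simp only [h, dif_pos, Pi.smul_apply, map_smul, RingHom.id_apply]
    · simp only [h, dif_neg, not_false_eq_true, Pi.smul_apply, smul_zero, RingHom.id_apply]

/-- The space `C₀^∞([0,∞), L²)` of smooth global sections of the bundle `L²` that vanish, with all
their derivatives, at `L = 0`; these are the sections over `[0,∞)` of the sheaf `ℒ²`.
(The value at `L = 0` being zero, a section is given by its values for `L > 0`.) -/
def L2Sections : Submodule ℂ (∀ L : Ioi (0 : ℝ), L2C L) := (C0inf ell2).comap hat

/-- The section `L ↦ (ξ̂(L,n))_n` of `[0,∞) × ℓ²(ℤ)` attached to a section `ξ` of `ℒ²`. -/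
def trivialize (ξ : L2Sections) : C0inf ell2 := ⟨hat ξ, ξ.2⟩

/-- The Fréchet topology of `C₀^∞([0,∞), L²)`, with seminorms
`max_{L ∈ K} L^{-n} ‖∂_L^m ξ(L)‖_{L²}`. -/
abbrev sectionsTopology : TopologicalSpace L2Sections :=
  TopologicalSpace.induced trivialize frechetTopology

/-- `H⁰(𝒮, ℒ²)`: the global sections `ξ` of `ℒ²` over `[0,∞)` that are invariant under the action
`(n · ξ)(L) = σ_n(ξ(nL))` of the monoid `ℕ^×`. -/
def H0 : Submodule ℂ L2Sections where
  carrier := {ξ | ∀ (n : ℕ+) (L : Ioi (0 : ℝ)), sigma n L (ξ.1 (scale n L)) = ξ.1 L}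
  zero_mem' := fun n L => map_zero (sigma n L)
  add_mem' := by
    intro ξ η hξ hη n L
    have := map_add (sigma n L) (ξ.1 (scale n L)) (η.1 (scale n L))
    rw [hξ n L, hη n L] at this
    exact this
  smul_mem' := by
    intro c ξ hξ n L
    have := map_smul (sigma n L) c (ξ.1 (scale n L))
    rw [hξ n L] at this
    exact this

/-- The component function `L ↦ ξ̂(L,n)` of a section of `ℒ²`, as a linear map
`C₀^∞([0,∞), L²) → C₀^∞([0,∞), ℂ)`. -/
def component (n : ℤ) : L2Sections →ₗ[ℂ] C0inf ℂ where
  toFun ξ := ⟨fun L => hat ξ.1 L n,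
    IsFlatSmooth.clm_comp (f := hat ξ.1) ξ.2
      (((lp.evalCLM ℂ (fun _ : ℤ => ℂ) 2 n).restrictScalars ℝ))⟩
  map_add' ξ η := by
    ext L
    change (hat (ξ.1 + η.1) L) n = _
    rw [map_add]; rfl
  map_smul' c ξ := by
    ext L
    change (hat (c • ξ.1) L) n = _
    rw [map_smul]; rfl

/-- The map `γ(ξ) = (ξ̂(·,1), ξ̂(·,-1))` on `H⁰(𝒮, ℒ²)`. -/
def gamma : H0 →ₗ[ℂ] C0inf ℂ × C0inf ℂ :=
  ((component 1).prod (component (-1))).comp H0.subtype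

/-! ## The subsheaf generated by `Σ ℰ` -/

/-- Real-valued even Schwartz functions `f` on `ℝ` with `f(0) = 0 = ∫ f`. -/
def SchwartzEvenZero : Set (SchwartzMap ℝ ℝ) :=
  {f | (∀ x : ℝ, f (-x) = f x) ∧ f 0 = 0 ∧ ∫ x : ℝ, f x = 0}

/-- `(ℰ f)(u) = u^{1/2} ∑_{n ≥ 1} f(n u)`, for `u > 0`. -/
def mapE (f : SchwartzMap ℝ ℝ) (u : ℝ) : ℂ :=
  ((Real.sqrt u * ∑' n : ℕ+, f ((n : ℝ) * u) : ℝ) : ℂ)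

/-- `(Σ_μ g)(u) = ∑_{k ∈ ℤ} g(μ^k u)`. -/
def SigmaMu (μ : ℝ) (g : ℝ → ℂ) (u : ℝ) : ℂ := ∑' k : ℤ, g (μ ^ k * u)

theorem SigmaMu_exp_periodic (L : ℝ) (g : ℝ → ℂ) :
    Function.Periodic (fun y : ℝ => SigmaMu (Real.exp L) g (Real.exp y)) L := by
  intro y
  simp only [SigmaMu]
  rw [← (Equiv.addRight (1 : ℤ)).tsum_eq fun k : ℤ => g (Real.exp L ^ k * Real.exp y)]
  refine tsum_congr fun k => ?_
  rw [Equiv.coe_addRight, zpow_add₀ (Real.exp_pos L).ne', zpow_one, Real.exp_add]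
  congr 1
  ring

/-- The function `Σ_μ ℰ(f)` on the circle `C_μ`, `μ = exp L` (with `u = exp y`). -/
def SigmaE (f : SchwartzMap ℝ ℝ) (L : Ioi (0 : ℝ)) : Circ L → ℂ :=
  (SigmaMu_exp_periodic (L : ℝ) (mapE f)).lift

/-- The module of the sections of `ℒ²` over `[0,∞)` that are finite sums of products
`h · Σℰ(f)`, with `h ∈ C₀^∞([0,∞), ℂ)` and `f` a real even Schwartz function with
`f(0) = 0 = ∫ f`. -/
def SigmaESpan : Submodule ℂ L2Sections :=
  Submodule.span ℂ {ξ : L2Sections | ∃ h : C0inf ℂ, ∃ f ∈ SchwartzEvenZero,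
    ∀ L : Ioi (0 : ℝ), (ξ.1 L : Circ L → ℂ) =ᵐ[volume]
      fun x => h.1 ⟨(L : ℝ), le_of_lt L.2⟩ * SigmaE f L x}

/-- The sections over `[0,∞)` of the closed subsheaf generated by `Σℰ`: the closure of the sums of
products `h · Σℰ(f)` in the Fréchet space `C₀^∞([0,∞), L²)`. -/
def SigmaEClosure : Set L2Sections := closure[sectionsTopology] (SigmaESpan : Set L2Sections)

/-- The `ℕ^×`-invariant global sections of the closed subsheaf generated by `Σℰ`, as a
subset of `H⁰(𝒮, ℒ²)`. -/
def H0SigmaE : Set H0 := {ξ | (ξ : L2Sections) ∈ SigmaEClosure}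

/-! ## The ideals generated by the zeta function -/

/-- The multiples `f · ζ(1/2 - 2πi e / L)`, `f ∈ C₀^∞([0,∞), ℂ)`, in `C₀^∞([0,∞), ℂ)`. -/
def zetaMultiples (e : ℤ) : Set (C0inf ℂ) :=
  {g | ∃ f : C0inf ℂ, ∀ L : ℝ≥0, 0 < L →
    g.1 L = riemannZeta (1 / 2 - 2 * (Real.pi : ℂ) * Complex.I * (e : ℂ) / ((L : ℝ) : ℂ)) * f.1 L}

/-- The closed ideal of `C₀^∞([0,∞), ℂ)` generated by the multiplication with
`ζ(1/2 - 2πi e / L)`. -/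
def zetaClosedIdeal (e : ℤ) : Set (C0inf ℂ) := closure[frechetTopology] (zetaMultiples e)

end ScalingSite

end

/-!
Write `s = 1/2 - 2πik/L`. Everything is read off the Fourier components `ξ̂(L,k)`.

*The map `γ` is bijective.* Integrating over the sheets of the covering `C_{μ^n} → C_μ`, one sees
that the component of index `k` of `σ_n ξ` is `n^{1/2}` times the component of index `nk` of `ξ`
(`fourierComp_sigma`). So `ξ` is invariant if and only if `ξ̂(L,k) = n^{1/2} ξ̂(nL,nk)` for all
`n`. The components of index `±n` are thus dilates of those of index `±1`, and `ξ̂(L,0) = n^{1/2}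
ξ̂(nL,0)` forces the component of index `0` to vanish, since `ξ̂(·,0)` is bounded near `0`.
Conversely the dilates of two flat functions form a smooth flat section, because the flatness
gives the decay in `k` that is needed for convergence in `ℓ²(ℤ)` (`isSummableFamily_dilates`).

*The components of the closed span lie in the closed ideals.* Unfolding the sum over `μ^ℤ`, the
component of index `k` of `Σℰ(f)` is `L^{-1/2}` times the Mellin transform of `∑_n f(nu)` at `s`.
For `re s > 1` the latter is `ζ(s)` times the Mellin transform of `f`, and this persists on the
critical line by analytic continuation, since `∫ f = 0` keeps `∑_n f(nu)` bounded as `u → 0`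
(`mellin_dilateSum`, `norm_dilateSum_schwartz_le`). The Mellin transform of `f` and its
derivatives grow at most polynomially on the critical line, so that multiplication by `L ↦
L^{-1/2} (Mellin f)(1/2 - 2πie/L)` preserves flat functions (`isFlat_mulExt`). Hence `h · Σℰ(f)`
has components in the multiples of `ζ`; pass to the closure by continuity.

*The closed ideals are attained.* By continuity of the dilation map and density it suffices to
treat the section attached to `ζ(1/2 - 2πie/L) h(L)` with `h` supported in a compact subset of
`(0,∞)`. For bounded `L` only finitely many of its components are nonzero, so one may consider a
single component of index `k`, namely `φ(L) ζ(s)` with `φ` of compact support in `(0,∞)`. Taking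
for `f` the derivative of `u^{1/2} g(log u)`, with `g` smooth of compact support, gives a section
`h · Σℰ(f)` with components `h(L) L^{-1/2} (1 - s) ζ(s) ĝ(k/L)`. Smooth functions of compact
support are dense in the Schwartz space and `(1 - s) ζ(s)` grows at most polynomially on the
critical line (`hasTemperateGrowth_zetaSymbol`), so the closed span contains all the sections with
components `h(L) (1 - s) ζ(s) P(k/L)`, `P` a Schwartz function (`sample_zetaMul_mem_spanClosure`).
If the support of `h` is short, a bump function `P` separates the points `k/L` from the `j/L` with
`j ≠ k`, and cutting `φ` into short pieces yields the claim (`exists_single_mem`).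
-/

noncomputable section

namespace ScalingSite

open scoped FourierTransform

/-! ### Flat functions on the real line -/

section FlatFunctions

variable {V W : Type*} [NormedAddCommGroup V]

/-- The extension by zero of a function on `[0,∞)` to the real line. -/
def zeroExt (f : ℝ≥0 → V) (x : ℝ) : V := if 0 ≤ x then f x.toNNReal else 0

theorem zeroExt_coe (f : ℝ≥0 → V) (L : ℝ≥0) : zeroExt f L = f L := by
  simp [zeroExt]

theorem zeroExt_add (f g : ℝ≥0 → V) : zeroExt (f + g) = zeroExt f + zeroExt g := by
  funext x; by_cases hx : 0 ≤ x <;> simp [zeroExt, hx]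

theorem zeroExt_sub (f g : ℝ≥0 → V) : zeroExt (f - g) = zeroExt f - zeroExt g := by
  funext x; by_cases hx : 0 ≤ x <;> simp [zeroExt, hx]

variable [NormedSpace ℂ V] [NormedAddCommGroup W] [NormedSpace ℂ W]

/-- A smooth function on `ℝ` that vanishes on `(-∞, 0]`. Extension by zero identifies
`C₀^∞([0,∞), V)` with the space of these functions. -/
def IsFlat (F : ℝ → V) : Prop := ContDiff ℝ ∞ F ∧ ∀ x ≤ 0, F x = 0

theorem iteratedDeriv_of_hasDerivAt_succ {D : ℕ → ℝ → V}
    (h : ∀ m x, HasDerivAt (D m) (D (m + 1) x) x) (m : ℕ) : iteratedDeriv m (D 0) = D m := by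
  induction m with
  | zero => simp
  | succ m ih =>
    rw [iteratedDeriv_succ, ih]
    exact funext fun x => (h m x).deriv

theorem contDiff_of_hasDerivAt_succ {D : ℕ → ℝ → V}
    (h : ∀ m x, HasDerivAt (D m) (D (m + 1) x) x) : ContDiff ℝ ∞ (D 0) := by
  refine contDiff_of_differentiable_iteratedDeriv fun m _ => ?_
  rw [iteratedDeriv_of_hasDerivAt_succ h]
  exact fun x => (h m x).differentiableAt

theorem IsFlat.iteratedDeriv_nonpos {F : ℝ → V} (hF : IsFlat F) (m : ℕ) {x : ℝ} (hx : x ≤ 0) :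
    iteratedDeriv m F x = 0 := by
  have hc : Continuous (iteratedDeriv m F) :=
    hF.1.continuous_iteratedDeriv m (by exact_mod_cast le_top)
  have h1 : EqOn (iteratedDeriv m F) 0 (Iio 0) := by
    intro y hy
    have h2 : F =ᶠ[𝓝 y] fun _ => (0 : V) := by
      filter_upwards [Iio_mem_nhds hy] with z hz
      exact hF.2 z (le_of_lt hz)
    rw [(h2.iteratedDeriv m).eq_of_nhds]
    simp
  have h3 := h1.closure hc continuous_const
  rw [closure_Iio] at h3
  exact h3 hx

theorem IsFlat.iteratedDeriv {F : ℝ → V} (hF : IsFlat F) (m : ℕ) :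
    IsFlat (iteratedDeriv m F) := by
  refine ⟨?_, fun x hx => hF.iteratedDeriv_nonpos m hx⟩
  rw [iteratedDeriv_eq_iterate]
  exact hF.1.iterate_deriv m

theorem IsFlat.deriv {F : ℝ → V} (hF : IsFlat F) : IsFlat (deriv F) := by
  have := hF.iteratedDeriv 1
  rwa [iteratedDeriv_one] at this

theorem IsFlat.hasDerivAt_iteratedDeriv {F : ℝ → V} (hF : IsFlat F) (m : ℕ) (x : ℝ) :
    HasDerivAt (_root_.iteratedDeriv m F) (_root_.iteratedDeriv (m + 1) F x) x := by
  rw [iteratedDeriv_succ]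
  exact ((hF.iteratedDeriv m).1.differentiable (by simp) x).hasDerivAt

/-- A flat function is `O(x ^ a)` on bounded intervals, for every `a`. -/
theorem IsFlat.bound {F : ℝ → V} (hF : IsFlat F) (a : ℕ) (R : ℝ) :
    ∃ C, 0 ≤ C ∧ ∀ x, 0 ≤ x → x ≤ R → ‖F x‖ ≤ C * x ^ a := by
  induction a generalizing F with
  | zero =>
    obtain ⟨C, hC⟩ := isCompact_Icc.exists_bound_of_continuousOn
      (hF.1.continuous.continuousOn (s := Icc 0 R))
    refine ⟨max C 0, le_max_right _ _, fun x h0 hR => ?_⟩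
    rw [pow_zero, mul_one]
    exact (hC x ⟨h0, hR⟩).trans (le_max_left _ _)
  | succ a ih =>
    obtain ⟨C, hC0, hC⟩ := ih hF.deriv
    refine ⟨C, hC0, fun x h0 hR => ?_⟩
    have h1 := (convex_Icc 0 x).norm_image_sub_le_of_norm_deriv_le (f := F) (C := C * x ^ a)
      (fun y _ => hF.1.differentiable (by simp) y)
      (fun y hy => (hC y hy.1 (hy.2.trans hR)).trans
        (mul_le_mul_of_nonneg_left (pow_le_pow_left₀ hy.1 hy.2 a) hC0))
      (left_mem_Icc.2 h0) (right_mem_Icc.2 h0)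
    rw [hF.2 0 le_rfl, sub_zero, sub_zero, Real.norm_of_nonneg h0, mul_assoc, ← pow_succ] at h1
    exact h1

theorem IsFlat.halfDeriv_coe {F : ℝ → V} (hF : IsFlat F) (m : ℕ) (L : ℝ≥0) :
    halfDeriv m (fun L : ℝ≥0 => F L) L = _root_.iteratedDeriv m F L := by
  have h1 : EqOn ((fun L : ℝ≥0 => F L) ∘ Real.toNNReal) F (Ici 0) := by
    intro x hx
    simp [Real.coe_toNNReal x hx]
  rw [halfDeriv, iteratedDerivWithin_congr h1 (mem_Ici.2 L.coe_nonneg)]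
  exact iteratedDerivWithin_eq_iteratedDeriv (uniqueDiffOn_Ici 0)
    (hF.1.contDiffAt.of_le (by exact_mod_cast le_top)) (mem_Ici.2 L.coe_nonneg)

theorem IsFlat.isFlatSmooth {F : ℝ → V} (hF : IsFlat F) :
    IsFlatSmooth (fun L : ℝ≥0 => F L) := by
  refine ⟨hF.1.contDiffOn.congr fun x hx => ?_, fun m => ?_⟩
  · simp [Real.coe_toNNReal x hx]
  · rw [hF.halfDeriv_coe]
    exact hF.iteratedDeriv_nonpos m le_rfl

/-- The derivatives from the right of `f` at `0` vanish, hence agree with those from the left of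
the extension by zero. -/
theorem hasDerivAt_zeroExt_halfDeriv {f : ℝ≥0 → V} (hf : IsFlatSmooth f) (m : ℕ) (x : ℝ) :
    HasDerivAt (zeroExt (halfDeriv m f)) (zeroExt (halfDeriv (m + 1) f) x) x := by
  set G := fun m => iteratedDerivWithin m (f ∘ Real.toNNReal) (Ici (0 : ℝ)) with hG
  have hG1 : ∀ m, EqOn (zeroExt (halfDeriv m f)) (G m) (Ici 0) := by
    intro m y hy
    simp only [zeroExt, if_pos (mem_Ici.1 hy), halfDeriv, Real.coe_toNNReal y hy, hG]
  have hR : ∀ y ∈ Ici (0 : ℝ), HasDerivWithinAt (zeroExt (halfDeriv m f))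
      (zeroExt (halfDeriv (m + 1) f) y) (Ici 0) y := by
    intro y hy
    have h1 : DifferentiableWithinAt ℝ (G m) (Ici 0) y :=
      hf.1.differentiableOn_iteratedDerivWithin (by exact_mod_cast WithTop.coe_lt_top _)
        (uniqueDiffOn_Ici 0) y hy
    rw [hG1 (m + 1) hy]
    simp only [hG]
    rw [iteratedDerivWithin_succ]
    exact h1.hasDerivWithinAt.congr (hG1 m) (hG1 m hy)
  have hz : ∀ m, ∀ y ≤ 0, zeroExt (halfDeriv m f) y = 0 := by
    intro m y hy
    rcases hy.lt_or_eq with h | h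
    · simp [zeroExt, not_le.2 h]
    · subst h
      simp [zeroExt, hf.2 m]
  have hL : ∀ y ≤ 0, HasDerivWithinAt (zeroExt (halfDeriv m f))
      (zeroExt (halfDeriv (m + 1) f) y) (Iic 0) y := by
    intro y hy
    rw [hz (m + 1) y hy]
    exact (hasDerivWithinAt_const y (Iic 0) (0 : V)).congr (fun z hz' => hz m z hz') (hz m y hy)
  rcases lt_trichotomy x 0 with h | h | h
  · exact (hL x h.le).hasDerivAt (Iic_mem_nhds h)
  · subst h
    have := (hR 0 self_mem_Ici).union (hL 0 le_rfl)
    rwa [Ici_union_Iic, hasDerivWithinAt_univ] at this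
  · exact (hR x h.le).hasDerivAt (Ici_mem_nhds h)

theorem zeroExt_halfDeriv_zero (f : ℝ≥0 → V) : zeroExt (halfDeriv 0 f) = zeroExt f := by
  funext x
  by_cases hx : 0 ≤ x
  · simp [zeroExt, hx, halfDeriv]
  · simp [zeroExt, hx]

theorem IsFlatSmooth.isFlat_zeroExt {f : ℝ≥0 → V} (hf : IsFlatSmooth f) :
    IsFlat (zeroExt f) := by
  have h := contDiff_of_hasDerivAt_succ (D := fun m => zeroExt (halfDeriv m f))
    (hasDerivAt_zeroExt_halfDeriv hf)
  simp only [zeroExt_halfDeriv_zero] at h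
  refine ⟨h, fun x hx => ?_⟩
  rcases hx.lt_or_eq with h | h
  · simp [zeroExt, not_le.2 h]
  · have h2 := hf.2 0
    rw [← zeroExt_halfDeriv_zero, h]
    simp [zeroExt, h2]

theorem IsFlatSmooth.halfDeriv_eq {f : ℝ≥0 → V} (hf : IsFlatSmooth f) (m : ℕ) (L : ℝ≥0) :
    halfDeriv m f L = iteratedDeriv m (zeroExt f) L := by
  have h := iteratedDeriv_of_hasDerivAt_succ (D := fun m => zeroExt (halfDeriv m f))
    (hasDerivAt_zeroExt_halfDeriv hf) m
  simp only [zeroExt_halfDeriv_zero] at h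
  rw [h, zeroExt_coe]

/-- The element of `C₀^∞([0,∞), V)` given by a flat function on `ℝ`. -/
def IsFlat.toC0inf {F : ℝ → V} (hF : IsFlat F) : C0inf V := ⟨fun L => F L, hF.isFlatSmooth⟩

theorem IsFlat.zeroExt_toC0inf {F : ℝ → V} (hF : IsFlat F) : zeroExt hF.toC0inf.1 = F := by
  funext x
  by_cases hx : 0 ≤ x
  · simp [zeroExt, hx, IsFlat.toC0inf]
  · simp [zeroExt, hx, hF.2 x (not_le.1 hx).le]

theorem isFlat_zeroExt (f : C0inf V) : IsFlat (zeroExt f.1) := IsFlatSmooth.isFlat_zeroExt f.2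

/-! ### Convergence in the Fréchet topology -/

/-- `L ^ (-n) * ‖∂ᵐ f (L)‖`, the quantity whose suprema over `(0, R]` are the seminorms that define
the Fréchet topology. -/
def weightedDeriv (n m : ℕ) (f : C0inf V) (L : ℝ) : ℝ :=
  L⁻¹ ^ n * ‖iteratedDeriv m (zeroExt f.1) L‖

theorem iteratedDeriv_zeroExt_add (m : ℕ) (f g : C0inf V) (L : ℝ) :
    iteratedDeriv m (zeroExt (f + g).1) L
      = iteratedDeriv m (zeroExt f.1) L + iteratedDeriv m (zeroExt g.1) L := by
  have : (f + g).1 = f.1 + g.1 := rfl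
  rw [this, zeroExt_add, iteratedDeriv_add]
  · exact (isFlat_zeroExt f).1.contDiffAt.of_le (by exact_mod_cast le_top)
  · exact (isFlat_zeroExt g).1.contDiffAt.of_le (by exact_mod_cast le_top)

theorem iteratedDeriv_zeroExt_sub (m : ℕ) (f g : C0inf V) (L : ℝ) :
    iteratedDeriv m (zeroExt (f - g).1) L
      = iteratedDeriv m (zeroExt f.1) L - iteratedDeriv m (zeroExt g.1) L := by
  have : (f - g).1 = f.1 - g.1 := rfl
  rw [this, zeroExt_sub, iteratedDeriv_sub]
  · exact (isFlat_zeroExt f).1.contDiffAt.of_le (by exact_mod_cast le_top)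
  · exact (isFlat_zeroExt g).1.contDiffAt.of_le (by exact_mod_cast le_top)

/-- The point `L = 0` can be left out, since all the derivatives vanish there. -/
theorem tendsto_frechetTopology_iff {ι : Type*} {l : Filter ι} {u : ι → C0inf V} {x : C0inf V} :
    Tendsto u l (@nhds _ frechetTopology x) ↔
      ∀ (n m : ℕ) (R ε : ℝ), 0 < ε →
        ∀ᶠ i in l, ∀ L ∈ Ioc 0 R, weightedDeriv n m (u i - x) L ≤ ε := by
  have key : ∀ (n m : ℕ) (f g : C0inf V) (L : ℝ≥0),
      dist ((((L : ℝ)⁻¹ ^ n : ℝ) : ℂ) • halfDeriv m (g : ℝ≥0 → V) L)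
        ((((L : ℝ)⁻¹ ^ n : ℝ) : ℂ) • halfDeriv m (f : ℝ≥0 → V) L)
        = weightedDeriv n m (f - g) L := by
    intro n m f g L
    have hL : (0 : ℝ) ≤ (L : ℝ)⁻¹ ^ n := by positivity
    rw [dist_comm, dist_eq_norm, ← smul_sub, norm_smul, weightedDeriv, iteratedDeriv_zeroExt_sub,
      IsFlatSmooth.halfDeriv_eq f.2, IsFlatSmooth.halfDeriv_eq g.2, Complex.norm_real,
      Real.norm_of_nonneg hL]
  simp only [nhds_iInf, nhds_induced, tendsto_iInf, tendsto_comap_iff,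
    UniformOnFun.tendsto_iff_tendstoUniformlyOn, Metric.tendstoUniformlyOn_iff]
  refine forall_congr' fun n => forall_congr' fun m => ?_
  constructor
  · intro h R ε hε
    have hK : IsCompact (Icc (0 : ℝ≥0) R.toNNReal) := isCompact_Icc
    filter_upwards [h _ hK ε hε] with i hi L hL
    have h1 := hi ⟨L, hL.1.le⟩ ⟨zero_le,
      (Real.le_toNNReal_iff_coe_le (hL.1.le.trans hL.2)).2 hL.2⟩
    have h2 := key n m (u i) x ⟨L, hL.1.le⟩
    exact (h2.symm.trans_lt h1).le
  · intro h K hK ε hε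
    obtain ⟨R, hR⟩ := hK.bddAbove
    filter_upwards [h R (ε / 2) (half_pos hε)] with i hi L hL
    refine lt_of_le_of_lt (le_of_eq (key n m (u i) x L)) ?_
    rcases eq_or_lt_of_le (zero_le (a := L)) with h0 | h0
    · have : weightedDeriv n m (u i - x) L = 0 := by
        rw [weightedDeriv, (isFlat_zeroExt (u i - x)).iteratedDeriv_nonpos m (by simp [← h0]),
          norm_zero, mul_zero]
      rw [this]
      exact hε
    · exact (hi L ⟨h0, hR hL⟩).trans_lt (half_lt_self hε)

theorem weightedDeriv_add_le (n m : ℕ) (f g : C0inf V) {L : ℝ} (hL : 0 ≤ L) :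
    weightedDeriv n m (f + g) L ≤ weightedDeriv n m f L + weightedDeriv n m g L := by
  rw [weightedDeriv, iteratedDeriv_zeroExt_add, weightedDeriv, weightedDeriv, ← mul_add]
  exact mul_le_mul_of_nonneg_left (norm_add_le _ _) (by positivity)

theorem tendsto_frechetTopology_add {ι : Type*} {l : Filter ι} {u v : ι → C0inf V} {x y : C0inf V}
    (hu : Tendsto u l (@nhds _ frechetTopology x)) (hv : Tendsto v l (@nhds _ frechetTopology y)) :
    Tendsto (fun i => u i + v i) l (@nhds _ frechetTopology (x + y)) := by
  rw [tendsto_frechetTopology_iff] at *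
  intro n m R ε hε
  filter_upwards [hu n m R (ε / 2) (half_pos hε), hv n m R (ε / 2) (half_pos hε)] with i h1 h2 L hL
  have h3 : u i + v i - (x + y) = (u i - x) + (v i - y) := by abel
  rw [h3]
  have := weightedDeriv_add_le n m (u i - x) (v i - y) hL.1.le
  linarith [h1 L hL, h2 L hL]

/-- A linear map that is bounded for the defining seminorms respects convergence in the Fréchet
topologies. -/
theorem tendsto_frechetTopology_map (A : C0inf V →ₗ[ℂ] C0inf W)
    (hA : ∀ (n m : ℕ) (R : ℝ), ∃ (n' m' : ℕ) (R' C : ℝ), 0 < C ∧ ∀ (f : C0inf V) (δ : ℝ),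
      (∀ L ∈ Ioc 0 R', weightedDeriv n' m' f L ≤ δ) → ∀ L ∈ Ioc 0 R,
        weightedDeriv n m (A f) L ≤ C * δ)
    {ι : Type*} {l : Filter ι} {u : ι → C0inf V} {x : C0inf V}
    (hu : Tendsto u l (@nhds _ frechetTopology x)) :
    Tendsto (fun i => A (u i)) l (@nhds _ frechetTopology (A x)) := by
  rw [tendsto_frechetTopology_iff] at *
  intro n m R ε hε
  obtain ⟨n', m', R', C, hC, h⟩ := hA n m R
  filter_upwards [hu n' m' R' (ε / C) (by positivity)] with i hi L hL
  have h1 := h _ _ hi L hL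
  rwa [map_sub, mul_div_cancel₀ _ hC.ne'] at h1

end FlatFunctions

/-! ### Multipliers of moderate growth at `0` -/

/-- `q` is `m` times differentiable on `(0,∞)`, and `q` and its derivatives up to order `m` are
continuous and bounded by a polynomial in `1 / x`. -/
def IsModerate : ℕ → (ℝ → ℂ) → Prop
  | 0, q => ContinuousOn q (Ioi 0) ∧ ∃ (C : ℝ) (a : ℕ), 0 ≤ C ∧ ∀ x > 0, ‖q x‖ ≤ C * (1 + x⁻¹) ^ a
  | m + 1, q => (ContinuousOn q (Ioi 0) ∧
      ∃ (C : ℝ) (a : ℕ), 0 ≤ C ∧ ∀ x > 0, ‖q x‖ ≤ C * (1 + x⁻¹) ^ a) ∧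
      ∃ q' : ℝ → ℂ, (∀ x > 0, HasDerivAt q (q' x) x) ∧ IsModerate m q'

theorem IsModerate.zero {m : ℕ} {q : ℝ → ℂ} (h : IsModerate m q) : IsModerate 0 q := by
  cases m with
  | zero => exact h
  | succ m => exact h.1

theorem IsModerate.of_succ {m : ℕ} {q : ℝ → ℂ} (h : IsModerate (m + 1) q) : IsModerate m q := by
  induction m generalizing q with
  | zero => exact h.1
  | succ m ih =>
    obtain ⟨h1, q', h2, h3⟩ := h
    exact ⟨h1, q', h2, ih h3⟩

theorem IsModerate.const (m : ℕ) (c : ℂ) : IsModerate m fun _ => c := by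
  have h0 : ∀ c : ℂ, IsModerate 0 fun _ => c := fun c =>
    ⟨continuousOn_const, ‖c‖, 0, norm_nonneg c, fun x _ => by simp⟩
  induction m generalizing c with
  | zero => exact h0 c
  | succ m ih => exact ⟨h0 c, fun _ => 0, fun x _ => hasDerivAt_const x c, ih 0⟩

theorem IsModerate.add {m : ℕ} {q r : ℝ → ℂ} (hq : IsModerate m q) (hr : IsModerate m r) :
    IsModerate m (fun x => q x + r x) := by
  have h0 : ∀ {q r : ℝ → ℂ}, IsModerate 0 q → IsModerate 0 r →
      IsModerate 0 (fun x => q x + r x) := by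
    rintro q r ⟨hq, C, a, hC, h1⟩ ⟨hr, D, b, hD, h2⟩
    refine ⟨hq.add hr, C + D, max a b, by positivity, fun x hx => ?_⟩
    have hx1 : 1 ≤ 1 + x⁻¹ := by have := inv_pos.2 hx; linarith
    calc ‖q x + r x‖ ≤ C * (1 + x⁻¹) ^ a + D * (1 + x⁻¹) ^ b :=
          (norm_add_le _ _).trans (add_le_add (h1 x hx) (h2 x hx))
      _ ≤ C * (1 + x⁻¹) ^ max a b + D * (1 + x⁻¹) ^ max a b := by
          gcongr <;> simp
      _ = (C + D) * (1 + x⁻¹) ^ max a b := by ring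
  induction m generalizing q r with
  | zero => exact h0 hq hr
  | succ m ih =>
    obtain ⟨hq1, q', hq2, hq3⟩ := id hq
    obtain ⟨hr1, r', hr2, hr3⟩ := id hr
    exact ⟨h0 hq.zero hr.zero, _, fun x hx => (hq2 x hx).add (hr2 x hx), ih hq3 hr3⟩

theorem IsModerate.mul {m : ℕ} {q r : ℝ → ℂ} (hq : IsModerate m q) (hr : IsModerate m r) :
    IsModerate m (fun x => q x * r x) := by
  have h0 : ∀ {q r : ℝ → ℂ}, IsModerate 0 q → IsModerate 0 r →
      IsModerate 0 (fun x => q x * r x) := by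
    rintro q r ⟨hq, C, a, hC, h1⟩ ⟨hr, D, b, hD, h2⟩
    refine ⟨hq.mul hr, C * D, a + b, by positivity, fun x hx => ?_⟩
    have hx1 : 0 ≤ 1 + x⁻¹ := by positivity
    rw [norm_mul, pow_add]
    calc ‖q x‖ * ‖r x‖ ≤ (C * (1 + x⁻¹) ^ a) * (D * (1 + x⁻¹) ^ b) :=
          mul_le_mul (h1 x hx) (h2 x hx) (norm_nonneg _) (by positivity)
      _ = C * D * ((1 + x⁻¹) ^ a * (1 + x⁻¹) ^ b) := by ring
  induction m generalizing q r with
  | zero => exact h0 hq hr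
  | succ m ih =>
    obtain ⟨hq1, q', hq2, hq3⟩ := id hq
    obtain ⟨hr1, r', hr2, hr3⟩ := id hr
    exact ⟨h0 hq.zero hr.zero, _, fun x hx => (hq2 x hx).mul (hr2 x hx),
      (ih hq3 hr.of_succ).add (ih hq.of_succ hr3)⟩

theorem isModerate_inv (m : ℕ) : IsModerate m fun x : ℝ => ((x⁻¹ : ℝ) : ℂ) := by
  have h0 : IsModerate 0 fun x : ℝ => ((x⁻¹ : ℝ) : ℂ) := by
    refine ⟨Complex.continuous_ofReal.comp_continuousOn
      (continuousOn_inv₀.mono fun x hx => ne_of_gt hx), 1, 1, zero_le_one, fun x hx => ?_⟩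
    rw [Complex.norm_real, Real.norm_of_nonneg (inv_nonneg.2 hx.le)]
    simp
  induction m with
  | zero => exact h0
  | succ m ih =>
    refine ⟨h0, _, fun x hx => ?_, (IsModerate.const m (-1)).mul (ih.mul ih)⟩
    convert! (hasDerivAt_inv (ne_of_gt hx)).ofReal_comp using 1
    push_cast
    field_simp

theorem isModerate_inv_sqrt (m : ℕ) :
    IsModerate m fun x : ℝ => (((Real.sqrt x)⁻¹ : ℝ) : ℂ) := by
  have h0 : IsModerate 0 fun x : ℝ => (((Real.sqrt x)⁻¹ : ℝ) : ℂ) := by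
    refine ⟨Complex.continuous_ofReal.comp_continuousOn (Real.continuous_sqrt.continuousOn.inv₀
      fun x hx => (Real.sqrt_pos.2 hx).ne'), 1, 1, zero_le_one, fun x hx => ?_⟩
    rw [Complex.norm_real, Real.norm_of_nonneg (by positivity), ← Real.sqrt_inv, one_mul, pow_one]
    have := inv_pos.2 hx
    rw [Real.sqrt_le_left (by positivity)]
    nlinarith
  induction m with
  | zero => exact h0
  | succ m ih =>
    refine ⟨h0, _, fun x hx => ?_, (IsModerate.const m (-1 / 2)).mul (ih.mul (isModerate_inv m))⟩
    have hs := Real.sqrt_pos.2 hx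
    convert! ((Real.hasDerivAt_sqrt (ne_of_gt hx)).fun_inv hs.ne').ofReal_comp using 1
    have h2 : (x : ℂ) = (Real.sqrt x : ℂ) ^ 2 := by
      rw [← Complex.ofReal_pow, Real.sq_sqrt (le_of_lt hx)]
    have h3 : (Real.sqrt x : ℂ) ≠ 0 := by exact_mod_cast hs.ne'
    push_cast
    rw [h2]
    field_simp

theorem hasTemperateGrowth_deriv {P : ℝ → ℂ} (hP : P.HasTemperateGrowth) :
    (deriv P).HasTemperateGrowth := by
  refine ⟨(contDiff_infty_iff_deriv.1 hP.1).2, fun n => ?_⟩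
  obtain ⟨k, C, h⟩ := hP.2 (n + 1)
  refine ⟨k, C, fun x => ?_⟩
  have := h x
  rwa [norm_iteratedFDeriv_eq_norm_iteratedDeriv, iteratedDeriv_succ',
    ← norm_iteratedFDeriv_eq_norm_iteratedDeriv] at this

/-- A function of temperate growth at `∞`, in the variable `1 / x`, has moderate growth at `0`. -/
theorem isModerate_comp_div (m : ℕ) {P : ℝ → ℂ} (hP : P.HasTemperateGrowth) (c : ℝ) :
    IsModerate m fun x : ℝ => P (c * x⁻¹) := by
  have h0 : ∀ P : ℝ → ℂ, P.HasTemperateGrowth → IsModerate 0 fun x : ℝ => P (c * x⁻¹) := by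
    intro P hP
    obtain ⟨k, C, h⟩ := hP.2 0
    refine ⟨hP.1.continuous.comp_continuousOn (continuousOn_const.mul
      (continuousOn_inv₀.mono fun x hx => ne_of_gt hx)), |C| * (1 + |c|) ^ k, k, by positivity,
      fun x hx => ?_⟩
    have h1 := h (c * x⁻¹)
    rw [norm_iteratedFDeriv_zero] at h1
    have hx' := inv_pos.2 hx
    calc ‖P (c * x⁻¹)‖ ≤ C * (1 + ‖c * x⁻¹‖) ^ k := h1
      _ ≤ |C| * ((1 + |c|) * (1 + x⁻¹)) ^ k := by
          refine mul_le_mul (le_abs_self C) (pow_le_pow_left₀ (by positivity) ?_ k)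
            (by positivity) (abs_nonneg C)
          rw [norm_mul, Real.norm_eq_abs, Real.norm_of_nonneg hx'.le]
          nlinarith [abs_nonneg c]
      _ = |C| * (1 + |c|) ^ k * (1 + x⁻¹) ^ k := by rw [mul_pow, mul_assoc]
  induction m generalizing P with
  | zero => exact h0 P hP
  | succ m ih =>
    refine ⟨h0 P hP, _, fun x hx => ?_, (ih (hasTemperateGrowth_deriv hP)).mul
      ((IsModerate.const m (-c)).mul ((isModerate_inv m).mul (isModerate_inv m)))⟩
    have h1 : HasDerivAt (fun x : ℝ => c * x⁻¹) (c * (-(x ^ 2)⁻¹)) x :=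
      (hasDerivAt_inv (ne_of_gt hx)).const_mul c
    have h2 := (hP.1.differentiable (by simp) (c * x⁻¹)).hasDerivAt
    convert! HasDerivAt.scomp x h2 h1 using 1
    rw [Complex.real_smul, mul_comm]
    push_cast
    field_simp

/-- The product of a function on `(0,∞)` and a function on `ℝ`, extended by zero to `(-∞, 0]`. -/
def mulExt (q F : ℝ → ℂ) (x : ℝ) : ℂ := if 0 < x then q x * F x else 0

/-- The factor `x ^ (a + 2)` gained from the flatness of `F` beats the growth `x ^ (-a)` of `q`. -/
theorem mulExt_bound {q F : ℝ → ℂ} (hq : IsModerate 0 q) (hF : IsFlat F) :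
    ∃ K, ∀ x ≤ 1, ‖mulExt q F x‖ ≤ K * ‖x‖ ^ 2 := by
  obtain ⟨-, C, a, hC, h1⟩ := hq
  obtain ⟨D, hD, h2⟩ := hF.bound (a + 2) 1
  refine ⟨C * 2 ^ a * D, fun x hx => ?_⟩
  by_cases h : 0 < x
  · rw [mulExt, if_pos h, norm_mul, Real.norm_of_nonneg h.le]
    calc ‖q x‖ * ‖F x‖ ≤ (C * (1 + x⁻¹) ^ a) * (D * x ^ (a + 2)) :=
          mul_le_mul (h1 x h) (h2 x h.le hx) (norm_nonneg _) (by positivity)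
      _ = C * ((1 + x⁻¹) * x) ^ a * D * x ^ 2 := by rw [mul_pow]; ring
      _ ≤ C * 2 ^ a * D * x ^ 2 := by
          have : (1 + x⁻¹) * x ≤ 2 := by
            rw [add_mul, inv_mul_cancel₀ h.ne']; linarith
          gcongr
  · rw [mulExt, if_neg h, norm_zero]
    positivity

theorem hasDerivAt_mulExt_of_nonpos {q F : ℝ → ℂ} (hq : IsModerate 0 q) (hF : IsFlat F) {x : ℝ}
    (hx : x ≤ 0) : HasDerivAt (mulExt q F) 0 x := by
  rcases hx.lt_or_eq with h | rfl
  · refine (hasDerivAt_const x (0 : ℂ)).congr_of_eventuallyEq ?_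
    filter_upwards [Iio_mem_nhds h] with y hy
    rw [mulExt, if_neg (not_lt.2 (le_of_lt hy))]
  · obtain ⟨K, hK⟩ := mulExt_bound hq hF
    have h1 : mulExt q F =O[𝓝 0] fun x : ℝ => ‖x - 0‖ ^ 2 := by
      refine Asymptotics.IsBigO.of_bound K ?_
      filter_upwards [Iic_mem_nhds (show (0 : ℝ) < 1 by norm_num)] with y hy
      simpa using hK y hy
    have h2 := h1.hasFDerivAt (𝕜 := ℝ) one_lt_two
    simpa using h2.hasDerivAt

theorem contDiff_mulExt {m : ℕ} {q F : ℝ → ℂ} (hq : IsModerate m q) (hF : IsFlat F) :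
    ContDiff ℝ m (mulExt q F) := by
  induction m generalizing q F with
  | zero =>
    rw [Nat.cast_zero, contDiff_zero, continuous_iff_continuousAt]
    intro x
    rcases le_or_gt x 0 with h | h
    · exact (hasDerivAt_mulExt_of_nonpos hq hF h).continuousAt
    · have h1 : ContinuousAt (fun x => q x * F x) x :=
        (hq.1.continuousAt (Ioi_mem_nhds h)).mul hF.1.continuous.continuousAt
      refine h1.congr ?_
      filter_upwards [Ioi_mem_nhds h] with y hy
      rw [mulExt, if_pos (mem_Ioi.1 hy)]
  | succ m ih =>
    obtain ⟨h0, q', h2, h3⟩ := id hq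
    have hd : ∀ x, HasDerivAt (mulExt q F) (mulExt q' F x + mulExt q (deriv F) x) x := by
      intro x
      rcases le_or_gt x 0 with h | h
      · have := hasDerivAt_mulExt_of_nonpos hq.zero hF h
        simpa [mulExt, not_lt.2 h] using this
      · have h1 := (h2 x h).mul (hF.1.differentiable (by simp) x).hasDerivAt
        simp only [mulExt, if_pos h]
        refine h1.congr_of_eventuallyEq ?_
        filter_upwards [Ioi_mem_nhds h] with y hy
        rw [mulExt, if_pos (mem_Ioi.1 hy)]
        rfl
    push_cast
    rw [contDiff_succ_iff_deriv]
    refine ⟨fun x => (hd x).differentiableAt, by simp, ?_⟩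
    rw [show deriv (mulExt q F) = fun x => mulExt q' F x + mulExt q (deriv F) x from
      funext fun x => (hd x).deriv]
    exact (ih h3 hF).add (ih hq.of_succ hF.deriv)

/-- Flat functions stay flat under multiplication by functions whose derivatives are all bounded by
polynomials in `1 / x`. -/
theorem isFlat_mulExt {q F : ℝ → ℂ} (hq : ∀ m, IsModerate m q) (hF : IsFlat F) :
    IsFlat (mulExt q F) :=
  ⟨contDiff_infty.2 fun m => contDiff_mulExt (hq m) hF, fun _ hx => if_neg (not_lt.2 hx)⟩

/-! ### Flat functions with values in `ℓ²(ℤ)` -/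

/-- A family of flat functions indexed by `ℤ` all of whose derivatives are, on every half-line
`(-∞, R]`, dominated by a summable family of constants. -/
def IsSummableFamily (c : ℤ → ℝ → ℂ) : Prop :=
  (∀ k, IsFlat (c k)) ∧ ∀ (m : ℕ) (R : ℝ), ∃ b : ℤ → ℝ, Summable b ∧
    ∀ k, ∀ x ≤ R, ‖iteratedDeriv m (c k) x‖ ≤ b k

theorem IsSummableFamily.summable_norm {c : ℤ → ℝ → ℂ} (hc : IsSummableFamily c) (m : ℕ) (x : ℝ) :
    Summable fun k => ‖iteratedDeriv m (c k) x‖ := by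
  obtain ⟨b, hb, h⟩ := hc.2 m x
  exact Summable.of_nonneg_of_le (fun _ => norm_nonneg _) (fun k => h k x le_rfl) hb

section SeqSum

variable {V : Type*} [NormedAddCommGroup V] [NormedSpace ℂ V]

/-- The series `∑ c k x • v k` in a normed space. -/
def seqSum (v : ℤ → V) (c : ℤ → ℝ → ℂ) (x : ℝ) : V := ∑' k, c k x • v k

variable [CompleteSpace V] {v : ℤ → V} {c : ℤ → ℝ → ℂ}

theorem IsSummableFamily.summable (hc : IsSummableFamily c) (hv : ∀ k, ‖v k‖ = 1) (m : ℕ) (x : ℝ) :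
    Summable fun k => iteratedDeriv m (c k) x • v k := by
  refine Summable.of_norm ?_
  simp only [norm_smul, hv, mul_one]
  exact hc.summable_norm m x

theorem IsSummableFamily.hasDerivAt (hc : IsSummableFamily c) (hv : ∀ k, ‖v k‖ = 1) (m : ℕ)
    (x : ℝ) : HasDerivAt (seqSum v (fun k => iteratedDeriv m (c k)))
      (seqSum v (fun k => iteratedDeriv (m + 1) (c k)) x) x := by
  obtain ⟨b, hb, h⟩ := hc.2 (m + 1) (x + 1)
  have hx : x ∈ Iio (x + 1) := by simp
  have h1 : ∀ (k : ℤ) (y : ℝ), y ∈ Iio (x + 1) → HasDerivAt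
      (fun y => iteratedDeriv m (c k) y • v k) (iteratedDeriv (m + 1) (c k) y • v k) y :=
    fun k y _ => ((hc.1 k).hasDerivAt_iteratedDeriv m y).smul_const (v k)
  have h2 : ∀ (k : ℤ) (y : ℝ), y ∈ Iio (x + 1) → ‖iteratedDeriv (m + 1) (c k) y • v k‖ ≤ b k := by
    intro k y hy
    rw [norm_smul, hv, mul_one]
    exact h k y (le_of_lt hy)
  exact hasDerivAt_tsum_of_isPreconnected hb isOpen_Iio isPreconnected_Iio h1 h2 hx
    (hc.summable hv m x) hx

theorem IsSummableFamily.iteratedDeriv_seqSum (hc : IsSummableFamily c) (hv : ∀ k, ‖v k‖ = 1)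
    (m : ℕ) : iteratedDeriv m (seqSum v c) = seqSum v fun k => iteratedDeriv m (c k) := by
  have := iteratedDeriv_of_hasDerivAt_succ
    (D := fun m => seqSum v fun k => iteratedDeriv m (c k)) (hc.hasDerivAt hv) m
  simpa using this

theorem IsSummableFamily.isFlat (hc : IsSummableFamily c) (hv : ∀ k, ‖v k‖ = 1) :
    IsFlat (seqSum v c) := by
  refine ⟨?_, fun x hx => ?_⟩
  · have := contDiff_of_hasDerivAt_succ
      (D := fun m => seqSum v fun k => iteratedDeriv m (c k)) (hc.hasDerivAt hv)
    simpa using this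
  · have : ∀ k, c k x = 0 := fun k => (hc.1 k).2 x hx
    simp [seqSum, this]

theorem IsSummableFamily.norm_iteratedDeriv_le (hc : IsSummableFamily c) (hv : ∀ k, ‖v k‖ = 1)
    (m : ℕ) (x : ℝ) {b : ℤ → ℝ} (hb : Summable b) (h : ∀ k, ‖iteratedDeriv m (c k) x‖ ≤ b k) :
    ‖iteratedDeriv m (seqSum v c) x‖ ≤ ∑' k, b k := by
  rw [hc.iteratedDeriv_seqSum hv, seqSum]
  have h1 : ∀ k, ‖iteratedDeriv m (c k) x • v k‖ = ‖iteratedDeriv m (c k) x‖ := fun k => by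
    rw [norm_smul, hv, mul_one]
  refine (norm_tsum_le_tsum_norm ?_).trans ?_
  · simpa only [h1] using hc.summable_norm m x
  · simpa only [h1] using (hc.summable_norm m x).tsum_le_tsum h hb

theorem IsSummableFamily.weightedDeriv_seqSum_le (hc : IsSummableFamily c) (hv : ∀ k, ‖v k‖ = 1)
    (n m : ℕ) {L : ℝ} (hL : 0 < L) {b : ℤ → ℝ} (hb : Summable b)
    (h : ∀ k, L⁻¹ ^ n * ‖iteratedDeriv m (c k) L‖ ≤ b k) :
    weightedDeriv n m (hc.isFlat hv).toC0inf L ≤ ∑' k, b k := by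
  have hL' : (0 : ℝ) < L⁻¹ ^ n := by positivity
  rw [weightedDeriv, (hc.isFlat hv).zeroExt_toC0inf, mul_comm, ← le_div_iff₀ hL',
    ← tsum_div_const]
  refine hc.norm_iteratedDeriv_le hv m L (hb.div_const _) fun k => ?_
  rw [le_div_iff₀ hL', mul_comm]
  exact h k

end SeqSum

/-- The standard basis vectors of `ℓ²(ℤ)`. -/
def basisVec (k : ℤ) : ell2 := lp.single 2 k (1 : ℂ)

theorem norm_basisVec (k : ℤ) : ‖basisVec k‖ = 1 := by
  rw [basisVec, lp.norm_single (E := fun _ : ℤ => ℂ) (p := 2) two_pos k (1 : ℂ), norm_one]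

theorem basisVec_apply (k j : ℤ) : basisVec k j = if j = k then 1 else 0 := by
  split_ifs with h
  · rw [h]
    exact lp.single_apply_self 2 k _
  · exact lp.single_apply_ne 2 k _ h

/-- The element of `C₀^∞([0,∞), ℓ²(ℤ))` with components `c k`. -/
def IsSummableFamily.toC0inf {c : ℤ → ℝ → ℂ} (hc : IsSummableFamily c) : C0inf ell2 :=
  (hc.isFlat norm_basisVec).toC0inf

theorem IsSummableFamily.toC0inf_apply {c : ℤ → ℝ → ℂ} (hc : IsSummableFamily c) (L : ℝ≥0)
    (k : ℤ) : hc.toC0inf.1 L k = c k L := by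
  have hs : Summable fun k => c k L • basisVec k := by
    have := hc.summable norm_basisVec 0 L
    simpa using this
  have h1 := (lp.evalCLM ℂ (fun _ : ℤ => ℂ) 2 k).map_tsum hs
  change lp.evalCLM ℂ (fun _ : ℤ => ℂ) 2 k (seqSum basisVec c L) = _
  rw [seqSum, h1, tsum_eq_single k]
  · rw [map_smul]
    change c k L * basisVec k k = _
    rw [basisVec_apply, if_pos rfl, mul_one]
  · intro j hj
    rw [map_smul]
    change c j L * basisVec j k = _
    rw [basisVec_apply, if_neg (Ne.symm hj), mul_zero]

theorem C0inf_ell2_ext {f g : C0inf ell2} (h : ∀ (L : ℝ≥0) (k : ℤ), f.1 L k = g.1 L k) : f = g :=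
  Subtype.ext (funext fun L => lp.ext (funext fun k => h L k))

theorem IsSummableFamily.weightedDeriv_le {c : ℤ → ℝ → ℂ} (hc : IsSummableFamily c) (n m : ℕ)
    {L : ℝ} (hL : 0 < L) {b : ℤ → ℝ} (hb : Summable b)
    (h : ∀ k, L⁻¹ ^ n * ‖iteratedDeriv m (c k) L‖ ≤ b k) :
    weightedDeriv n m hc.toC0inf L ≤ ∑' k, b k :=
  hc.weightedDeriv_seqSum_le norm_basisVec n m hL hb h

theorem summable_inv_one_add_sq : Summable fun k : ℤ => (1 + (k : ℝ) ^ 2)⁻¹ := by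
  have h1 : Summable fun k : ℤ => ((k : ℝ) ^ 2)⁻¹ := by
    simpa using Real.summable_one_div_int_pow.2 (by norm_num : 1 < 2)
  have h2 : Summable fun k : ℤ => if k = 0 then (1 : ℝ) else 0 :=
    summable_of_ne_finset_zero (s := {0}) (fun k hk => by simp_all)
  refine Summable.of_nonneg_of_le (fun _ => by positivity) (fun k => ?_) (h1.add h2)
  by_cases hk : k = 0
  · simp [hk]
  · have : (0 : ℝ) < (k : ℝ) ^ 2 := by positivity
    rw [if_neg hk, add_zero]
    exact inv_anti₀ this (by linarith)

/-! ### Sections obtained by sampling a Schwartz function -/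

/-- A smooth function with compact support in `(0,∞)`. -/
def IsBump (h : ℝ → ℂ) : Prop :=
  ContDiff ℝ ∞ h ∧ ∃ a b : ℝ, 0 < a ∧ ∀ x, x ∉ Icc a b → h x = 0

theorem IsBump.isFlat {h : ℝ → ℂ} (hh : IsBump h) : IsFlat h := by
  obtain ⟨h1, a, b, ha, h2⟩ := hh
  exact ⟨h1, fun x hx => h2 x fun h => absurd (h.1.trans hx) (not_le.2 ha)⟩

theorem IsBump.contDiff_mul {h g : ℝ → ℂ} (hh : IsBump h) (hg : ContDiffOn ℝ ∞ g (Ioi 0)) :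
    ContDiff ℝ ∞ (fun x => h x * g x) := by
  obtain ⟨h1, a, b, ha, h2⟩ := hh
  rw [contDiff_iff_contDiffAt]
  intro x
  rcases lt_or_ge x a with hx | hx
  · refine (contDiffAt_const (c := (0 : ℂ))).congr_of_eventuallyEq ?_
    filter_upwards [Iio_mem_nhds hx] with y hy
    rw [h2 y fun h => absurd h.1 (not_le.2 hy), zero_mul]
  · exact h1.contDiffAt.mul (hg.contDiffAt (Ioi_mem_nhds (ha.trans_le hx)))

theorem IsBump.mul {h g : ℝ → ℂ} (hh : IsBump h) (hg : ContDiffOn ℝ ∞ g (Ioi 0)) :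
    IsBump (fun x => h x * g x) := by
  obtain ⟨-, a, b, ha, h2⟩ := id hh
  exact ⟨hh.contDiff_mul hg, a, b, ha, fun x hx => by simp [h2 x hx]⟩

theorem IsBump.deriv {h : ℝ → ℂ} (hh : IsBump h) : IsBump (deriv h) := by
  obtain ⟨h1, a, b, ha, h2⟩ := hh
  refine ⟨(contDiff_infty_iff_deriv.1 h1).2, a, b, ha, fun x hx => ?_⟩
  have : h =ᶠ[𝓝 x] fun _ => 0 := by
    filter_upwards [isClosed_Icc.isOpen_compl.mem_nhds hx] with y hy
    exact h2 y hy
  rw [this.deriv_eq, deriv_const]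

theorem contDiffOn_inv_ofReal : ContDiffOn ℝ ∞ (fun x : ℝ => ((x⁻¹ : ℝ) : ℂ)) (Ioi 0) :=
  Complex.ofRealCLM.contDiff.comp_contDiffOn
    (contDiffOn_id.inv fun _ hx => ne_of_gt hx)

theorem contDiffOn_comp_inv {P : ℝ → ℂ} (hP : ContDiff ℝ ∞ P) (τ : ℝ) :
    ContDiffOn ℝ ∞ (fun x : ℝ => P (τ * x⁻¹)) (Ioi 0) :=
  hP.comp_contDiffOn (contDiffOn_const.mul (contDiffOn_id.inv fun _ hx => ne_of_gt hx))

/-- The operator `P ↦ x P'` on Schwartz functions. -/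
def eulerCLM : SchwartzMap ℝ ℂ →L[ℂ] SchwartzMap ℝ ℂ :=
  (SchwartzMap.smulLeftCLM ℂ fun x : ℝ => (x : ℂ)).comp (SchwartzMap.derivCLM ℂ ℂ)

theorem eulerCLM_apply (P : SchwartzMap ℝ ℂ) (x : ℝ) : eulerCLM P x = x * deriv P x := by
  simp only [eulerCLM, ContinuousLinearMap.comp_apply]
  rw [SchwartzMap.smulLeftCLM_apply_apply Function.Complex.hasTemperateGrowth_ofReal]
  rfl

theorem IsBump.deriv_mul_comp {h : ℝ → ℂ} (hh : IsBump h) (P : SchwartzMap ℝ ℂ) (τ : ℝ) :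
    _root_.deriv (fun x => h x * P (τ * x⁻¹)) = fun x => _root_.deriv h x * P (τ * x⁻¹) +
      (h x * ((x⁻¹ : ℝ) : ℂ)) * (-eulerCLM P) (τ * x⁻¹) := by
  obtain ⟨h1, a, b, ha, h2⟩ := id hh
  obtain ⟨-, a', b', ha', h2'⟩ := id hh.deriv
  funext x
  rcases le_or_gt x 0 with hx | hx
  · have e1 : (fun x => h x * P (τ * x⁻¹)) =ᶠ[𝓝 x] fun _ => 0 := by
      filter_upwards [Iio_mem_nhds (hx.trans_lt ha)] with y hy
      rw [h2 y fun h => absurd h.1 (not_le.2 hy), zero_mul]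
    rw [e1.deriv_eq, deriv_const, hh.isFlat.2 x hx, hh.deriv.isFlat.2 x hx]
    simp
  · have d1 : HasDerivAt (fun x : ℝ => τ * x⁻¹) (τ * (-(x ^ 2)⁻¹)) x :=
      (hasDerivAt_inv (ne_of_gt hx)).const_mul τ
    have d2 := HasDerivAt.scomp x (P.hasDerivAt (τ * x⁻¹)) d1
    have d3 := ((h1.differentiable (by simp) x).hasDerivAt.mul d2).deriv
    refine d3.trans ?_
    have hx' : (x : ℂ) ≠ 0 := by exact_mod_cast ne_of_gt hx
    rw [neg_apply, eulerCLM_apply, Complex.real_smul]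
    push_cast
    simp only [Function.comp_apply]
    field_simp

/-- The `m`-th derivative in `L` of `h(L) P(τ / L)` is `O((1 + τ²)⁻¹)`, with a constant that depends
continuously on the Schwartz function `P`. -/
theorem IsBump.bound_sample (m : ℕ) {h : ℝ → ℂ} (hh : IsBump h) :
    ∃ p : SchwartzMap ℝ ℂ → ℝ, Continuous p ∧ p 0 = 0 ∧ ∀ (P : SchwartzMap ℝ ℂ) (τ x : ℝ),
      ‖iteratedDeriv m (fun x => h x * P (τ * x⁻¹)) x‖ * (1 + τ ^ 2) ≤ p P := by
  induction m generalizing h with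
  | zero =>
    obtain ⟨h1, a, b, ha, h2⟩ := hh
    obtain ⟨M, hM⟩ := isCompact_Icc.exists_bound_of_continuousOn
      (h1.continuous.continuousOn (s := Icc a b))
    have hs := schwartz_withSeminorms ℂ ℝ ℂ
    refine ⟨fun P => |M| * (1 + b ^ 2) *
      (SchwartzMap.seminorm ℂ 0 0 P + SchwartzMap.seminorm ℂ 2 0 P), ?_, by simp, ?_⟩
    · exact continuous_const.mul
        ((hs.continuous_seminorm (0, 0)).add (hs.continuous_seminorm (2, 0)))
    · intro P τ x
      have hp0 := apply_nonneg (SchwartzMap.seminorm ℂ 0 0) P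
      have hp2 := apply_nonneg (SchwartzMap.seminorm ℂ 2 0) P
      rw [iteratedDeriv_zero]
      by_cases hx : x ∈ Icc a b
      · have hx0 : 0 < x := ha.trans_le hx.1
        have e1 := SchwartzMap.norm_le_seminorm ℂ P (τ * x⁻¹)
        have e2 := SchwartzMap.norm_pow_mul_le_seminorm ℂ P 2 (τ * x⁻¹)
        rw [Real.norm_eq_abs, sq_abs] at e2
        have e3 : 1 + τ ^ 2 ≤ (1 + b ^ 2) * (1 + (τ * x⁻¹) ^ 2) := by
          have : τ ^ 2 = x ^ 2 * (τ * x⁻¹) ^ 2 := by field_simp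
          have hb : x ^ 2 ≤ b ^ 2 := pow_le_pow_left₀ hx0.le hx.2 2
          rw [this]
          nlinarith [sq_nonneg (τ * x⁻¹), sq_nonneg b]
        have e4 : ‖P (τ * x⁻¹)‖ * (1 + τ ^ 2) ≤ (1 + b ^ 2) *
            (SchwartzMap.seminorm ℂ 0 0 P + SchwartzMap.seminorm ℂ 2 0 P) := by
          calc ‖P (τ * x⁻¹)‖ * (1 + τ ^ 2)
              ≤ ‖P (τ * x⁻¹)‖ * ((1 + b ^ 2) * (1 + (τ * x⁻¹) ^ 2)) := by gcongr
            _ = (1 + b ^ 2) * (‖P (τ * x⁻¹)‖ + (τ * x⁻¹) ^ 2 * ‖P (τ * x⁻¹)‖) := by ring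
            _ ≤ _ := by gcongr
        calc ‖h x * P (τ * x⁻¹)‖ * (1 + τ ^ 2) = ‖h x‖ * (‖P (τ * x⁻¹)‖ * (1 + τ ^ 2)) := by
              rw [norm_mul, mul_assoc]
          _ ≤ |M| * ((1 + b ^ 2) *
              (SchwartzMap.seminorm ℂ 0 0 P + SchwartzMap.seminorm ℂ 2 0 P)) :=
              mul_le_mul ((hM x hx).trans (le_abs_self M)) e4 (by positivity) (abs_nonneg M)
          _ = _ := by ring
      · rw [h2 x hx, zero_mul, norm_zero, zero_mul]
        positivity
  | succ m ih =>
    obtain ⟨p, hp, hp0, h1⟩ := ih hh.deriv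
    obtain ⟨q, hq, hq0, h2⟩ := ih (hh.mul contDiffOn_inv_ofReal)
    refine ⟨fun P => p P + q (-eulerCLM P), hp.add (hq.comp eulerCLM.continuous.neg),
      by simp [hp0, hq0], fun P τ x => ?_⟩
    rw [iteratedDeriv_succ', hh.deriv_mul_comp, iteratedDeriv_fun_add]
    · calc _ ≤ (‖iteratedDeriv m (fun x => _root_.deriv h x * P (τ * x⁻¹)) x‖ +
          ‖iteratedDeriv m (fun x => (h x * ((x⁻¹ : ℝ) : ℂ)) * (-eulerCLM P) (τ * x⁻¹)) x‖) *
            (1 + τ ^ 2) := by gcongr; exact norm_add_le _ _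
        _ ≤ _ := by
          rw [add_mul]
          exact add_le_add (h1 P τ x) (h2 (-eulerCLM P) τ x)
    · exact (hh.deriv.contDiff_mul (contDiffOn_comp_inv (P.smooth ⊤) τ)).contDiffAt.of_le
        (by exact_mod_cast le_top)
    · exact ((hh.mul contDiffOn_inv_ofReal).contDiff_mul
        (contDiffOn_comp_inv ((-eulerCLM P).smooth ⊤) τ)).contDiffAt.of_le
        (by exact_mod_cast le_top)

theorem IsBump.isSummableFamily {h : ℝ → ℂ} (hh : IsBump h) (P : SchwartzMap ℝ ℂ) :
    IsSummableFamily fun (k : ℤ) x => h x * P (k * x⁻¹) := by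
  refine ⟨fun k => (hh.mul (contDiffOn_comp_inv (P.smooth ⊤) k)).isFlat, fun m R => ?_⟩
  obtain ⟨p, -, -, hp⟩ := hh.bound_sample m
  refine ⟨fun k => p P * (1 + (k : ℝ) ^ 2)⁻¹, summable_inv_one_add_sq.mul_left _, fun k x _ => ?_⟩
  change _ ≤ p P * (1 + (k : ℝ) ^ 2)⁻¹
  rw [← div_eq_mul_inv, le_div_iff₀ (by positivity)]
  exact hp P k x

/-- The element of `C₀^∞([0,∞), ℓ²(ℤ))` with components `h(L) P(k / L)`. -/
def IsBump.sample {h : ℝ → ℂ} (hh : IsBump h) (P : SchwartzMap ℝ ℂ) : C0inf ell2 :=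
  (hh.isSummableFamily P).toC0inf

theorem IsBump.sample_apply {h : ℝ → ℂ} (hh : IsBump h) (P : SchwartzMap ℝ ℂ) (L : ℝ≥0) (k : ℤ) :
    (hh.sample P).1 L k = h L * P (k * (L : ℝ)⁻¹) :=
  (hh.isSummableFamily P).toC0inf_apply L k

theorem IsBump.tendsto_sample {h : ℝ → ℂ} (hh : IsBump h) {ι : Type*} {l : Filter ι}
    {u : ι → SchwartzMap ℝ ℂ} {P : SchwartzMap ℝ ℂ} (hu : Tendsto u l (𝓝 P)) :
    Tendsto (fun i => hh.sample (u i)) l (@nhds _ frechetTopology (hh.sample P)) := by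
  rw [tendsto_frechetTopology_iff]
  intro n m R ε hε
  obtain ⟨p, hpc, hp0, hp⟩ := hh.bound_sample m
  obtain ⟨-, a, b, ha, hab⟩ := id hh
  set S := ∑' k : ℤ, (1 + (k : ℝ) ^ 2)⁻¹ with hS
  have h1 : Tendsto (fun i => a⁻¹ ^ n * p (u i - P) * S) l (𝓝 (a⁻¹ ^ n * 0 * S)) := by
    have : Tendsto (fun i => p (u i - P)) l (𝓝 0) := by
      rw [← hp0, ← sub_self P]
      exact (hpc.tendsto _).comp (hu.sub_const P)
    exact (this.const_mul _).mul_const _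
  rw [mul_zero, zero_mul] at h1
  filter_upwards [h1.eventually_le_const hε] with i hi L hL
  have hsub : hh.sample (u i) - hh.sample P = hh.sample (u i - P) := by
    refine C0inf_ell2_ext fun L k => ?_
    rw [hh.sample_apply, sub_apply, mul_sub, ← hh.sample_apply, ← hh.sample_apply]
    rfl
  rw [hsub]
  refine le_trans ?_ hi
  rw [hS, ← tsum_mul_left]
  refine (hh.isSummableFamily (u i - P)).weightedDeriv_le n m hL.1
    (summable_inv_one_add_sq.mul_left _) fun k => ?_
  have hp' := hp (u i - P) k L
  rw [← div_eq_mul_inv, le_div_iff₀ (by positivity), mul_assoc]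
  rcases lt_or_ge L a with hLa | hLa
  · have e1 : (fun x => h x * (u i - P) (k * x⁻¹)) =ᶠ[𝓝 L] fun _ => 0 := by
      filter_upwards [Iio_mem_nhds hLa] with y hy
      rw [hab y fun h => absurd h.1 (not_le.2 hy), zero_mul]
    have e2 := (e1.iteratedDeriv m).eq_of_nhds
    rw [e2] at hp' ⊢
    simp only [iteratedDeriv_fun_const_zero, norm_zero, zero_mul, mul_zero] at hp' ⊢
    positivity
  · have : L⁻¹ ^ n ≤ a⁻¹ ^ n := pow_le_pow_left₀ (inv_nonneg.2 hL.1.le) (inv_anti₀ ha hLa) n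
    exact mul_le_mul this hp' (by positivity) (by positivity)

/-! ### The section with a given component -/

/-- For `e = ±1`, the components `ξ̂(L,k) = |k|^{-1/2} G(L / |k|)`, `k` of sign `e`, of the
`ℕ^×`-invariant section with `ξ̂(L,e) = G(L)`. -/
def dilates (e : ℤ) (G : ℝ → ℂ) (k : ℤ) (x : ℝ) : ℂ :=
  if k.sign = e then (((Real.sqrt |(k : ℝ)|)⁻¹ : ℝ) : ℂ) * G (|(k : ℝ)|⁻¹ * x) else 0

theorem one_le_abs_of_sign {e k : ℤ} (he : e ≠ 0) (hk : k.sign = e) : 1 ≤ |(k : ℝ)| := by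
  have : k ≠ 0 := by
    rintro rfl
    exact he (by simpa using hk.symm)
  exact_mod_cast Int.one_le_abs this

theorem norm_iteratedDeriv_dilates_le {e : ℤ} (he : e ≠ 0) {G : ℝ → ℂ} (hG : IsFlat G) (m : ℕ)
    {k : ℤ} (hk : k.sign = e) (x : ℝ) :
    ‖iteratedDeriv m (dilates e G k) x‖ ≤ ‖iteratedDeriv m G (|(k : ℝ)|⁻¹ * x)‖ := by
  have h1 := one_le_abs_of_sign he hk
  have h2 : dilates e G k
      = fun x => (((Real.sqrt |(k : ℝ)|)⁻¹ : ℝ) : ℂ) * G (|(k : ℝ)|⁻¹ * x) := by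
    funext x; simp [dilates, hk]
  have h3 : ContDiff ℝ m G := hG.1.of_le (by exact_mod_cast le_top)
  rw [h2, iteratedDeriv_const_mul_field, iteratedDeriv_comp_const_smul h3, norm_mul, norm_smul,
    Complex.norm_real, ← mul_assoc]
  refine mul_le_of_le_one_left (norm_nonneg _) ?_
  rw [norm_pow, norm_inv, norm_inv, Real.norm_of_nonneg (Real.sqrt_nonneg _),
    Real.norm_of_nonneg (abs_nonneg _)]
  exact mul_le_one₀ (inv_le_one_of_one_le₀ (Real.one_le_sqrt.2 h1)) (by positivity)
    (pow_le_one₀ (by positivity) (inv_le_one_of_one_le₀ h1))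

theorem isFlat_dilates (e : ℤ) {G : ℝ → ℂ} (hG : IsFlat G) (k : ℤ) :
    IsFlat (dilates e G k) := by
  by_cases hk : k.sign = e
  · refine ⟨?_, fun x hx => ?_⟩
    · unfold dilates
      simp only [if_pos hk]
      exact contDiff_const.mul (hG.1.comp (contDiff_const.mul contDiff_id))
    · rw [dilates, if_pos hk, hG.2 _ (mul_nonpos_of_nonneg_of_nonpos (by positivity) hx), mul_zero]
  · refine ⟨?_, fun x _ => by simp [dilates, hk]⟩
    unfold dilates
    simp only [if_neg hk]
    exact contDiff_const

theorem summable_inv_sq_int : Summable fun k : ℤ => ((k : ℝ) ^ 2)⁻¹ := by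
  simpa using Real.summable_one_div_int_pow.2 (by norm_num : 1 < 2)

theorem iteratedDeriv_dilates_of_ne {e k : ℤ} (hk : k.sign ≠ e) (G : ℝ → ℂ) (m : ℕ) (x : ℝ) :
    iteratedDeriv m (dilates e G k) x = 0 := by
  have : dilates e G k = fun _ => 0 := by funext x; simp [dilates, hk]
  rw [this]
  simp

/-- Flatness of `G` at `0` makes the dilates `G(x / |k|)` summable over `k`. -/
theorem isSummableFamily_dilates {e : ℤ} (he : e ≠ 0) {G : ℝ → ℂ} (hG : IsFlat G) :
    IsSummableFamily (dilates e G) := by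
  refine ⟨isFlat_dilates e hG, fun m R => ?_⟩
  obtain ⟨C, hC, h⟩ := (hG.iteratedDeriv m).bound 2 R
  refine ⟨fun k => C * R ^ 2 * ((k : ℝ) ^ 2)⁻¹, summable_inv_sq_int.mul_left _, fun k x hx => ?_⟩
  rcases le_or_gt x 0 with hx0 | hx0
  · rw [(isFlat_dilates e hG k).iteratedDeriv_nonpos m hx0, norm_zero]
    positivity
  by_cases hk : k.sign = e
  · have h1 := one_le_abs_of_sign he hk
    refine (norm_iteratedDeriv_dilates_le he hG m hk x).trans ?_
    have h2 : |(k : ℝ)|⁻¹ * x ≤ x :=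
      mul_le_of_le_one_left hx0.le (inv_le_one_of_one_le₀ h1)
    refine (h _ (by positivity) (h2.trans hx)).trans ?_
    rw [mul_pow, inv_pow, sq_abs]
    have : x ^ 2 ≤ R ^ 2 := pow_le_pow_left₀ hx0.le hx 2
    calc C * (((k : ℝ) ^ 2)⁻¹ * x ^ 2) ≤ C * (((k : ℝ) ^ 2)⁻¹ * R ^ 2) := by gcongr
      _ = _ := by ring
  · rw [iteratedDeriv_dilates_of_ne hk, norm_zero]
    positivity

/-- The linear map `G ↦ (|k|^{-1/2} G(L / |k|))_{sign k = e}`. -/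
def dilation (e : ℤ) (he : e ≠ 0) : C0inf ℂ →ₗ[ℂ] C0inf ell2 where
  toFun g := (isSummableFamily_dilates he (isFlat_zeroExt g)).toC0inf
  map_add' f g := by
    refine C0inf_ell2_ext fun L k => ?_
    have h1 : (f + g).1 = f.1 + g.1 := rfl
    have h2 : ∀ a b : C0inf ell2, (a + b).1 L k = a.1 L k + b.1 L k := fun _ _ => rfl
    rw [h2]
    simp only [IsSummableFamily.toC0inf_apply, dilates, h1, zeroExt_add, Pi.add_apply]
    split_ifs <;> ring
  map_smul' c f := by
    refine C0inf_ell2_ext fun L k => ?_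
    have h1 : (c • f).1 = c • f.1 := rfl
    have h2 : ∀ a : C0inf ell2, (c • a).1 L k = c * a.1 L k := fun _ => rfl
    have h3 : ∀ x, zeroExt (c • f.1) x = c * zeroExt f.1 x := by
      intro x; by_cases hx : 0 ≤ x <;> simp [zeroExt, hx]
    rw [RingHom.id_apply, h2]
    simp only [IsSummableFamily.toC0inf_apply, dilates, h1, h3]
    split_ifs <;> ring

theorem dilation_apply {e : ℤ} (he : e ≠ 0) (g : C0inf ℂ) (L : ℝ≥0) (k : ℤ) :
    (dilation e he g).1 L k = dilates e (zeroExt g.1) k L :=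
  (isSummableFamily_dilates he (isFlat_zeroExt g)).toC0inf_apply L k

/-- The dilation map is continuous: the seminorm of weight `L ^ (-n - 2)` controls the sum over `k`
of the seminorms of weight `L ^ (-n)` of the dilates, with a factor `∑ k ^ (-2)`. -/
theorem tendsto_dilation {e : ℤ} (he : e ≠ 0) {ι : Type*} {l : Filter ι} {u : ι → C0inf ℂ}
    {g : C0inf ℂ} (hu : Tendsto u l (@nhds _ frechetTopology g)) :
    Tendsto (fun i => dilation e he (u i)) l (@nhds _ frechetTopology (dilation e he g)) := by
  refine tendsto_frechetTopology_map (dilation e he) (fun n m R => ?_) hu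
  set S := ∑' k : ℤ, ((k : ℝ) ^ 2)⁻¹ with hS
  have hS0 : 0 ≤ S := tsum_nonneg fun _ => by positivity
  refine ⟨n + 2, m, R, R ^ 2 * S + 1, by positivity, fun f δ hδ L hL => ?_⟩
  have hδ0 : 0 ≤ δ := le_trans (by unfold weightedDeriv; have := hL.1; positivity) (hδ L hL)
  have key : weightedDeriv n m (dilation e he f) L ≤ ∑' k : ℤ, R ^ 2 * δ * ((k : ℝ) ^ 2)⁻¹ := by
    refine (isSummableFamily_dilates he (isFlat_zeroExt f)).weightedDeriv_le n m hL.1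
      (summable_inv_sq_int.mul_left _) fun k => ?_
    by_cases hk : k.sign = e
    · have h1 := one_le_abs_of_sign he hk
      set N := |(k : ℝ)| with hN
      have hN0 : 0 < N := by linarith
      have hy0 : 0 < N⁻¹ * L := mul_pos (inv_pos.2 hN0) hL.1
      have hy1 : N⁻¹ * L ≤ L := mul_le_of_le_one_left hL.1.le (inv_le_one_of_one_le₀ h1)
      have h2 := hδ (N⁻¹ * L) ⟨hy0, hy1.trans hL.2⟩
      rw [weightedDeriv, mul_comm, inv_pow, ← div_eq_mul_inv, div_le_iff₀ (by positivity)] at h2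
      have hL0 := hL.1
      calc L⁻¹ ^ n * ‖iteratedDeriv m (dilates e (zeroExt f.1) k) L‖
          ≤ L⁻¹ ^ n * (δ * (N⁻¹ * L) ^ (n + 2)) := by
            gcongr
            exact (norm_iteratedDeriv_dilates_le he (isFlat_zeroExt f) m hk L).trans h2
        _ = (N⁻¹ ^ n * L ^ 2) * δ * (N ^ 2)⁻¹ := by
            have : L⁻¹ ^ n * L ^ n = 1 := by rw [← mul_pow, inv_mul_cancel₀ hL0.ne', one_pow]
            rw [mul_pow, pow_add, pow_add, inv_pow N 2]
            linear_combination (δ * N⁻¹ ^ n * (N ^ 2)⁻¹ * L ^ 2) * this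
        _ ≤ R ^ 2 * δ * (N ^ 2)⁻¹ := by
            gcongr
            calc N⁻¹ ^ n * L ^ 2 ≤ 1 * R ^ 2 := by
                  gcongr
                  · exact pow_le_one₀ (by positivity) (inv_le_one_of_one_le₀ h1)
                  · exact hL.2
              _ = R ^ 2 := one_mul _
        _ = _ := by rw [hN, sq_abs]
    · rw [iteratedDeriv_dilates_of_ne hk, norm_zero, mul_zero]
      positivity
  refine key.trans ?_
  rw [tsum_mul_left, ← hS]
  nlinarith

/-! ### Fourier components on the circles -/

/-- The factor is `L^{1/2}`, because the Haar measure on the circle is normalized to total mass `1`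
whereas `d^*u` has total mass `L`. -/
theorem fourierComp_eq_repr (L : Ioi (0 : ℝ)) (ξ : L2C L)
    (hm : MemLp (ξ : Circ L → ℂ) 2 AddCircle.haarAddCircle) (n : ℤ) :
    fourierComp L ξ n = ((Real.sqrt (L : ℝ) : ℝ) : ℂ) * fourierBasis.repr hm.toLp n := by
  have hL : (0 : ℝ) < L := L.2
  rw [fourierBasis_repr, fourierCoeff_congr_ae hm.coeFn_toLp, fourierCoeff,
    AddCircle.integral_haarAddCircle, fourierComp, Complex.real_smul]
  simp only [smul_eq_mul]
  rw [← mul_assoc, ← Complex.ofReal_mul]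
  congr 2
  rw [← div_eq_mul_inv, Real.sqrt_div_self]

theorem ae_volume_eq (L : Ioi (0 : ℝ)) : ae (volume : Measure (Circ L)) =
    ae (AddCircle.haarAddCircle : Measure (Circ L)) := by
  rw [AddCircle.volume_eq_smul_haarAddCircle]
  refine Measure.ae_ennreal_smul_measure_eq ?_ _
  have : (0 : ℝ) < L := L.2
  positivity

theorem fourierTransform_injective (L : Ioi (0 : ℝ)) :
    Function.Injective (fourierTransform L) := by
  rw [injective_iff_map_eq_zero]
  intro ξ hξ
  have hm : MemLp (ξ : Circ L → ℂ) 2 AddCircle.haarAddCircle :=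
    memLp_haarAddCircle_iff.2 (Lp.memLp ξ)
  have hs : ((Real.sqrt (L : ℝ) : ℝ) : ℂ) ≠ 0 := by
    exact_mod_cast (Real.sqrt_pos.2 L.2).ne'
  have h1 : fourierBasis.repr hm.toLp = 0 := by
    ext n
    have h2 : fourierTransform L ξ n = 0 := by rw [hξ]; rfl
    have h3 := fourierComp_eq_repr L ξ hm n
    rw [show fourierComp L ξ n = 0 from h2] at h3
    exact (mul_eq_zero.1 h3.symm).resolve_left hs
  have h4 : hm.toLp = 0 := by
    exact (map_eq_zero_iff (fourierBasis (T := (L : ℝ))).repr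
      (fourierBasis (T := (L : ℝ))).repr.injective).1 h1
  have h5 : (ξ : Circ L → ℂ) =ᵐ[AddCircle.haarAddCircle] 0 := by
    have := hm.coeFn_toLp
    rw [h4] at this
    exact this.symm.trans (Lp.coeFn_zero _ _ _)
  rw [Filter.EventuallyEq, ← ae_volume_eq] at h5
  exact (Lp.eq_zero_iff_ae_eq_zero).2 h5

theorem fourierTransform_surjective (L : Ioi (0 : ℝ)) :
    Function.Surjective (fourierTransform L) := by
  intro a
  have hs : ((Real.sqrt (L : ℝ) : ℝ) : ℂ) ≠ 0 := by
    exact_mod_cast (Real.sqrt_pos.2 L.2).ne'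
  set η := (fourierBasis (T := (L : ℝ))).repr.symm ((((Real.sqrt (L : ℝ) : ℝ) : ℂ))⁻¹ • a) with hη
  have hη2 : MemLp (η : Circ L → ℂ) 2 volume := memLp_haarAddCircle_iff.1 (Lp.memLp η)
  set ξ : L2C L := hη2.toLp with hξ
  have hm : MemLp (ξ : Circ L → ℂ) 2 AddCircle.haarAddCircle :=
    memLp_haarAddCircle_iff.2 (Lp.memLp ξ)
  have h1 : hm.toLp = η := by
    refine Lp.ext (hm.coeFn_toLp.trans ?_)
    have := hη2.coeFn_toLp
    rwa [Filter.EventuallyEq, ae_volume_eq] at this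
  refine ⟨ξ, ?_⟩
  ext n
  change fourierComp L ξ n = a n
  rw [fourierComp_eq_repr L ξ hm, h1, hη, LinearIsometryEquiv.apply_symm_apply]
  change _ * ((_)⁻¹ * a n) = _
  rw [mul_inv_cancel_left₀ hs]

theorem fourier_scale (n : ℕ+) (L : Ioi (0 : ℝ)) (k : ℤ) (y : ℝ) :
    fourier (-k) (y : Circ L) = fourier (-((n : ℕ) * k)) (y : Circ (scale n L)) := by
  rw [fourier_coe_apply, fourier_coe_apply]
  congr 1
  have hL : ((L : ℝ) : ℂ) ≠ 0 := by
    exact_mod_cast (ne_of_gt L.2)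
  have hn : ((n : ℕ) : ℂ) ≠ 0 := by exact_mod_cast n.pos.ne'
  simp only [scale]
  push_cast
  field_simp

/-- The Fourier components of `σ_n ξ` are obtained by integrating over the sheets of the covering
`C_{μ^n} → C_μ`, that is, over the whole of `C_{μ^n}`. -/
theorem fourierComp_sigma (n : ℕ+) (L : Ioi (0 : ℝ)) (ξ : L2C (scale n L)) (k : ℤ) :
    fourierComp L (sigma n L ξ) k
      = ((Real.sqrt (n : ℝ) : ℝ) : ℂ) * fourierComp (scale n L) ξ ((n : ℕ) * k) := by
  have hL : (0 : ℝ) < L := L.2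
  have hn : (0 : ℝ) < (n : ℝ) := by exact_mod_cast n.pos
  have hξ : Integrable (ξ : Circ (scale n L) → ℂ) := (Lp.memLp ξ).integrable (by norm_num)
  set E : ℝ → ℂ := fun y => fourier (-((n : ℕ) * k)) (y : Circ (scale n L)) *
    ξ (y : Circ (scale n L)) with hE
  have hEi : ∀ a b : ℝ, a ≤ b → b ≤ a + (scale n L : ℝ) → IntervalIntegrable E volume a b := by
    intro a b hab hb
    have h1 : Integrable (fun x : Circ (scale n L) => fourier (-((n : ℕ) * k)) x * ξ x) := by
      refine hξ.bdd_mul (c := 1) (map_continuous _).aestronglyMeasurable ?_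
      exact ae_of_all _ fun x => by simp only [fourier_apply, Circle.norm_coe, le_refl]
    have h2 := (AddCircle.measurePreserving_mk (scale n L : ℝ) a).integrable_comp_of_integrable h1
    rw [intervalIntegrable_iff_integrableOn_Ioc_of_le hab]
    exact IntegrableOn.mono_set (t := Ioc a (a + (scale n L : ℝ))) h2 (Ioc_subset_Ioc_right hb)
  have hLn : (L : ℝ) ≤ (scale n L : ℝ) := by
    have : (1 : ℝ) ≤ (n : ℝ) := by exact_mod_cast n.pos
    simp only [scale]; nlinarith
  have h1 : ∫ x : Circ L, fourier (-k) x * (sigma n L ξ) x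
      = ∫ x : Circ L, fourier (-k) x * sigmaFun n L ξ x := by
    refine integral_congr_ae ?_
    filter_upwards [(memLp_sigmaFun n L (Lp.memLp ξ)).coeFn_toLp] with x hx
    rw [← hx]
    rfl
  have h2 : ∫ x : Circ L, fourier (-k) x * sigmaFun n L ξ x
      = ∑ j ∈ Finset.range n, ∫ y in ((j + 1 : ℕ) * (L : ℝ))..((j + 1 + 1 : ℕ) * (L : ℝ)), E y := by
    rw [← AddCircle.intervalIntegral_preimage (L : ℝ) 0, zero_add]
    have e1 : ∀ y : ℝ, fourier (-k) (y : Circ L) * sigmaFun n L ξ (y : Circ L)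
        = ∑ j ∈ Finset.range n, E (y + (j + 1 : ℕ) * (L : ℝ)) := by
      intro y
      have e2 : sigmaFun n L ξ (y : Circ L) = ∑ j ∈ Finset.Icc 1 (n : ℕ),
          ξ ((y + j * (L : ℝ) : ℝ) : Circ (scale n L)) := rfl
      have e3 : ∑ j ∈ Finset.Icc 1 (n : ℕ), ξ ((y + j * (L : ℝ) : ℝ) : Circ (scale n L))
          = ∑ j ∈ Finset.range n, ξ ((y + (j + 1 : ℕ) * (L : ℝ) : ℝ) : Circ (scale n L)) := by
        rw [Finset.range_eq_Ico, Finset.sum_Ico_add'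
          (fun j : ℕ => ξ ((y + j * (L : ℝ) : ℝ) : Circ (scale n L))) 0 n 1]
        rfl
      rw [e2, e3, Finset.mul_sum]
      refine Finset.sum_congr rfl fun j _ => ?_
      simp only [hE]
      rw [← fourier_scale]
      congr 2
      have := AddCircle.coe_add (p := (L : ℝ)) y ((j + 1 : ℕ) * (L : ℝ))
      rw [this, ← nsmul_eq_mul, AddCircle.coe_nsmul, AddCircle.coe_period, smul_zero, add_zero]
    simp only [e1]
    rw [intervalIntegral.integral_finsetSum]
    · refine Finset.sum_congr rfl fun j _ => ?_
      rw [intervalIntegral.integral_comp_add_right]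
      congr 1 <;> push_cast <;> ring
    · intro j _
      have := (hEi ((j + 1 : ℕ) * (L : ℝ)) ((j + 1 : ℕ) * (L : ℝ) + L) (by linarith)
        (by linarith)).comp_add_right ((j + 1 : ℕ) * (L : ℝ))
      simpa using this
  have h3 : ∑ j ∈ Finset.range n, ∫ y in ((j + 1 : ℕ) * (L : ℝ))..((j + 1 + 1 : ℕ) * (L : ℝ)), E y
      = ∫ x : Circ (scale n L), fourier (-((n : ℕ) * k)) x * ξ x := by
    rw [intervalIntegral.sum_integral_adjacent_intervals
      (a := fun j : ℕ => ((j + 1 : ℕ) : ℝ) * (L : ℝ)),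
      ← AddCircle.intervalIntegral_preimage (scale n L : ℝ) (L : ℝ)]
    · congr 1
      · push_cast; ring
      · simp only [scale]; push_cast; ring
    · intro j _
      refine hEi _ _ ?_ ?_ <;> push_cast <;> linarith
  rw [fourierComp, fourierComp, h1, h2, h3, ← mul_assoc, ← Complex.ofReal_mul]
  congr 2
  simp only [scale]
  rw [Real.sqrt_mul hn.le]
  have : Real.sqrt (n : ℝ) ≠ 0 := (Real.sqrt_pos.2 hn).ne'
  field_simp

/-! ### Invariant sections -/

theorem hat_eq (ξ : ∀ L : Ioi (0 : ℝ), L2C L) (M : Ioi (0 : ℝ)) {L : ℝ≥0} (h : (L : ℝ) = M) :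
    hat ξ L = fourierTransform M (ξ M) := by
  have hL : (0 : ℝ) < (L : ℝ) := h ▸ M.2
  obtain rfl : M = ⟨L, hL⟩ := Subtype.ext h.symm
  change (if h : (0 : ℝ) < (L : ℝ) then fourierTransform ⟨L, h⟩ (ξ ⟨L, h⟩) else 0) = _
  rw [dif_pos hL]

theorem hat_zero (ξ : ∀ L : Ioi (0 : ℝ), L2C L) : hat ξ 0 = 0 := by
  change (if h : (0 : ℝ) < ((0 : ℝ≥0) : ℝ) then _ else 0) = _
  rw [dif_neg (by simp)]

/-- Invariance under `ℕ^×` in terms of Fourier components. (At `L = 0` both sides vanish.) -/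
theorem mem_H0_iff (ξ : L2Sections) : ξ ∈ H0 ↔ ∀ (n : ℕ+) (L : ℝ≥0) (k : ℤ),
    hat ξ.1 L k = ((Real.sqrt (n : ℝ) : ℝ) : ℂ) * hat ξ.1 ((n : ℕ) * L) ((n : ℕ) * k) := by
  constructor
  · intro h n L k
    rcases eq_or_lt_of_le (zero_le (a := L)) with h0 | h0
    · rw [← h0, mul_zero, hat_zero]
      simp
    · rw [hat_eq ξ.1 ⟨L, h0⟩ rfl, hat_eq ξ.1 (scale n ⟨L, h0⟩) (by simp [scale])]
      change fourierComp _ _ _ = _ * fourierComp _ _ _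
      rw [← fourierComp_sigma, h n ⟨L, h0⟩]
  · intro h n L
    refine fourierTransform_injective L ?_
    ext k
    have h1 := h n ⟨L, le_of_lt L.2⟩ k
    rw [hat_eq ξ.1 L (L := ⟨L, le_of_lt L.2⟩) rfl,
      hat_eq ξ.1 (scale n L) (by simp only [scale]; rfl)] at h1
    rw [h1]
    exact fourierComp_sigma n L _ k

/-- The section of `ℒ²` with given Fourier components. -/
def ofHat (f : C0inf ell2) : L2Sections :=
  ⟨fun L => (fourierTransform_surjective L (f.1 ⟨L, le_of_lt L.2⟩)).choose, by
    have h : hat (fun L : Ioi (0 : ℝ) =>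
        (fourierTransform_surjective L (f.1 ⟨L, le_of_lt L.2⟩)).choose) = f.1 := by
      funext L
      rcases eq_or_lt_of_le (zero_le (a := L)) with h0 | h0
      · rw [← h0, hat_zero]
        have := (isFlat_zeroExt f).2 0 le_rfl
        rw [← NNReal.coe_zero, zeroExt_coe] at this
        exact this.symm
      · rw [hat_eq _ ⟨L, h0⟩ rfl]
        exact (fourierTransform_surjective ⟨L, h0⟩ (f.1 ⟨L, le_of_lt h0⟩)).choose_spec
    change hat _ ∈ C0inf ell2
    rw [h]
    exact f.2⟩

theorem trivialize_injective : Function.Injective trivialize := by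
  intro ξ η h
  refine Subtype.ext (funext fun L => fourierTransform_injective L ?_)
  have h1 : hat ξ.1 = hat η.1 := congrArg Subtype.val h
  rw [← hat_eq ξ.1 L (L := ⟨L, le_of_lt L.2⟩) rfl, ← hat_eq η.1 L (L := ⟨L, le_of_lt L.2⟩) rfl, h1]

theorem trivialize_ofHat (f : C0inf ell2) : trivialize (ofHat f) = f := by
  refine Subtype.ext (funext fun L => ?_)
  change hat (ofHat f).1 L = f.1 L
  rcases eq_or_lt_of_le (zero_le (a := L)) with h0 | h0
  · rw [← h0, hat_zero]
    have := (isFlat_zeroExt f).2 0 le_rfl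
    rw [← NNReal.coe_zero, zeroExt_coe] at this
    exact this.symm
  · rw [hat_eq _ ⟨L, h0⟩ rfl]
    exact (fourierTransform_surjective ⟨L, h0⟩ (f.1 ⟨L, le_of_lt h0⟩)).choose_spec

theorem trivialize_add (ξ η : L2Sections) : trivialize (ξ + η) = trivialize ξ + trivialize η :=
  Subtype.ext (map_add hat ξ.1 η.1)

theorem trivialize_smul (c : ℂ) (ξ : L2Sections) : trivialize (c • ξ) = c • trivialize ξ :=
  Subtype.ext (map_smul hat c ξ.1)

/-- The zeroth Fourier component of an invariant section vanishes: invariance gives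
`ξ̂(L/n,0) = n^{1/2} ξ̂(L,0)`, and the left-hand side stays bounded as `n → ∞`. -/
theorem hat_zero_component {ξ : L2Sections} (hξ : ξ ∈ H0) (L : ℝ≥0) : hat ξ.1 L 0 = 0 := by
  have h := (mem_H0_iff ξ).1 hξ
  obtain ⟨C, hC, hb⟩ := (isFlat_zeroExt (component 0 ξ)).bound 0 L
  by_contra hne
  have hpos : 0 < ‖hat ξ.1 L 0‖ := norm_pos_iff.2 hne
  obtain ⟨n, hn⟩ := exists_nat_gt ((C / ‖hat ξ.1 L 0‖) ^ 2)
  have hn0 : 0 < n := by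
    have : (0 : ℝ) < n := lt_of_le_of_lt (by positivity) hn
    exact_mod_cast this
  have h1 := h ⟨n, hn0⟩ ((n : ℝ≥0)⁻¹ * L) 0
  have hn' : (n : ℝ≥0) ≠ 0 := by exact_mod_cast hn0.ne'
  simp only [PNat.mk_coe, mul_zero, mul_inv_cancel_left₀ hn'] at h1
  have h2 := hb ((n : ℝ≥0)⁻¹ * L : ℝ≥0) (NNReal.coe_nonneg _) (by
    push_cast
    refine mul_le_of_le_one_left L.coe_nonneg (inv_le_one_of_one_le₀ ?_)
    exact_mod_cast hn0)
  rw [pow_zero, mul_one, zeroExt_coe] at h2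
  change ‖hat ξ.1 ((n : ℝ≥0)⁻¹ * L) 0‖ ≤ C at h2
  rw [h1, norm_mul, Complex.norm_real, Real.norm_of_nonneg (Real.sqrt_nonneg _),
    ← le_div_iff₀ hpos] at h2
  have h3 : C / ‖hat ξ.1 L 0‖ < Real.sqrt n := Real.lt_sqrt_of_sq_lt hn
  linarith

/-- An invariant section is determined by its components of index `±1`. -/
theorem hat_eq_of_mem_H0 {ξ : L2Sections} (hξ : ξ ∈ H0) (n : ℕ+) (e : ℤ) (L : ℝ≥0) :
    hat ξ.1 L ((n : ℕ) * e)
      = (((Real.sqrt (n : ℝ))⁻¹ : ℝ) : ℂ) * hat ξ.1 (((n : ℕ) : ℝ≥0)⁻¹ * L) e := by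
  have hn' : ((n : ℕ) : ℝ≥0) ≠ 0 := by exact_mod_cast n.pos.ne'
  have hs : Real.sqrt (n : ℝ) ≠ 0 := (Real.sqrt_pos.2 (by exact_mod_cast n.pos)).ne'
  rw [(mem_H0_iff ξ).1 hξ n _ e, mul_inv_cancel_left₀ hn', ← mul_assoc, ← Complex.ofReal_mul,
    inv_mul_cancel₀ hs, Complex.ofReal_one, one_mul]

theorem gamma_injective : Function.Injective gamma := by
  rw [injective_iff_map_eq_zero]
  intro ξ hξ
  have h1 : ∀ L, hat ξ.1.1 L 1 = 0 := fun L =>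
    congrFun (congrArg Subtype.val (congrArg Prod.fst hξ)) L
  have h2 : ∀ L, hat ξ.1.1 L (-1) = 0 := fun L =>
    congrFun (congrArg Subtype.val (congrArg Prod.snd hξ)) L
  refine Subtype.ext (trivialize_injective (C0inf_ell2_ext fun L k => ?_))
  change hat ξ.1.1 L k = hat 0 L k
  have h0 : hat 0 L k = 0 := by rw [map_zero]; rfl
  rw [h0]
  rcases lt_trichotomy k 0 with hk | rfl | hk
  · obtain ⟨n, rfl⟩ : ∃ n : ℕ+, k = (n : ℕ) * (-1) :=
      ⟨⟨(-k).toNat, by omega⟩, by simp only [PNat.mk_coe]; omega⟩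
    rw [hat_eq_of_mem_H0 ξ.2, h2, mul_zero]
  · exact hat_zero_component ξ.2 L
  · obtain ⟨n, rfl⟩ : ∃ n : ℕ+, k = (n : ℕ) * 1 :=
      ⟨⟨k.toNat, by omega⟩, by simp only [PNat.mk_coe]; omega⟩
    rw [hat_eq_of_mem_H0 ξ.2, h1, mul_zero]

/-- The invariant section `ξ` with `ξ̂(·, 1) = g₁` and `ξ̂(·, -1) = g₂`. -/
def gammaInv (g₁ g₂ : C0inf ℂ) : L2Sections :=
  ofHat (dilation 1 one_ne_zero g₁ + dilation (-1) (by norm_num) g₂)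

theorem hat_gammaInv (g₁ g₂ : C0inf ℂ) (L : ℝ≥0) (k : ℤ) : hat (gammaInv g₁ g₂).1 L k
    = dilates 1 (zeroExt g₁.1) k L + dilates (-1) (zeroExt g₂.1) k L := by
  have h := congrArg Subtype.val (trivialize_ofHat
    (dilation 1 one_ne_zero g₁ + dilation (-1) (by norm_num) g₂))
  have h1 : hat (gammaInv g₁ g₂).1 L k =
      (dilation 1 one_ne_zero g₁ + dilation (-1) (by norm_num) g₂).1 L k :=
    congrArg (fun x : ell2 => x k) (congrFun h L)
  rw [h1, ← dilation_apply one_ne_zero, ← dilation_apply (by norm_num)]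
  rfl

theorem dilates_scale (e : ℤ) (G : ℝ → ℂ) (n : ℕ+) (k : ℤ) (x : ℝ) :
    dilates e G k x = ((Real.sqrt (n : ℝ) : ℝ) : ℂ) * dilates e G ((n : ℕ) * k) ((n : ℕ) * x) := by
  have hn : (0 : ℝ) < (n : ℝ) := by exact_mod_cast n.pos
  have hs : (Real.sqrt (n : ℝ)) ≠ 0 := (Real.sqrt_pos.2 hn).ne'
  have h1 : (((n : ℕ) : ℤ) * k).sign = k.sign := by
    rw [Int.sign_mul, Int.sign_natCast_of_ne_zero n.pos.ne', one_mul]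
  unfold dilates
  rw [h1]
  split_ifs
  · push_cast
    rw [abs_mul, abs_of_pos hn, Real.sqrt_mul hn.le, ← mul_assoc]
    congr 1
    · push_cast
      have hs' : (Real.sqrt (n : ℝ) : ℂ) ≠ 0 := by exact_mod_cast hs
      rw [mul_inv, mul_inv_cancel_left₀ hs']
    · congr 1
      field_simp
  · simp

theorem gammaInv_mem_H0 (g₁ g₂ : C0inf ℂ) : gammaInv g₁ g₂ ∈ H0 := by
  rw [mem_H0_iff]
  intro n L k
  rw [hat_gammaInv, hat_gammaInv, NNReal.coe_mul, NNReal.coe_natCast,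
    dilates_scale 1 _ n, dilates_scale (-1) _ n]
  ring

theorem gamma_gammaInv (g₁ g₂ : C0inf ℂ) :
    gamma ⟨gammaInv g₁ g₂, gammaInv_mem_H0 g₁ g₂⟩ = (g₁, g₂) := by
  refine Prod.ext (Subtype.ext (funext fun L => ?_)) (Subtype.ext (funext fun L => ?_))
  · change hat (gammaInv g₁ g₂).1 L 1 = g₁.1 L
    rw [hat_gammaInv]
    simp [dilates, zeroExt_coe]
  · change hat (gammaInv g₁ g₂).1 L (-1) = g₂.1 L
    rw [hat_gammaInv]
    simp [dilates, zeroExt_coe]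

theorem gamma_bijective : Function.Bijective gamma :=
  ⟨gamma_injective, fun g => ⟨⟨_, gammaInv_mem_H0 g.1 g.2⟩, gamma_gammaInv g.1 g.2⟩⟩

/-! ### Mellin transforms and the Riemann zeta function -/

/-- A measurable function on `(0,∞)` that is bounded and `O(u⁻²)`. -/
def IsAdmissible (f : ℝ → ℂ) : Prop :=
  Measurable f ∧ ∃ C : ℝ, ∀ u > 0, ‖f u‖ ≤ C ∧ ‖f u‖ * u ^ 2 ≤ C

/-- The sum over dilates `u ↦ ∑_{n ≥ 1} f(n u)`. -/
def dilateSum (f : ℝ → ℂ) (u : ℝ) : ℂ := ∑' n : ℕ+, f ((n : ℝ) * u)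

theorem IsAdmissible.locallyIntegrableOn {f : ℝ → ℂ} (hf : IsAdmissible f) :
    LocallyIntegrableOn f (Ioi 0) := by
  obtain ⟨hm, C, hC⟩ := hf
  refine locallyIntegrableOn_of_locallyIntegrable_restrict ?_
  refine (locallyIntegrable_const C).mono hm.aestronglyMeasurable ?_
  filter_upwards [ae_restrict_mem measurableSet_Ioi] with u hu
  exact ((hC u hu).1).trans (le_abs_self C)

theorem IsAdmissible.isBigO_top {f : ℝ → ℂ} (hf : IsAdmissible f) :
    f =O[atTop] fun x : ℝ => x ^ (-(2 : ℝ)) := by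
  obtain ⟨hm, C, hC⟩ := hf
  refine Asymptotics.IsBigO.of_bound C ?_
  filter_upwards [Ioi_mem_atTop (0 : ℝ)] with u hu
  have hu0 : (0 : ℝ) < u := hu
  rw [Real.rpow_neg hu0.le, Real.norm_of_nonneg (by positivity), ← div_eq_mul_inv,
    le_div_iff₀ (by positivity)]
  exact_mod_cast (hC u hu).2

theorem IsAdmissible.isBigO_zero {f : ℝ → ℂ} (hf : IsAdmissible f) :
    f =O[𝓝[>] 0] fun x : ℝ => x ^ (-(0 : ℝ)) := by
  obtain ⟨hm, C, hC⟩ := hf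
  refine Asymptotics.IsBigO.of_bound C ?_
  filter_upwards [self_mem_nhdsWithin] with u hu
  simpa using (hC u hu).1

theorem IsAdmissible.mellinConvergent {f : ℝ → ℂ} (hf : IsAdmissible f) {s : ℂ} (h0 : 0 < s.re)
    (h2 : s.re < 2) : MellinConvergent f s :=
  mellinConvergent_of_isBigO_rpow hf.locallyIntegrableOn hf.isBigO_top h2 hf.isBigO_zero h0

theorem IsAdmissible.differentiableAt_mellin {f : ℝ → ℂ} (hf : IsAdmissible f) {s : ℂ}
    (h0 : 0 < s.re) (h2 : s.re < 2) : DifferentiableAt ℂ (mellin f) s :=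
  mellin_differentiableAt_of_isBigO_rpow hf.locallyIntegrableOn hf.isBigO_top h2 hf.isBigO_zero h0

theorem summable_pnat_rpow {σ : ℝ} (hσ : 1 < σ) : Summable fun n : ℕ+ => ((n : ℝ) ^ σ)⁻¹ :=
  (Real.summable_nat_rpow_inv.2 hσ).comp_injective PNat.coe_injective

theorem summable_pnat_inv_sq : Summable fun n : ℕ+ => ((n : ℝ) ^ 2)⁻¹ := by
  have := summable_pnat_rpow (σ := 2) (by norm_num)
  exact_mod_cast this

theorem IsAdmissible.summable {f : ℝ → ℂ} (hf : IsAdmissible f) {u : ℝ} (hu : 0 < u) :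
    Summable fun n : ℕ+ => f ((n : ℝ) * u) := by
  obtain ⟨hm, C, hC⟩ := hf
  refine Summable.of_norm_bounded (summable_pnat_inv_sq.mul_left (C * (u ^ 2)⁻¹)) fun n => ?_
  have hn : (0 : ℝ) < n := by exact_mod_cast n.pos
  have h := (hC (n * u) (by positivity)).2
  rw [← le_div_iff₀ (by positivity)] at h
  refine h.trans (le_of_eq ?_)
  rw [mul_pow, div_eq_mul_inv, mul_inv]
  ring

theorem measurable_tsum_of_summable {α ι : Type*} [MeasurableSpace α] [Countable ι]
    {g : ι → α → ℂ} (hg : ∀ i, Measurable (g i)) {s : Set α} (hs : MeasurableSet s)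
    (h : ∀ x ∈ s, Summable fun i => g i x) : Measurable (s.indicator fun x => ∑' i, g i x) := by
  have h1 : s.indicator (fun x => ∑' i, g i x) = fun x => ∑' i, s.indicator (g i) x := by
    funext x
    by_cases hx : x ∈ s <;> simp [hx]
  rw [h1]
  refine measurable_of_tendsto_metrizable'
    (f := fun (t : Finset ι) x => ∑ i ∈ t, s.indicator (g i) x) atTop (fun t => Finset.measurable_sum t fun i _ => (hg i).indicator hs) ?_
  rw [tendsto_pi_nhds]
  intro x
  by_cases hx : x ∈ s
  · simp only [indicator_of_mem hx]
    exact (h x hx).hasSum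
  · simp [hx]

/-- The sum over dilates of an admissible function, cut off to `(0,∞)`, is admissible as soon as it
is bounded. -/
theorem IsAdmissible.dilateSum {f : ℝ → ℂ} (hf : IsAdmissible f) {B : ℝ}
    (hB : ∀ u > 0, ‖dilateSum f u‖ ≤ B) : IsAdmissible ((Ioi 0).indicator (dilateSum f)) := by
  refine ⟨measurable_tsum_of_summable (fun n : ℕ+ => hf.1.comp (measurable_const_mul (n : ℝ)))
    measurableSet_Ioi fun u hu => hf.summable hu, ?_⟩
  obtain ⟨hm, C, hC⟩ := id hf
  refine ⟨max B (C * ∑' n : ℕ+, ((n : ℝ) ^ 2)⁻¹), fun u hu => ?_⟩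
  rw [indicator_of_mem (mem_Ioi.2 hu)]
  refine ⟨(hB u hu).trans (le_max_left _ _), le_trans ?_ (le_max_right _ _)⟩
  have h1 : ∀ n : ℕ+, ‖f ((n : ℝ) * u)‖ ≤ C * (u ^ 2)⁻¹ * ((n : ℝ) ^ 2)⁻¹ := by
    intro n
    have hn : (0 : ℝ) < n := by exact_mod_cast n.pos
    have h := (hC (n * u) (by positivity)).2
    rw [← le_div_iff₀ (by positivity)] at h
    refine h.trans (le_of_eq ?_)
    rw [mul_pow, div_eq_mul_inv, mul_inv]
    ring
  have h2 := tsum_of_norm_bounded (summable_pnat_inv_sq.mul_left (C * (u ^ 2)⁻¹)).hasSum h1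
  rw [tsum_mul_left] at h2
  calc ‖ScalingSite.dilateSum f u‖ * u ^ 2
      ≤ (C * (u ^ 2)⁻¹ * ∑' n : ℕ+, ((n : ℝ) ^ 2)⁻¹) * u ^ 2 :=
        mul_le_mul_of_nonneg_right h2 (by positivity)
    _ = _ := by field_simp

theorem mellin_indicator_Ioi (f : ℝ → ℂ) (s : ℂ) :
    mellin ((Ioi 0).indicator f) s = mellin f s := by
  refine setIntegral_congr_fun measurableSet_Ioi fun t ht => ?_
  simp only [indicator_of_mem ht]

/-- In the half-plane of absolute convergence the Mellin transform of `∑ f(n u)` is obtained by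
integrating term by term. -/
theorem mellin_dilateSum_of_one_lt {f : ℝ → ℂ} (hf : IsAdmissible f) {s : ℂ} (h1 : 1 < s.re)
    (h2 : s.re < 2) : mellin (dilateSum f) s = riemannZeta s * mellin f s := by
  have hc := hf.mellinConvergent (by linarith) h2
  set F : ℕ+ → ℝ → ℂ := fun n t => (t : ℂ) ^ (s - 1) • f ((n : ℝ) * t) with hF
  have hn : ∀ n : ℕ+, (0 : ℝ) < n := fun n => by exact_mod_cast n.pos
  have hF_int : ∀ n, Integrable (F n) (volume.restrict (Ioi 0)) := fun n =>
    (MellinConvergent.comp_mul_left (hn n)).2 hc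
  set G : ℝ → ℝ := fun t => t ^ (s.re - 1) * ‖f t‖ with hG
  have hFG : ∀ n, ∫ t in Ioi 0, ‖F n t‖ = ((n : ℝ) ^ s.re)⁻¹ * ∫ t in Ioi 0, G t := by
    intro n
    have e1 : ∀ t ∈ Ioi (0 : ℝ), ‖F n t‖ = (n : ℝ) ^ (1 - s.re) * G (n * t) := by
      intro t ht
      have ht0 : (0 : ℝ) < t := ht
      simp only [hF, hG]
      rw [norm_smul, Complex.norm_cpow_eq_rpow_re_of_pos ht0, Real.mul_rpow (hn n).le ht0.le,
        ← mul_assoc, ← mul_assoc, ← Real.rpow_add (hn n)]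
      simp
    rw [setIntegral_congr_fun measurableSet_Ioi e1, integral_const_mul,
      integral_comp_mul_left_Ioi G 0 (hn n), mul_zero, smul_eq_mul, ← mul_assoc,
      ← Real.rpow_neg (hn n).le, ← Real.rpow_neg_one, ← Real.rpow_add (hn n)]
    ring_nf
  have hF_sum : Summable fun n => ∫ t in Ioi 0, ‖F n t‖ := by
    simp only [hFG]
    exact (summable_pnat_rpow h1).mul_right _
  have hs := (hasSum_integral_of_summable_integral_norm hF_int hF_sum).tsum_eq
  have e2 : mellin (dilateSum f) s = ∫ t in Ioi 0, ∑' n, F n t := by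
    refine setIntegral_congr_fun measurableSet_Ioi fun t _ => ?_
    simp only [hF, dilateSum, smul_eq_mul]
    rw [tsum_mul_left]
  have e3 : ∀ n : ℕ+, ∫ t in Ioi 0, F n t = ((n : ℕ) : ℂ) ^ (-s) * mellin f s := by
    intro n
    have := mellin_comp_mul_left f s (hn n)
    rw [smul_eq_mul] at this
    exact_mod_cast this
  rw [e2, ← hs]
  simp only [e3]
  rw [tsum_mul_right, zeta_eq_tsum_one_div_nat_add_one_cpow h1,
    tsum_pnat_eq_tsum_succ (f := fun n : ℕ => (n : ℂ) ^ (-s))]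
  congr 2
  funext n
  rw [Complex.cpow_neg, one_div]
  push_cast
  rfl

theorem eqOn_of_eventuallyEq_of_convex {f g : ℂ → ℂ} {U : Set ℂ} (hU : IsOpen U)
    (hc : Convex ℝ U) (hf : DifferentiableOn ℂ f U) (hg : DifferentiableOn ℂ g U) {z : ℂ}
    (hz : z ∈ U) (h : f =ᶠ[𝓝 z] g) : EqOn f g U :=
  (hf.analyticOnNhd hU).eqOn_of_preconnected_of_eventuallyEq (hg.analyticOnNhd hU)
    hc.isPreconnected hz h

/-- By analytic continuation the factorization of the Mellin transform of `∑ f(n u)` holds in the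
strip `0 < re s < 1`, if this function is bounded. -/
theorem mellin_dilateSum {f : ℝ → ℂ} (hf : IsAdmissible f) {B : ℝ}
    (hB : ∀ u > 0, ‖dilateSum f u‖ ≤ B) {s : ℂ} (h0 : 0 < s.re) (h1 : s.re < 1) :
    mellin (dilateSum f) s = riemannZeta s * mellin f s := by
  set A : ℂ → ℂ := fun s => mellin ((Ioi 0).indicator (dilateSum f)) s with hA
  set Z : ℂ → ℂ := fun s => riemannZeta s * mellin f s with hZ
  have hAd : ∀ s : ℂ, 0 < s.re → s.re < 2 → DifferentiableAt ℂ A s := fun s h h' =>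
    (hf.dilateSum hB).differentiableAt_mellin h h'
  have hZd : ∀ s : ℂ, 0 < s.re → s.re < 2 → s ≠ 1 → DifferentiableAt ℂ Z s := fun s h h' hs =>
    (differentiableAt_riemannZeta hs).mul (hf.differentiableAt_mellin h h')
  -- The strips `0 < re s < 2, 0 < im s` and `0 < re s < 1` overlap and avoid the pole of `ζ`; the
  -- identity spreads from `1 < re s` to the former and from there to the latter.
  have hre : ∀ a b : ℝ, IsOpen {z : ℂ | a < z.re ∧ z.re < b} := fun a b =>
    (isOpen_lt continuous_const Complex.continuous_re).inter
      (isOpen_lt Complex.continuous_re continuous_const)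
  have hcv : ∀ a b : ℝ, Convex ℝ {z : ℂ | a < z.re ∧ z.re < b} := fun a b =>
    (convex_halfSpace_re_gt a).inter (convex_halfSpace_re_lt b)
  have him : IsOpen {z : ℂ | 0 < z.im} := isOpen_lt continuous_const Complex.continuous_im
  have hU1 : EqOn A Z ({z : ℂ | 0 < z.re ∧ z.re < 2} ∩ {z : ℂ | 0 < z.im}) := by
    refine eqOn_of_eventuallyEq_of_convex (z := 3 / 2 + Complex.I) ((hre 0 2).inter him)
      ((hcv 0 2).inter (convex_halfSpace_im_gt 0))
      (fun z hz => (hAd z hz.1.1 hz.1.2).differentiableWithinAt)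
      (fun z hz => (hZd z hz.1.1 hz.1.2 ?_).differentiableWithinAt) ?_ ?_
    · rintro rfl
      simpa using hz.2
    · norm_num
    · filter_upwards [(hre 1 2).mem_nhds (by norm_num : (3 / 2 + Complex.I : ℂ) ∈ _)] with z hz
      simp only [hA, hZ, mellin_indicator_Ioi]
      exact mellin_dilateSum_of_one_lt hf hz.1 hz.2
  have hU2 : EqOn A Z {z : ℂ | 0 < z.re ∧ z.re < 1} := by
    refine eqOn_of_eventuallyEq_of_convex (z := 1 / 2 + Complex.I) (hre 0 1) (hcv 0 1)
      (fun z hz => (hAd z hz.1 (hz.2.trans one_lt_two)).differentiableWithinAt)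
      (fun z hz => (hZd z hz.1 (hz.2.trans one_lt_two) ?_).differentiableWithinAt) ?_ ?_
    · rintro rfl
      simpa using hz.2
    · norm_num
    · filter_upwards [((hre 0 2).inter him).mem_nhds
        (by norm_num : (1 / 2 + Complex.I : ℂ) ∈ _)] with z hz
      exact hU1 hz
  have h3 := hU2 (show s ∈ {z : ℂ | 0 < z.re ∧ z.re < 1} from ⟨h0, h1⟩)
  rw [← mellin_indicator_Ioi]
  exact h3

/-! ### The critical line -/

/-- A function on `(0,∞)` in the logarithmic coordinate, weighted by `u^{1/2}`. -/
def logCoord (f : ℝ → ℂ) (y : ℝ) : ℂ := ((Real.exp (y / 2) : ℝ) : ℂ) * f (Real.exp y)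

theorem IsAdmissible.measurable_logCoord {f : ℝ → ℂ} (hf : IsAdmissible f) :
    Measurable (logCoord f) :=
  (Complex.measurable_ofReal.comp (Real.measurable_exp.comp (measurable_id.div_const 2))).mul
    (hf.1.comp Real.measurable_exp)

theorem IsAdmissible.norm_logCoord_le {f : ℝ → ℂ} (hf : IsAdmissible f) :
    ∃ C, 0 ≤ C ∧ ∀ y, ‖logCoord f y‖ ≤ C * Real.exp (-|y| / 2) := by
  obtain ⟨hm, C, hC⟩ := hf
  have hC0 : 0 ≤ C := (norm_nonneg _).trans (hC 1 one_pos).1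
  refine ⟨C, hC0, fun y => ?_⟩
  obtain ⟨h1, h2⟩ := hC (Real.exp y) (Real.exp_pos y)
  rw [logCoord, norm_mul, Complex.norm_real, Real.norm_of_nonneg (Real.exp_pos _).le]
  rcases le_total 0 y with hy | hy
  · rw [abs_of_nonneg hy]
    have h3 : Real.exp (y / 2) ≤ Real.exp (-y / 2) * Real.exp y ^ 2 := by
      rw [← Real.exp_nat_mul, ← Real.exp_add, Real.exp_le_exp]
      push_cast
      linarith
    calc Real.exp (y / 2) * ‖f (Real.exp y)‖
        ≤ (Real.exp (-y / 2) * Real.exp y ^ 2) * ‖f (Real.exp y)‖ := by gcongr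
      _ = (‖f (Real.exp y)‖ * Real.exp y ^ 2) * Real.exp (-y / 2) := by ring
      _ ≤ C * Real.exp (-y / 2) := by gcongr
  · rw [abs_of_nonpos hy, neg_neg, mul_comm]
    gcongr

/-- On the critical line the Mellin transform is the Fourier transform in the logarithmic
coordinate. -/
theorem mellin_half_eq_fourier (f : ℝ → ℂ) (ξ : ℝ) :
    mellin f (1 / 2 - 2 * Real.pi * Complex.I * ξ) = 𝓕 (logCoord f) ξ := by
  rw [mellin_eq_fourier]
  have hre : (1 / 2 - 2 * Real.pi * Complex.I * ξ : ℂ).re = 1 / 2 := by simp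
  have him : (1 / 2 - 2 * Real.pi * Complex.I * ξ : ℂ).im / (2 * Real.pi) = -ξ := by
    simp; field_simp
  rw [hre, him, Real.fourier_eq', Real.fourier_eq',
    ← integral_neg_eq_self (fun v : ℝ => Complex.exp (↑(-2 * Real.pi * inner ℝ v ξ) * Complex.I) •
      logCoord f v)]
  congr 1
  funext v
  simp only [logCoord, inner_neg_left, inner_neg_right]
  rw [Complex.real_smul]
  congr 4
  ring

theorem integrable_pow_smul_of_exp_decay {G : ℝ → ℂ} (hm : AEStronglyMeasurable G) {C : ℝ}
    (hG : ∀ y, ‖G y‖ ≤ C * Real.exp (-|y| / 2)) (n : ℕ) :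
    Integrable fun y : ℝ => y ^ n • G y := by
  set K : ℝ := 2 ^ n * n.factorial + 2 ^ (n + 2) * (n + 2).factorial with hK
  refine (integrable_inv_one_add_sq.const_mul (C * K)).mono'
    ((continuous_pow n).aestronglyMeasurable.smul hm) (ae_of_all _ fun y => ?_)
  -- From `t ^ k / k! ≤ exp t` at `t = |y| / 2`.
  have hpow : ∀ k : ℕ, |y| ^ k ≤ 2 ^ k * k.factorial * Real.exp (|y| / 2) := by
    intro k
    have h := Real.pow_div_factorial_le_exp (x := |y| / 2) (by positivity) k
    rw [div_le_iff₀ (by positivity), div_pow, div_le_iff₀ (by positivity)] at h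
    calc |y| ^ k ≤ _ := h
      _ = _ := by ring
  have h1 : |y| ^ n * (1 + y ^ 2) ≤ K * Real.exp (|y| / 2) := by
    have h2 := hpow n
    have h3 := hpow (n + 2)
    rw [pow_add, sq_abs] at h3
    rw [hK]
    nlinarith
  have h4 : Real.exp (-|y| / 2) * Real.exp (|y| / 2) = 1 := by
    rw [← Real.exp_add]; simp [neg_div]
  rw [norm_smul, norm_pow, Real.norm_eq_abs, ← div_eq_mul_inv, le_div_iff₀ (by positivity)]
  calc |y| ^ n * ‖G y‖ * (1 + y ^ 2) = (|y| ^ n * (1 + y ^ 2)) * ‖G y‖ := by ring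
    _ ≤ (K * Real.exp (|y| / 2)) * (C * Real.exp (-|y| / 2)) :=
        mul_le_mul h1 (hG y) (norm_nonneg _) (by positivity)
    _ = C * K * (Real.exp (-|y| / 2) * Real.exp (|y| / 2)) := by ring
    _ = C * K := by rw [h4, mul_one]

/-- All derivatives of the Fourier transform of an exponentially decaying function are bounded. -/
theorem hasTemperateGrowth_fourier {G : ℝ → ℂ} (hm : AEStronglyMeasurable G) {C : ℝ}
    (hG : ∀ y, ‖G y‖ ≤ C * Real.exp (-|y| / 2)) :
    (𝓕 G : ℝ → ℂ).HasTemperateGrowth := by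
  have hi := integrable_pow_smul_of_exp_decay hm hG
  refine ⟨contDiff_infty.2 fun n => Real.contDiff_fourier (N := n) fun k _ => ?_, fun n => ?_⟩
  · convert! (hi k).norm using 2 with y
    rw [norm_smul, norm_pow]
  · refine ⟨0, ∫ y, ‖(-2 * Real.pi * Complex.I * (y : ℝ) : ℂ) ^ n • G y‖, fun x => ?_⟩
    rw [norm_iteratedFDeriv_eq_norm_iteratedDeriv, Real.iteratedDeriv_fourier (N := n)
      (fun k _ => hi k) le_rfl, pow_zero, mul_one, Real.fourier_eq]
    refine (norm_integral_le_integral_norm _).trans (le_of_eq ?_)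
    congr 1
    funext y
    rw [Circle.norm_smul]

theorem IsAdmissible.hasTemperateGrowth_mellin {f : ℝ → ℂ} (hf : IsAdmissible f) :
    (fun ξ : ℝ => mellin f (1 / 2 - 2 * Real.pi * Complex.I * ξ)).HasTemperateGrowth := by
  obtain ⟨C, -, h⟩ := hf.norm_logCoord_le
  have := hasTemperateGrowth_fourier hf.measurable_logCoord.aestronglyMeasurable h
  convert! this using 1
  exact funext fun ξ => mellin_half_eq_fourier f ξ

/-- The test function `u ↦ 1 - 2u` on `(0,1]`; it has integral `0`, and its Mellin transform is
`(1 - s) / (s (s + 1))`. -/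
def linearTest : ℝ → ℂ := indicator (Ioc 0 1) fun u => 1 - 2 * (u : ℂ)

theorem isAdmissible_linearTest : IsAdmissible linearTest := by
  refine ⟨(measurable_const.sub (measurable_const.mul Complex.measurable_ofReal)).indicator
    measurableSet_Ioc, 1, fun u hu => ?_⟩
  by_cases h : u ∈ Ioc (0 : ℝ) 1
  · have h1 : ‖linearTest u‖ ≤ 1 := by
      rw [linearTest, indicator_of_mem h]
      have : (1 - 2 * (u : ℂ)) = ((1 - 2 * u : ℝ) : ℂ) := by push_cast; ring
      rw [this, Complex.norm_real, Real.norm_eq_abs, abs_le]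
      constructor <;> linarith [h.1, h.2]
    exact ⟨h1, mul_le_one₀ h1 (by positivity) (pow_le_one₀ h.1.le h.2)⟩
  · rw [linearTest, indicator_of_notMem h]
    simp

theorem mellin_linearTest {s : ℂ} (hs : 0 < s.re) :
    mellin linearTest s = (1 - s) / (s * (s + 1)) := by
  have h1 := hasMellin_one_Ioc hs
  have h2 := hasMellin_cpow_Ioc 1 (s := s) (by simp; linarith)
  have h3 := hasMellin_const_smul h2.1 (2 : ℂ)
  have h4 := hasMellin_sub h1.1 h3.1
  have h5 : linearTest = fun t => indicator (Ioc 0 1) (fun _ => 1 : ℝ → ℂ) t -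
      (2 : ℂ) • indicator (Ioc 0 1) (fun t : ℝ => (t : ℂ) ^ (1 : ℂ)) t := by
    funext t
    by_cases h : t ∈ Ioc (0 : ℝ) 1 <;> simp [linearTest, h]
  have hs0 : s ≠ 0 := by rintro rfl; simp at hs
  have hs1 : s + 1 ≠ 0 := by
    intro h
    have := congrArg Complex.re h
    simp at this
    linarith
  rw [h5, h4.2, h3.2, h1.2, h2.2, smul_eq_mul]
  field_simp
  ring

theorem sum_range_one_sub (N : ℕ) (u : ℝ) :
    ∑ n ∈ Finset.range N, (1 - 2 * (((n + 1 : ℕ) : ℝ) * u)) = N - u * (N * (N + 1)) := by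
  induction N with
  | zero => simp
  | succ N ih => rw [Finset.sum_range_succ, ih]; push_cast; ring

/-- The Riemann sums of `1 - 2u`, which has integral `0`, are bounded after division by the mesh. -/
theorem norm_dilateSum_linearTest_le {u : ℝ} (hu : 0 < u) : ‖dilateSum linearTest u‖ ≤ 1 := by
  -- The terms with `n ≤ N = ⌊1/u⌋` sum to `N (1 - u N) - u N`.
  set N := ⌊u⁻¹⌋₊ with hN
  have h1 : dilateSum linearTest u = ((N - u * (N * (N + 1)) : ℝ) : ℂ) := by
    rw [dilateSum, tsum_pnat_eq_tsum_succ (f := fun n : ℕ => linearTest ((n : ℝ) * u)),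
      ← sum_range_one_sub, tsum_eq_sum (s := Finset.range N)]
    · push_cast
      refine Finset.sum_congr rfl fun n hn => ?_
      have h2 : n + 1 ≤ N := Finset.mem_range.1 hn
      have h3 : ((n + 1 : ℕ) : ℝ) ≤ u⁻¹ :=
        (Nat.le_floor_iff (by positivity)).1 h2
      have h4 : ((n + 1 : ℕ) : ℝ) * u ≤ 1 := by
        calc ((n + 1 : ℕ) : ℝ) * u ≤ u⁻¹ * u := mul_le_mul_of_nonneg_right h3 hu.le
          _ = 1 := inv_mul_cancel₀ hu.ne'
      push_cast at h4
      rw [linearTest, indicator_of_mem (show ((n : ℝ) + 1) * u ∈ Ioc (0 : ℝ) 1 from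
        ⟨by positivity, h4⟩)]
      push_cast
      ring
    · intro n hn
      have h2 : N < n + 1 := by simpa [Nat.lt_succ_iff] using hn
      have h3 : u⁻¹ < ((n + 1 : ℕ) : ℝ) := (Nat.floor_lt (by positivity)).1 h2
      rw [linearTest, indicator_of_notMem]
      intro h
      have := h.2
      rw [← inv_mul_cancel₀ hu.ne'] at this
      exact absurd (lt_of_mul_lt_mul_right (lt_of_lt_of_le (mul_lt_mul_of_pos_right h3 hu) this)
        hu.le) (lt_irrefl _)
  have h2 : (N : ℝ) ≤ u⁻¹ := Nat.floor_le (by positivity)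
  have h3 : u⁻¹ < N + 1 := Nat.lt_floor_add_one _
  have h4 : (N : ℝ) * u ≤ 1 := by
    calc (N : ℝ) * u ≤ u⁻¹ * u := by gcongr
      _ = 1 := inv_mul_cancel₀ hu.ne'
  have h5 : 1 < (N + 1) * u := by
    calc 1 = u⁻¹ * u := (inv_mul_cancel₀ hu.ne').symm
      _ < (N + 1) * u := by gcongr
  rw [h1, Complex.norm_real, Real.norm_eq_abs, abs_le]
  have hN0 : (0 : ℝ) ≤ N := Nat.cast_nonneg N
  constructor <;> nlinarith

/-- The function `(1 - s) ζ(s)` at `s = 1/2 - 2πiξ`. -/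
def zetaSymbol (ξ : ℝ) : ℂ :=
  (1 - (1 / 2 - 2 * Real.pi * Complex.I * ξ)) * riemannZeta (1 / 2 - 2 * Real.pi * Complex.I * ξ)

theorem hasTemperateGrowth_affine (a b : ℂ) :
    (fun ξ : ℝ => a + b * (ξ : ℂ)).HasTemperateGrowth :=
  (Function.HasTemperateGrowth.const a).add
    ((Function.HasTemperateGrowth.const b).mul Function.Complex.hasTemperateGrowth_ofReal)

/-- On the critical line `(1 - s) ζ(s)` is `s (s + 1)` times the Mellin transform of a bounded
function that vanishes for `u > 1`. Hence `ζ` and its derivatives grow at most polynomially. -/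
theorem hasTemperateGrowth_zetaSymbol : zetaSymbol.HasTemperateGrowth := by
  have hB : ∀ u > 0, ‖dilateSum linearTest u‖ ≤ 1 := fun u hu => norm_dilateSum_linearTest_le hu
  have h1 := (isAdmissible_linearTest.dilateSum hB).hasTemperateGrowth_mellin
  have h2 := ((hasTemperateGrowth_affine (1 / 2) (-(2 * Real.pi * Complex.I))).mul
    (hasTemperateGrowth_affine (3 / 2) (-(2 * Real.pi * Complex.I)))).mul h1
  convert! h2 using 1
  funext ξ
  set s : ℂ := 1 / 2 - 2 * Real.pi * Complex.I * ξ with hs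
  have hre : s.re = 1 / 2 := by simp [hs]
  have hs0 : s ≠ 0 := by
    intro h
    rw [h] at hre
    norm_num at hre
  have hs1 : s + 1 ≠ 0 := by
    intro h
    have := congrArg Complex.re h
    rw [Complex.add_re, hre] at this
    norm_num at this
  simp only [Pi.mul_apply]
  rw [mellin_indicator_Ioi, mellin_dilateSum isAdmissible_linearTest hB (by rw [hre]; norm_num)
    (by rw [hre]; norm_num), mellin_linearTest (by rw [hre]; norm_num), zetaSymbol, ← hs,
    show (1 / 2 + -(2 * Real.pi * Complex.I) * ξ : ℂ) = s by rw [hs]; ring,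
    show (3 / 2 + -(2 * Real.pi * Complex.I) * ξ : ℂ) = s + 1 by rw [hs]; ring]
  field_simp

/-! ### The functions `ℰ(f)` -/

theorem isAdmissible_ofReal_schwartz (f : SchwartzMap ℝ ℝ) :
    IsAdmissible fun u => (f u : ℂ) := by
  refine ⟨Complex.measurable_ofReal.comp f.continuous.measurable, ?_⟩
  obtain ⟨C₀, -, h₀⟩ := f.decay 0 0
  obtain ⟨C₂, -, h₂⟩ := f.decay 2 0
  refine ⟨max C₀ C₂, fun u hu => ⟨?_, ?_⟩⟩
  · have := h₀ u
    simp only [norm_iteratedFDeriv_zero, pow_zero, one_mul] at this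
    simpa using Or.inl this
  · have := h₂ u
    simp only [norm_iteratedFDeriv_zero, Real.norm_of_nonneg hu.le] at this
    rw [Complex.norm_real, mul_comm]
    exact this.trans (le_max_right _ _)

/-- A right Riemann sum differs from the integral by at most the mesh times the total variation. -/
theorem abs_riemannSum_sub_integral_le (f : SchwartzMap ℝ ℝ) {u : ℝ} (hu : 0 < u) (N : ℕ) :
    |u * ∑ n ∈ Finset.range N, f (((n + 1 : ℕ) : ℝ) * u) - ∫ x in (0 : ℝ)..N * u, f x|
      ≤ u * ∫ x, |deriv f x| := by
  have hd : Integrable (deriv f) := (SchwartzMap.derivCLM ℝ ℝ f).integrable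
  have hfi : ∀ a b : ℝ, IntervalIntegrable f volume a b := fun a b =>
    f.continuous.intervalIntegrable a b
  have hdi : ∀ a b : ℝ, IntervalIntegrable (deriv f) volume a b := fun a b =>
    hd.intervalIntegrable
  have h1 : ∀ n : ℕ,
      |u * f (((n + 1 : ℕ) : ℝ) * u) - ∫ x in (n * u : ℝ)..((n + 1 : ℕ) : ℝ) * u, f x| ≤ u * ∫ x in (n * u : ℝ)..((n + 1 : ℕ) : ℝ) * u, |deriv f x| := by
    intro n
    have hab : (n * u : ℝ) ≤ ((n + 1 : ℕ) : ℝ) * u := by push_cast; nlinarith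
    have hlen : ((n + 1 : ℕ) : ℝ) * u - n * u = u := by push_cast; ring
    have e1 : u * f (((n + 1 : ℕ) : ℝ) * u) - ∫ x in (n * u : ℝ)..((n + 1 : ℕ) : ℝ) * u, f x =
        ∫ x in (n * u : ℝ)..((n + 1 : ℕ) : ℝ) * u, (f (((n + 1 : ℕ) : ℝ) * u) - f x) := by
      rw [intervalIntegral.integral_sub (by simp) (hfi _ _), intervalIntegral.integral_const, hlen,
        smul_eq_mul]
    have h2 := intervalIntegral.norm_integral_le_of_norm_le_const (a := (n * u : ℝ))
      (b := ((n + 1 : ℕ) : ℝ) * u) (f := fun x => f (((n + 1 : ℕ) : ℝ) * u) - f x)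
      (C := ∫ x in (n * u : ℝ)..((n + 1 : ℕ) : ℝ) * u, |deriv f x|) (by
        intro x hx
        rw [uIoc_of_le hab] at hx
        rw [← intervalIntegral.integral_eq_sub_of_hasDerivAt (fun y _ => f.hasDerivAt y) (hdi _ _)]
        refine (intervalIntegral.norm_integral_le_integral_norm hx.2).trans ?_
        exact intervalIntegral.integral_mono_interval hx.1.le hx.2 le_rfl
          (ae_of_all _ fun y => abs_nonneg _) (hdi _ _).abs)
    rw [hlen, abs_of_pos hu] at h2
    rw [e1, mul_comm u (∫ x in _.._, _)]
    exact h2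
  have h3 := intervalIntegral.sum_integral_adjacent_intervals (f := f) (μ := volume)
    (a := fun n : ℕ => (n * u : ℝ)) (n := N) fun k _ => hfi _ _
  have h4 := intervalIntegral.sum_integral_adjacent_intervals (f := fun x => |deriv f x|)
    (μ := volume) (a := fun n : ℕ => (n * u : ℝ)) (n := N) fun k _ => (hdi _ _).abs
  simp only [Nat.cast_zero, zero_mul] at h3 h4
  rw [← h3, Finset.mul_sum, ← Finset.sum_sub_distrib]
  refine (Finset.abs_sum_le_sum_abs _ _).trans ((Finset.sum_le_sum fun n _ => h1 n).trans ?_)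
  rw [← Finset.mul_sum, h4]
  gcongr
  rw [intervalIntegral.integral_of_le (by positivity)]
  exact setIntegral_le_integral hd.abs (ae_of_all _ fun y => abs_nonneg _)

/-- The vanishing of the integral of `f` makes the sum over dilates bounded near `u = 0`. -/
theorem norm_dilateSum_schwartz_le {f : SchwartzMap ℝ ℝ} (hf : f ∈ SchwartzEvenZero) {u : ℝ}
    (hu : 0 < u) : ‖dilateSum (fun u => (f u : ℂ)) u‖ ≤ ∫ x, |deriv f x| := by
  obtain ⟨hev, -, hint⟩ := hf
  have h0 : ∫ x in Ioi (0 : ℝ), f x = 0 := by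
    have h := integral_comp_abs (f := f)
    have h' : (fun x : ℝ => f |x|) = f := by
      funext x
      rcases abs_choice x with h | h <;> rw [h]
      exact hev x
    rw [h', hint] at h
    linarith
  have hsum := (isAdmissible_ofReal_schwartz f).summable hu
  have h1 : dilateSum (fun u => (f u : ℂ)) u = ∑' n : ℕ, (f (((n + 1 : ℕ) : ℝ) * u) : ℂ) :=
    tsum_pnat_eq_tsum_succ (f := fun n : ℕ => (f ((n : ℝ) * u) : ℂ))
  have hsum' : Summable fun n : ℕ => (f (((n + 1 : ℕ) : ℝ) * u) : ℂ) :=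
    (summable_pnat_iff_summable_succ (f := fun n : ℕ => (f ((n : ℝ) * u) : ℂ))).1 hsum
  have h2 : Tendsto (fun N : ℕ => ∑ n ∈ Finset.range N, (f (((n + 1 : ℕ) : ℝ) * u) : ℂ)) atTop
      (𝓝 (dilateSum (fun u => (f u : ℂ)) u)) := by
    rw [h1]
    exact hsum'.hasSum.tendsto_sum_nat
  have h3 : Tendsto (fun N : ℕ => ∫ x in (0 : ℝ)..N * u, f x) atTop (𝓝 0) := by
    have h := intervalIntegral_tendsto_integral_Ioi 0 (f.integrable (μ := volume)).integrableOn
      (tendsto_natCast_atTop_atTop.atTop_mul_const hu)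
    rwa [h0] at h
  have h4 : Tendsto (fun N : ℕ => u⁻¹ * |∫ x in (0 : ℝ)..N * u, f x| + ∫ x, |deriv f x|) atTop
      (𝓝 (∫ x, |deriv f x|)) := by
    simpa using ((h3.abs).const_mul u⁻¹).add_const (∫ x, |deriv f x|)
  refine le_of_tendsto_of_tendsto' h2.norm h4 fun N => ?_
  have h5 := abs_riemannSum_sub_integral_le f hu N
  rw [← Complex.ofReal_sum, Complex.norm_real, Real.norm_eq_abs]
  set S := ∑ n ∈ Finset.range N, f (((n + 1 : ℕ) : ℝ) * u)
  set J := ∫ x in (0 : ℝ)..N * u, f x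
  have h6 : |u * S| ≤ |J| + u * ∫ x, |deriv f x| := by
    have := abs_add_le (u * S - J) J
    rw [sub_add_cancel] at this
    linarith
  rw [abs_mul, abs_of_pos hu] at h6
  calc |S| = u⁻¹ * (u * |S|) := by field_simp
    _ ≤ u⁻¹ * (|J| + u * ∫ x, |deriv f x|) := by gcongr
    _ = _ := by field_simp

theorem mapE_exp (f : SchwartzMap ℝ ℝ) (y : ℝ) :
    mapE f (Real.exp y) = logCoord (dilateSum fun u => (f u : ℂ)) y := by
  rw [mapE, logCoord, dilateSum, Real.sqrt_eq_rpow, ← Real.exp_mul]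
  push_cast
  congr 3
  ring_nf

theorem logCoord_indicator_Ioi (f : ℝ → ℂ) : logCoord ((Ioi 0).indicator f) = logCoord f := by
  funext y
  rw [logCoord, logCoord, indicator_of_mem (mem_Ioi.2 (Real.exp_pos y))]

/-- `ℰ(f)` in the logarithmic coordinate is measurable and decays exponentially. -/
theorem logCoord_dilateSum_schwartz {f : SchwartzMap ℝ ℝ} (hf : f ∈ SchwartzEvenZero) :
    Measurable (logCoord (dilateSum fun u => (f u : ℂ))) ∧
      ∃ C, 0 ≤ C ∧ ∀ y, ‖logCoord (dilateSum fun u => (f u : ℂ)) y‖ ≤ C * Real.exp (-|y| / 2) := by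
  have h := (isAdmissible_ofReal_schwartz f).dilateSum fun u hu => norm_dilateSum_schwartz_le hf hu
  have h1 := h.measurable_logCoord
  have h2 := h.norm_logCoord_le
  rw [logCoord_indicator_Ioi] at h1 h2
  exact ⟨h1, h2⟩

/-- On the critical line, the Fourier transform of `ℰ(f)` is `ζ` times the Mellin transform
of `f`. -/
theorem fourier_logCoord_dilateSum {f : SchwartzMap ℝ ℝ} (hf : f ∈ SchwartzEvenZero) (ξ : ℝ) :
    𝓕 (logCoord (dilateSum fun u => (f u : ℂ))) ξ =
      riemannZeta (1 / 2 - 2 * Real.pi * Complex.I * ξ) *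
        mellin (fun u => (f u : ℂ)) (1 / 2 - 2 * Real.pi * Complex.I * ξ) := by
  have hre : (1 / 2 - 2 * Real.pi * Complex.I * ξ : ℂ).re = 1 / 2 := by simp
  rw [← mellin_half_eq_fourier, mellin_dilateSum (isAdmissible_ofReal_schwartz f)
    (fun u hu => norm_dilateSum_schwartz_le hf hu) (by rw [hre]; norm_num) (by rw [hre]; norm_num)]

/-! ### Periodization -/

/-- `∑_{k ∈ ℤ} G(y + k T)`. -/
def periodize (T : ℝ) (G : ℝ → ℂ) (y : ℝ) : ℂ := ∑' k : ℤ, G (y + k * T)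

theorem summable_int_exp_neg_abs {c : ℝ} (hc : 0 < c) :
    Summable fun k : ℤ => Real.exp (-(|(k : ℝ)| * c)) := by
  have h : Summable fun n : ℕ => Real.exp (-((n : ℝ) * c)) := by
    have := summable_geometric_of_lt_one (Real.exp_pos (-c)).le
      (Real.exp_lt_one_iff.2 (by linarith))
    refine this.congr fun n => ?_
    rw [← Real.exp_nat_mul]
    ring_nf
  refine Summable.of_nat_of_neg ?_ ?_
  · simpa using h
  · simpa using h

theorem norm_comp_add_int_mul_le {G : ℝ → ℂ} {C T y : ℝ} (hC : 0 ≤ C) (hT : 0 < T)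
    (hG : ∀ y, ‖G y‖ ≤ C * Real.exp (-|y| / 2)) (hy : y ∈ Ioc 0 T) (k : ℤ) :
    ‖G (y + k * T)‖ ≤ C * Real.exp (T / 2) * Real.exp (-(|(k : ℝ)| * (T / 2))) := by
  refine (hG _).trans ?_
  rw [mul_assoc, ← Real.exp_add]
  gcongr
  have h1 : |(k : ℝ) * T| ≤ |y + k * T| + |y| := by
    have := abs_sub (y + k * T) y
    rwa [add_sub_cancel_left] at this
  rw [abs_mul, abs_of_pos hT, abs_of_pos hy.1] at h1
  linarith [hy.2]

theorem summable_comp_add_int_mul {G : ℝ → ℂ} {C T y : ℝ} (hC : 0 ≤ C) (hT : 0 < T)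
    (hG : ∀ y, ‖G y‖ ≤ C * Real.exp (-|y| / 2)) (hy : y ∈ Ioc 0 T) :
    Summable fun k : ℤ => G (y + k * T) :=
  Summable.of_norm_bounded ((summable_int_exp_neg_abs (half_pos hT)).mul_left _)
    (norm_comp_add_int_mul_le hC hT hG hy)

theorem norm_periodize_le {G : ℝ → ℂ} {C T y : ℝ} (hC : 0 ≤ C) (hT : 0 < T)
    (hG : ∀ y, ‖G y‖ ≤ C * Real.exp (-|y| / 2)) (hy : y ∈ Ioc 0 T) :
    ‖periodize T G y‖ ≤
      ∑' k : ℤ, C * Real.exp (T / 2) * Real.exp (-(|(k : ℝ)| * (T / 2))) :=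
  tsum_of_norm_bounded ((summable_int_exp_neg_abs (half_pos hT)).mul_left _).hasSum
    (norm_comp_add_int_mul_le hC hT hG hy)

theorem integrable_of_exp_decay {G : ℝ → ℂ} (hm : AEStronglyMeasurable G) {C : ℝ}
    (hG : ∀ y, ‖G y‖ ≤ C * Real.exp (-|y| / 2)) : Integrable G := by
  simpa using integrable_pow_smul_of_exp_decay hm hG 0

theorem hasSum_integral_comp_add_int_mul {E : Type*} [NormedAddCommGroup E] [NormedSpace ℝ E]
    [CompleteSpace E] {H : ℝ → E} (hH : Integrable H) {T : ℝ} (hT : 0 < T) :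
    HasSum (fun k : ℤ => ∫ y in (0 : ℝ)..T, H (y + k * T)) (∫ y, H y) := by
  have h1 : Integrable fun t => T • H (t * T) := (hH.comp_mul_right' hT.ne').smul T
  have h2 := h1.hasSum_intervalIntegral_comp_add_int
  have e1 : ∫ t, T • H (t * T) = ∫ y, H y := by
    rw [integral_smul, Measure.integral_comp_mul_right, abs_of_pos (inv_pos.2 hT), smul_smul,
      mul_inv_cancel₀ hT.ne', one_smul]
  have e2 : ∀ k : ℤ, ∫ t in (0 : ℝ)..1, T • H ((t + k) * T) = ∫ y in (0 : ℝ)..T, H (y + k * T) := by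
    intro k
    have := intervalIntegral.integral_comp_mul_right (a := 0) (b := 1)
      (fun y => H (y + k * T)) hT.ne'
    rw [zero_mul, one_mul] at this
    rw [intervalIntegral.integral_smul]
    simp only [add_mul]
    rw [this, smul_smul, mul_inv_cancel₀ hT.ne', one_smul]
  rw [e1] at h2
  simpa only [e2] using h2

/-- Unfolding: integrating the sum of the translates over a period gives the integral over `ℝ`. -/
theorem integral_periodize {H : ℝ → ℂ} (hH : Integrable H) {T : ℝ} (hT : 0 < T) :
    ∫ y in Ioc 0 T, periodize T H y = ∫ y, H y := by
  have h1 := hasSum_integral_comp_add_int_mul hH hT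
  have h2 := hasSum_integral_comp_add_int_mul hH.norm hT
  simp only [intervalIntegral.integral_of_le hT.le] at h1 h2
  have h3 := hasSum_integral_of_summable_integral_norm (μ := volume.restrict (Ioc 0 T))
    (F := fun (k : ℤ) y => H (y + k * T)) (fun k => (hH.comp_add_right _).integrableOn) h2.summable
  exact h3.unique h1

theorem SigmaMu_exp (f : SchwartzMap ℝ ℝ) (T y : ℝ) :
    SigmaMu (Real.exp T) (mapE f) (Real.exp y) =
      periodize T (logCoord (dilateSum fun u => (f u : ℂ))) y := by
  rw [SigmaMu, periodize]
  refine tsum_congr fun k => ?_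
  rw [← mapE_exp, ← Real.rpow_intCast, ← Real.exp_mul, ← Real.exp_add, add_comm, mul_comm T]

theorem SigmaE_coe (f : SchwartzMap ℝ ℝ) (L : Ioi (0 : ℝ)) (y : ℝ) :
    SigmaE f L (y : Circ L) =
      periodize (L : ℝ) (logCoord (dilateSum fun u => (f u : ℂ))) y :=
  SigmaMu_exp f L y

theorem SigmaE_eq_equivIoc (f : SchwartzMap ℝ ℝ) (L : Ioi (0 : ℝ)) (x : Circ L) :
    SigmaE f L x = periodize (L : ℝ) (logCoord (dilateSum fun u => (f u : ℂ)))
      (AddCircle.equivIoc (L : ℝ) 0 x : ℝ) := by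
  have hx : ((AddCircle.equivIoc (L : ℝ) 0 x : ℝ) : Circ L) = x :=
    (AddCircle.equivIoc (L : ℝ) 0).symm_apply_apply x
  conv_lhs => rw [← hx]
  exact SigmaE_coe f L _

theorem memLp_SigmaE {f : SchwartzMap ℝ ℝ} (hf : f ∈ SchwartzEvenZero) (L : Ioi (0 : ℝ)) :
    MemLp (SigmaE f L) 2 volume := by
  obtain ⟨hm, C, hC, hG⟩ := logCoord_dilateSum_schwartz hf
  have hL : (0 : ℝ) < L := L.2
  set G := logCoord (dilateSum fun u => (f u : ℂ)) with hGdef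
  have hmem : ∀ x : Circ L, (AddCircle.equivIoc (L : ℝ) 0 x : ℝ) ∈ Ioc (0 : ℝ) L := by
    intro x
    simpa using (AddCircle.equivIoc (L : ℝ) 0 x).2
  have h1 : Measurable ((Ioc (0 : ℝ) L).indicator (periodize L G)) :=
    measurable_tsum_of_summable (fun k : ℤ => hm.comp (measurable_add_const _)) measurableSet_Ioc
      fun y hy => summable_comp_add_int_mul hC hL hG hy
  have h2 : Measurable (SigmaE f L) := by
    have e : SigmaE f L = fun x => (Ioc (0 : ℝ) L).indicator (periodize L G)
        (AddCircle.equivIoc (L : ℝ) 0 x : ℝ) := by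
      funext x
      rw [indicator_of_mem (hmem x), SigmaE_eq_equivIoc]
    rw [e]
    exact h1.comp (measurable_subtype_coe.comp
      (AddCircle.measurableEquivIoc (L : ℝ) 0).measurable)
  refine MemLp.of_bound h2.aestronglyMeasurable
    (∑' k : ℤ, C * Real.exp (L / 2) * Real.exp (-(|(k : ℝ)| * (L / 2)))) (ae_of_all _ fun x => ?_)
  rw [SigmaE_eq_equivIoc]
  exact norm_periodize_le hC hL hG (hmem x)

theorem integral_fourier_mul_SigmaE {f : SchwartzMap ℝ ℝ} (hf : f ∈ SchwartzEvenZero)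
    (L : Ioi (0 : ℝ)) (k : ℤ) :
    ∫ x : Circ L, fourier (-k) x * SigmaE f L x =
      riemannZeta (1 / 2 - 2 * Real.pi * Complex.I * (k * (L : ℝ)⁻¹ : ℝ)) *
        mellin (fun u => (f u : ℂ)) (1 / 2 - 2 * Real.pi * Complex.I * (k * (L : ℝ)⁻¹ : ℝ)) := by
  obtain ⟨hm, C, hC, hG⟩ := logCoord_dilateSum_schwartz hf
  have hL : (0 : ℝ) < L := L.2
  rw [← fourier_logCoord_dilateSum hf]
  set G := logCoord (dilateSum fun u => (f u : ℂ)) with hGdef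
  have hGi := integrable_of_exp_decay hm.aestronglyMeasurable hG
  set H : ℝ → ℂ := fun y => fourier (-k) (y : Circ L) * G y with hH
  have hHi : Integrable H := by
    refine hGi.bdd_mul (c := 1) ?_ (ae_of_all _ fun x => ?_)
    · exact ((map_continuous (fourier (-k))).comp
        (AddCircle.continuous_mk' (L : ℝ))).aestronglyMeasurable
    · simp only [fourier_apply, Circle.norm_coe, le_refl]
  rw [← AddCircle.integral_preimage (L : ℝ) 0]
  have e1 : ∀ y : ℝ, fourier (-k) (y : Circ L) * SigmaE f L (y : Circ L) = periodize L H y := by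
    intro y
    rw [SigmaE_coe, periodize, periodize, ← tsum_mul_left]
    refine tsum_congr fun j => ?_
    simp only [hH]
    congr 2
    rw [AddCircle.coe_add, ← zsmul_eq_mul, AddCircle.coe_zsmul, AddCircle.coe_period, smul_zero,
      add_zero]
  simp only [e1, zero_add]
  rw [integral_periodize hHi hL, Real.fourier_eq']
  congr 1
  funext y
  simp only [hH]
  rw [fourier_coe_apply, smul_eq_mul]
  congr 2
  simp
  field_simp

/-! ### The Fourier components of `h · Σℰ(f)` -/

/-- `ζ(s)` times the Mellin transform of `f` at `s = 1/2 - 2πiξ`. -/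
def zetaMellin (f : SchwartzMap ℝ ℝ) (ξ : ℝ) : ℂ :=
  riemannZeta (1 / 2 - 2 * Real.pi * Complex.I * ξ) *
    mellin (fun u => (f u : ℂ)) (1 / 2 - 2 * Real.pi * Complex.I * ξ)

theorem fourierComp_of_ae_eq_mul_SigmaE {f : SchwartzMap ℝ ℝ} (hf : f ∈ SchwartzEvenZero)
    {L : Ioi (0 : ℝ)} {ξ : L2C L} {c : ℂ}
    (h : (ξ : Circ L → ℂ) =ᵐ[volume] fun x => c * SigmaE f L x) (k : ℤ) : fourierComp L ξ k =
      (((Real.sqrt (L : ℝ))⁻¹ : ℝ) : ℂ) * (c * zetaMellin f (k * (L : ℝ)⁻¹)) := by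
  rw [fourierComp, zetaMellin, ← integral_fourier_mul_SigmaE hf,
    ← MeasureTheory.integral_const_mul c (fun x : Circ L => fourier (-k) x * SigmaE f L x)]
  congr 1
  refine integral_congr_ae ?_
  filter_upwards [h] with x hx
  rw [hx, mul_left_comm]

/-- Membership in the generating family of the span can be checked on Fourier components. -/
theorem ae_eq_mul_SigmaE_of_fourierComp {f : SchwartzMap ℝ ℝ} (hf : f ∈ SchwartzEvenZero)
    {L : Ioi (0 : ℝ)} {ξ : L2C L} {c : ℂ} (h : ∀ k : ℤ, fourierComp L ξ k =
      (((Real.sqrt (L : ℝ))⁻¹ : ℝ) : ℂ) * (c * zetaMellin f (k * (L : ℝ)⁻¹))) :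
    (ξ : Circ L → ℂ) =ᵐ[volume] fun x => c * SigmaE f L x := by
  have hm : MemLp (fun x => c * SigmaE f L x) 2 volume := (memLp_SigmaE hf L).const_mul c
  have h1 : ξ = hm.toLp := by
    refine fourierTransform_injective L (lp.ext (funext fun k => ?_))
    change fourierComp L ξ k = fourierComp L hm.toLp k
    rw [h, fourierComp_of_ae_eq_mul_SigmaE hf hm.coeFn_toLp]
  rw [h1]
  exact hm.coeFn_toLp

theorem zetaMultiples_add {e : ℤ} {g₁ g₂ : C0inf ℂ} (h₁ : g₁ ∈ zetaMultiples e)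
    (h₂ : g₂ ∈ zetaMultiples e) : g₁ + g₂ ∈ zetaMultiples e := by
  obtain ⟨f₁, h₁⟩ := h₁
  obtain ⟨f₂, h₂⟩ := h₂
  refine ⟨f₁ + f₂, fun L hL => ?_⟩
  change g₁.1 L + g₂.1 L = _ * (f₁.1 L + f₂.1 L)
  rw [h₁ L hL, h₂ L hL, mul_add]

theorem zetaMultiples_smul {e : ℤ} (c : ℂ) {g : C0inf ℂ} (h : g ∈ zetaMultiples e) :
    c • g ∈ zetaMultiples e := by
  obtain ⟨f, h⟩ := h
  refine ⟨c • f, fun L hL => ?_⟩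
  change c * g.1 L = _ * (c * f.1 L)
  rw [h L hL, mul_left_comm]

/-- The component of index `e` of `h · Σℰ(f)` is the product of `ζ(1/2 - 2πie/L)` and a flat
function, since the Mellin transform of `f` on the critical line grows at most polynomially. -/
theorem component_mem_zetaMultiples (e : ℤ) {ξ : L2Sections} (hξ : ξ ∈ SigmaESpan) :
    component e ξ ∈ zetaMultiples e := by
  refine Submodule.span_induction ?_ ?_ ?_ ?_ hξ
  · rintro ξ ⟨h, f, hf, hae⟩
    have hq : ∀ m, IsModerate m fun x => (((Real.sqrt x)⁻¹ : ℝ) : ℂ) *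
        mellin (fun u => (f u : ℂ)) (1 / 2 - 2 * Real.pi * Complex.I * (e * x⁻¹ : ℝ)) := fun m =>
      (isModerate_inv_sqrt m).mul
        (isModerate_comp_div m (isAdmissible_ofReal_schwartz f).hasTemperateGrowth_mellin e)
    refine ⟨(isFlat_mulExt hq (isFlat_zeroExt h)).toC0inf, fun L hL => ?_⟩
    have hL' : (0 : ℝ) < (L : ℝ) := hL
    change hat ξ.1 L e = _ * mulExt _ _ (L : ℝ)
    rw [hat_eq ξ.1 ⟨L, hL'⟩ rfl, mulExt, if_pos hL', zeroExt_coe]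
    change fourierComp _ _ e = _
    rw [fourierComp_of_ae_eq_mul_SigmaE hf (hae ⟨L, hL'⟩), zetaMellin]
    change _ * (h.1 L * _) = _
    have e1 : (1 / 2 - 2 * Real.pi * Complex.I * (e * (L : ℝ)⁻¹ : ℝ) : ℂ) =
        1 / 2 - 2 * (Real.pi : ℂ) * Complex.I * (e : ℂ) / ((L : ℝ) : ℂ) := by
      push_cast
      ring
    rw [e1]
    ring
  · refine ⟨0, fun L _ => ?_⟩
    rw [map_zero]
    exact (mul_zero _).symm
  · intro ξ η _ _ h1 h2
    rw [map_add]
    exact zetaMultiples_add h1 h2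
  · intro c ξ _ h
    rw [map_smul]
    exact zetaMultiples_smul c h

/-! ### Continuous linear images of flat functions -/

section PostComp

variable {V W : Type*} [NormedAddCommGroup V] [NormedSpace ℂ V] [NormedAddCommGroup W]
  [NormedSpace ℂ W]

theorem IsFlat.iteratedDeriv_clm_comp {F : ℝ → V} (hF : IsFlat F) (A : V →L[ℂ] W) (m : ℕ) :
    _root_.iteratedDeriv m (fun x => A (F x)) = fun x => A (_root_.iteratedDeriv m F x) := by
  have := iteratedDeriv_of_hasDerivAt_succ (D := fun m x => A (_root_.iteratedDeriv m F x))
    (fun m x => (A.restrictScalars ℝ).hasFDerivAt.comp_hasDerivAt x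
      (hF.hasDerivAt_iteratedDeriv m x)) m
  simpa using this

/-- The linear map `f ↦ A ∘ f`. -/
def postComp (A : V →L[ℂ] W) : C0inf V →ₗ[ℂ] C0inf W where
  toFun f := ⟨fun L => A (f.1 L), f.2.clm_comp (A.restrictScalars ℝ)⟩
  map_add' f g := Subtype.ext (funext fun L => map_add A (f.1 L) (g.1 L))
  map_smul' c f := Subtype.ext (funext fun L => map_smul A c (f.1 L))

theorem weightedDeriv_postComp_le (A : V →L[ℂ] W) (n m : ℕ) (f : C0inf V) {L : ℝ} (hL : 0 < L) :
    weightedDeriv n m (postComp A f) L ≤ ‖A‖ * weightedDeriv n m f L := by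
  have h1 : zeroExt (postComp A f).1 = fun x => A (zeroExt f.1 x) := by
    funext x
    by_cases hx : 0 ≤ x <;> simp [zeroExt, hx, postComp]
  rw [weightedDeriv, weightedDeriv, h1, (isFlat_zeroExt f).iteratedDeriv_clm_comp, mul_left_comm]
  exact mul_le_mul_of_nonneg_left (A.le_opNorm _) (by positivity)

theorem continuous_postComp (A : V →L[ℂ] W) :
    @Continuous _ _ frechetTopology frechetTopology (postComp A) := by
  refine (@continuous_iff_continuousAt _ _ frechetTopology frechetTopology _).2 fun f => ?_
  refine tendsto_frechetTopology_map (u := id) (postComp A) (fun n m R => ?_) tendsto_id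
  refine ⟨n, m, R, ‖A‖ + 1, by positivity, fun f δ h L hL => ?_⟩
  refine (weightedDeriv_postComp_le A n m f hL.1).trans ?_
  have h0 : 0 ≤ weightedDeriv n m f L :=
    mul_nonneg (pow_nonneg (inv_nonneg.2 hL.1.le) _) (norm_nonneg _)
  have := h L hL
  nlinarith [norm_nonneg A]

end PostComp

/-! ### The closure of the span, seen through the Fourier transform -/

/-- The image of the closed span of the products `h · Σℰ(f)` under the Fourier transform. -/
def spanClosure : Set (C0inf ell2) := closure[frechetTopology] (trivialize '' SigmaESpan)

theorem mem_SigmaEClosure_iff (ξ : L2Sections) : ξ ∈ SigmaEClosure ↔ trivialize ξ ∈ spanClosure :=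
  @closure_induced _ _ frechetTopology trivialize ξ SigmaESpan

theorem component_mem_zetaClosedIdeal (e : ℤ) {ξ : L2Sections} (hξ : ξ ∈ SigmaEClosure) :
    component e ξ ∈ zetaClosedIdeal e := by
  have h1 := (mem_SigmaEClosure_iff ξ).1 hξ
  refine @map_mem_closure _ _ frechetTopology frechetTopology _ _ _ _
    (continuous_postComp (lp.evalCLM ℂ (fun _ : ℤ => ℂ) 2 e)) h1 ?_
  rintro _ ⟨η, hη, rfl⟩
  exact component_mem_zetaMultiples e hη

theorem spanClosure_of_mem_span {ξ : L2Sections} (hξ : ξ ∈ SigmaESpan) :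
    trivialize ξ ∈ spanClosure :=
  @subset_closure _ frechetTopology _ _ ⟨ξ, hξ, rfl⟩

theorem spanClosure_of_tendsto {ι : Type*} {l : Filter ι} [l.NeBot] {u : ι → C0inf ell2}
    {x : C0inf ell2} (hu : Tendsto u l (@nhds _ frechetTopology x))
    (h : ∀ᶠ i in l, u i ∈ spanClosure) : x ∈ spanClosure :=
  @IsClosed.mem_of_tendsto _ frechetTopology _ _ _ _ _ ‹_›
    (@isClosed_closure _ frechetTopology _) hu h

theorem continuous_add_right_frechetTopology {V : Type*} [NormedAddCommGroup V] [NormedSpace ℂ V]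
    (y : C0inf V) : @Continuous _ _ frechetTopology frechetTopology fun x : C0inf V => x + y :=
  (@continuous_iff_continuousAt _ _ frechetTopology frechetTopology _).2 fun _ =>
    tendsto_frechetTopology_add tendsto_id (@tendsto_const_nhds _ frechetTopology _ _ _)

theorem spanClosure_add {x y : C0inf ell2} (hx : x ∈ spanClosure) (hy : y ∈ spanClosure) :
    x + y ∈ spanClosure := by
  have h1 : ∀ y ∈ trivialize '' SigmaESpan, ∀ x ∈ spanClosure, x + y ∈ spanClosure := by
    rintro _ ⟨η, hη, rfl⟩ x hx
    refine @map_mem_closure _ _ frechetTopology frechetTopology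
      (fun x => x + trivialize η) _ _ _
      (continuous_add_right_frechetTopology (trivialize η)) hx ?_
    rintro _ ⟨ξ, hξ, rfl⟩
    exact ⟨ξ + η, SigmaESpan.add_mem hξ hη, trivialize_add ξ η⟩
  have h2 := @map_mem_closure _ _ frechetTopology frechetTopology
    (fun y => y + x) (trivialize '' SigmaESpan) y spanClosure
    (continuous_add_right_frechetTopology x) hy fun y hy => by
      change y + x ∈ spanClosure
      rw [add_comm]
      exact h1 y hy x hx
  rwa [spanClosure, @closure_closure _ frechetTopology, add_comm] at h2

theorem spanClosure_zero : (0 : C0inf ell2) ∈ spanClosure := by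
  have := spanClosure_of_mem_span SigmaESpan.zero_mem
  rwa [show trivialize 0 = 0 from Subtype.ext (map_zero hat)] at this

/-! ### Test functions with prescribed Mellin transform -/

/-- The even function on `ℝ` given by `u ↦ u^{-1/2} g(log u)` for `u > 0`, with value `0` at `0`.
(`Real.log` is even.) -/
def logPull (g : ℝ → ℝ) (x : ℝ) : ℝ :=
  if x = 0 then 0 else Real.exp (-(Real.log x / 2)) * g (Real.log x)

theorem logPull_neg (g : ℝ → ℝ) (x : ℝ) : logPull g (-x) = logPull g x := by
  simp [logPull]

theorem logPull_of_ne {g : ℝ → ℝ} {x : ℝ} (hx : x ≠ 0) :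
    logPull g x = Real.exp (-(Real.log x / 2)) * g (Real.log x) := if_neg hx

theorem logPull_eventuallyEq_zero {g : ℝ → ℝ} (hc : HasCompactSupport g) :
    logPull g =ᶠ[𝓝 0] fun _ => 0 := by
  obtain ⟨r, hr⟩ := hc.isCompact.isBounded.subset_closedBall 0
  have h1 : ∀ᶠ x in 𝓝[≠] (0 : ℝ), logPull g x = 0 := by
    filter_upwards [Real.tendsto_log_nhdsNE_zero.eventually (eventually_lt_atBot (-|r|)),
      self_mem_nhdsWithin] with x hx hx0
    rw [logPull_of_ne hx0, image_eq_zero_of_notMem_tsupport (f := g), mul_zero]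
    intro h
    have h2 := hr h
    rw [mem_closedBall_zero_iff, Real.norm_eq_abs] at h2
    linarith [neg_abs_le (Real.log x), le_abs_self r]
  rw [eventually_nhdsWithin_iff] at h1
  filter_upwards [h1] with x hx
  by_cases h : x = 0
  · simp [logPull, h]
  · exact hx h

theorem logPull_eventuallyEq {g : ℝ → ℝ} {x : ℝ} (hx : x ≠ 0) :
    logPull g =ᶠ[𝓝 x] fun x => Real.exp (-(Real.log x / 2)) * g (Real.log x) := by
  filter_upwards [isOpen_ne.mem_nhds hx] with y hy
  exact logPull_of_ne hy

theorem contDiff_logPull {g : ℝ → ℝ} (hg : ContDiff ℝ ∞ g) (hc : HasCompactSupport g) :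
    ContDiff ℝ ∞ (logPull g) := by
  rw [contDiff_iff_contDiffAt]
  intro x
  rcases eq_or_ne x 0 with rfl | hx
  · exact contDiffAt_const.congr_of_eventuallyEq (logPull_eventuallyEq_zero hc)
  · refine ContDiffAt.congr_of_eventuallyEq ?_ (logPull_eventuallyEq hx)
    have hl : ContDiffAt ℝ ∞ Real.log x := Real.contDiffAt_log.2 hx
    exact ((hl.div_const 2).neg.exp).mul (hg.contDiffAt.comp x hl)

theorem hasCompactSupport_logPull {g : ℝ → ℝ} (hc : HasCompactSupport g) :
    HasCompactSupport (logPull g) := by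
  obtain ⟨r, hr⟩ := hc.isCompact.isBounded.subset_closedBall 0
  refine HasCompactSupport.of_support_subset_isCompact
    (isCompact_closedBall (0 : ℝ) (Real.exp r)) fun x hx => ?_
  have hx0 : x ≠ 0 := by
    rintro rfl
    simp [logPull] at hx
  rw [Function.mem_support, logPull_of_ne hx0] at hx
  have h1 : Real.log x ∈ tsupport g := subset_tsupport g (right_ne_zero_of_mul hx)
  have h2 := hr h1
  rw [mem_closedBall_zero_iff, Real.norm_eq_abs] at h2 ⊢
  rw [← Real.log_le_iff_le_exp (abs_pos.2 hx0), Real.log_abs]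
  exact (le_abs_self _).trans h2

theorem hasDerivAt_mul_logPull {g : ℝ → ℝ} (hg : ContDiff ℝ ∞ g) (hc : HasCompactSupport g)
    (x : ℝ) : HasDerivAt (fun x => x * logPull g x)
      (logPull (fun y => g y / 2 + deriv g y) x) x := by
  rcases eq_or_ne x 0 with rfl | hx
  · refine (hasDerivAt_const (0 : ℝ) (0 : ℝ)).congr_of_eventuallyEq ?_ |>.congr_deriv ?_
    · filter_upwards [logPull_eventuallyEq_zero hc] with x hx
      rw [hx, mul_zero]
    · simp [logPull]
  · have hl := Real.hasDerivAt_log hx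
    have hg' : HasDerivAt g (deriv g (Real.log x)) (Real.log x) :=
      ((hg.differentiable (by simp)) _).hasDerivAt
    have h1 := (hasDerivAt_id x).mul ((hl.div_const 2).fun_neg.exp.mul (hg'.comp x hl))
    refine (h1.congr_of_eventuallyEq ?_).congr_deriv ?_
    · filter_upwards [logPull_eventuallyEq (g := g) hx] with y hy
      rw [hy]
      rfl
    · rw [logPull_of_ne hx]
      simp only [id, Pi.mul_apply, Function.comp_apply]
      field_simp
      ring

theorem hasCompactSupport_half_add_deriv {g : ℝ → ℝ} (hc : HasCompactSupport g) :
    HasCompactSupport fun y => g y / 2 + deriv g y := by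
  have h1 : HasCompactSupport fun y => g y / 2 := hc.comp_left (g := fun t => t / 2) (zero_div 2)
  exact h1.add hc.deriv

theorem contDiff_half_add_deriv {g : ℝ → ℝ} (hg : ContDiff ℝ ∞ g) :
    ContDiff ℝ ∞ fun y => g y / 2 + deriv g y :=
  (hg.div_const 2).add (contDiff_infty_iff_deriv.1 hg).2

/-- The even function `d/du (u^{1/2} g(log u))`, whose Mellin transform on the line `re s = 1/2` is
`1 - s` times the Fourier transform of `g`. -/
def logTest {g : ℝ → ℝ} (hg : ContDiff ℝ ∞ g) (hc : HasCompactSupport g) : SchwartzMap ℝ ℝ :=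
  (hasCompactSupport_logPull (hasCompactSupport_half_add_deriv hc)).toSchwartzMap
    (contDiff_logPull (contDiff_half_add_deriv hg) (hasCompactSupport_half_add_deriv hc))

theorem logTest_apply {g : ℝ → ℝ} (hg : ContDiff ℝ ∞ g) (hc : HasCompactSupport g) (x : ℝ) :
    logTest hg hc x = logPull (fun y => g y / 2 + deriv g y) x := rfl

theorem logTest_mem {g : ℝ → ℝ} (hg : ContDiff ℝ ∞ g) (hc : HasCompactSupport g) :
    logTest hg hc ∈ SchwartzEvenZero := by
  have hi : Integrable fun x => x * logPull g x :=
    (continuous_id.mul (contDiff_logPull hg hc).continuous).integrable_of_hasCompactSupport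
      (hasCompactSupport_logPull hc).mul_left
  refine ⟨fun x => ?_, if_pos rfl, ?_⟩
  · rw [logTest_apply, logTest_apply, logPull_neg]
  · exact integral_eq_zero_of_hasDerivAt_of_integrable (hasDerivAt_mul_logPull hg hc)
      (logTest hg hc).integrable hi

theorem logCoord_logTest {g : ℝ → ℝ} (hg : ContDiff ℝ ∞ g) (hc : HasCompactSupport g) (y : ℝ) :
    logCoord (fun u => (logTest hg hc u : ℂ)) y = ((g y / 2 + deriv g y : ℝ) : ℂ) := by
  have h : logTest hg hc (Real.exp y) = Real.exp (-(y / 2)) * (g y / 2 + deriv g y) := by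
    rw [logTest_apply, logPull_of_ne (Real.exp_pos y).ne', Real.log_exp]
  rw [logCoord, h, ← Complex.ofReal_mul, ← mul_assoc, ← Real.exp_add, add_neg_cancel,
    Real.exp_zero, one_mul]

/-- In the logarithmic coordinate the test function is `g/2 + g'`, and the Fourier transform turns
`1/2 + d/dy` into `1/2 + 2πiξ = 1 - s`. -/
theorem zetaMellin_logTest {g : ℝ → ℝ} (hg : ContDiff ℝ ∞ g) (hc : HasCompactSupport g) (ξ : ℝ) :
    zetaMellin (logTest hg hc) ξ = zetaSymbol ξ * 𝓕 (fun y => (g y : ℂ)) ξ := by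
  set gc : ℝ → ℂ := fun y => (g y : ℂ) with hgc
  have hd : ∀ y, HasDerivAt gc ((deriv g y : ℝ) : ℂ) y := fun y =>
    ((hg.differentiable (by simp)) y).hasDerivAt.ofReal_comp
  have hgi : Integrable gc :=
    (hg.continuous.integrable_of_hasCompactSupport hc).ofReal
  have hdi : Integrable fun y => ((deriv g y : ℝ) : ℂ) :=
    ((contDiff_infty_iff_deriv.1 hg).2.continuous.integrable_of_hasCompactSupport hc.deriv).ofReal
  have hde : deriv gc = fun y => ((deriv g y : ℝ) : ℂ) := funext fun y => (hd y).deriv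
  have h1 := congrFun (Real.fourier_deriv hgi (fun y => (hd y).differentiableAt) (hde ▸ hdi)) ξ
  have h2 : logCoord (fun u => (logTest hg hc u : ℂ)) = (1 / 2 : ℂ) • gc + deriv gc := by
    funext y
    rw [logCoord_logTest, hde]
    simp only [hgc, Pi.add_apply, Pi.smul_apply, smul_eq_mul]
    push_cast
    ring
  have h3 : 𝓕 ((1 / 2 : ℂ) • gc + deriv gc) ξ = (1 / 2 : ℂ) * 𝓕 gc ξ + 𝓕 (deriv gc) ξ := by
    rw [Real.fourier_eq, Real.fourier_eq, Real.fourier_eq, ← integral_const_mul, ← integral_add]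
    · congr 1
      funext v
      simp only [Pi.add_apply, Pi.smul_apply, Circle.smul_def, smul_eq_mul]
      ring
    · exact ((Real.fourierIntegral_convergent_iff ξ).2 hgi).const_mul _
    · exact (Real.fourierIntegral_convergent_iff ξ).2 (hde ▸ hdi)
  rw [zetaMellin, mellin_half_eq_fourier, h2, h3, h1, zetaSymbol, smul_eq_mul]
  ring

/-! ### Sampled Schwartz functions in the closed span -/

theorem IsBump.sample_add {h : ℝ → ℂ} (hh : IsBump h) (P Q : SchwartzMap ℝ ℂ) :
    hh.sample (P + Q) = hh.sample P + hh.sample Q := by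
  refine C0inf_ell2_ext fun L k => ?_
  change _ = (hh.sample P).1 L k + (hh.sample Q).1 L k
  rw [hh.sample_apply, hh.sample_apply, hh.sample_apply, add_apply, mul_add]

theorem IsBump.sample_smul {h : ℝ → ℂ} (hh : IsBump h) (c : ℂ) (P : SchwartzMap ℝ ℂ) :
    hh.sample (c • P) = c • hh.sample P := by
  refine C0inf_ell2_ext fun L k => ?_
  change _ = c * (hh.sample P).1 L k
  rw [hh.sample_apply, hh.sample_apply, smul_apply, smul_eq_mul, mul_left_comm]

/-- Multiplication by `(1 - s) ζ(s)`, `s = 1/2 - 2πiξ`, on Schwartz functions of `ξ`. -/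
def zetaMul : SchwartzMap ℝ ℂ →L[ℂ] SchwartzMap ℝ ℂ := SchwartzMap.smulLeftCLM ℂ zetaSymbol

theorem zetaMul_apply (P : SchwartzMap ℝ ℂ) (ξ : ℝ) : zetaMul P ξ = zetaSymbol ξ * P ξ :=
  SchwartzMap.smulLeftCLM_apply_apply hasTemperateGrowth_zetaSymbol P ξ

theorem trivialize_apply (ξ : L2Sections) (L : Ioi (0 : ℝ)) (k : ℤ) :
    fourierComp L (ξ.1 L) k = (trivialize ξ).1 ⟨L, le_of_lt L.2⟩ k := by
  change fourierTransform L (ξ.1 L) k = hat ξ.1 _ k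
  rw [hat_eq ξ.1 L (L := ⟨L, le_of_lt L.2⟩) rfl]

/-- The section with components `h(L) (1 - s) ζ(s) ĝ(k/L)`, `s = 1/2 - 2πik/L`, is the product of
`L^{1/2} h(L)` and `Σℰ(f)`, where `f` is the derivative of `u^{1/2} g(log u)`. -/
theorem sample_mem_of_real {h : ℝ → ℂ} (hh : IsBump h) {g : ℝ → ℝ} (hg : ContDiff ℝ ∞ g)
    (hc : HasCompactSupport g) {P : SchwartzMap ℝ ℂ} (hP : ∀ ξ, P ξ = 𝓕 (fun y => (g y : ℂ)) ξ) :
    ofHat (hh.sample (zetaMul P)) ∈ SigmaESpan := by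
  have hs : ContDiffOn ℝ ∞ (fun x : ℝ => ((Real.sqrt x : ℝ) : ℂ)) (Ioi 0) :=
    Complex.ofRealCLM.contDiff.comp_contDiffOn
      (contDiffOn_id.sqrt fun x hx => ne_of_gt hx)
  refine Submodule.subset_span ⟨(hh.mul hs).isFlat.toC0inf, logTest hg hc, logTest_mem hg hc,
    fun L => ae_eq_mul_SigmaE_of_fourierComp (logTest_mem hg hc) fun k => ?_⟩
  have hL : (0 : ℝ) < L := L.2
  have hL' : ((Real.sqrt L : ℝ) : ℂ) ≠ 0 := by
    exact_mod_cast (Real.sqrt_pos.2 hL).ne'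
  have e : fourierComp L ((ofHat (hh.sample (zetaMul P))).1 L) k =
      h L * zetaMul P (k * (L : ℝ)⁻¹) := by
    rw [trivialize_apply, trivialize_ofHat]
    exact hh.sample_apply _ _ _
  rw [e, zetaMul_apply, zetaMellin_logTest, hP]
  change _ = _ * ((h L * ((Real.sqrt L : ℝ) : ℂ)) * _)
  push_cast
  field_simp

theorem sample_mem_of_hasCompactSupport {h : ℝ → ℂ} (hh : IsBump h) {g : SchwartzMap ℝ ℂ}
    (hc : HasCompactSupport g) :
    hh.sample (zetaMul (SchwartzMap.fourierTransformCLM ℂ g)) ∈ trivialize '' SigmaESpan := by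
  have hre : HasCompactSupport fun x => (g x).re := hc.comp_left Complex.zero_re
  have him : HasCompactSupport fun x => (g x).im := hc.comp_left Complex.zero_im
  have hre' : ContDiff ℝ ∞ fun x => (g x).re := Complex.reCLM.contDiff.comp (g.smooth ⊤)
  have him' : ContDiff ℝ ∞ fun x => (g x).im := Complex.imCLM.contDiff.comp (g.smooth ⊤)
  have key : ∀ q : ℝ → ℝ, ContDiff ℝ ∞ q → HasCompactSupport q → ∃ Q : SchwartzMap ℝ ℂ,
      (∀ x, Q x = (q x : ℂ)) ∧ ofHat (hh.sample (zetaMul (SchwartzMap.fourierTransformCLM ℂ Q))) ∈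
        SigmaESpan := by
    intro q hq hqc
    have e1 : HasCompactSupport fun x => (q x : ℂ) := hqc.comp_left Complex.ofReal_zero
    have e2 : ContDiff ℝ ∞ fun x => (q x : ℂ) := Complex.ofRealCLM.contDiff.comp hq
    exact ⟨e1.toSchwartzMap e2, fun x => rfl, sample_mem_of_real hh hq hqc fun ξ => rfl⟩
  obtain ⟨Q₁, h1, m1⟩ := key _ hre' hre
  obtain ⟨Q₂, h2, m2⟩ := key _ him' him
  -- The test functions are real valued: treat real and imaginary part separately.
  have hg : g = Q₁ + Complex.I • Q₂ := by
    ext x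
    rw [add_apply, smul_apply, h1, h2, smul_eq_mul, mul_comm]
    exact (Complex.re_add_im (g x)).symm
  refine ⟨_, SigmaESpan.add_mem m1 (SigmaESpan.smul_mem Complex.I m2), ?_⟩
  rw [trivialize_add, trivialize_smul, trivialize_ofHat, trivialize_ofHat, ← hh.sample_smul,
    ← hh.sample_add]
  conv_rhs => rw [hg]
  simp only [map_add, map_smul]

/-- A smooth function that is constant on `|x| < 1`, minus this constant, contracted by `c → 0`
and multiplied with a Schwartz function, is `O(c)` in every Schwartz seminorm. -/
theorem exists_bound_contraction (n : ℕ) : ∀ (S : SchwartzMap ℝ ℂ) (a : ℂ),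
    (∀ x, |x| < 1 → S x = a) → ∀ (g : SchwartzMap ℝ ℂ) (k : ℕ), ∃ C, 0 ≤ C ∧
      ∀ c : ℝ, 0 < c → c ≤ 1 → ∀ x, |x| ^ k * ‖iteratedDeriv n (fun x => (S (c * x) - a) * g x) x‖ ≤ C * c := by
  induction n with
  | zero =>
    intro S a hS g k
    obtain ⟨B, hB, h1⟩ := S.decay 0 0
    obtain ⟨D, hD, h2⟩ := g.decay (k + 1) 0
    simp only [norm_iteratedFDeriv_zero, pow_zero, one_mul, Real.norm_eq_abs] at h1 h2
    refine ⟨(B + ‖a‖) * D, by positivity, fun c hc _ x => ?_⟩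
    rw [iteratedDeriv_zero, norm_mul]
    by_cases hx : |c * x| < 1
    · rw [hS _ hx, sub_self, norm_zero, zero_mul, mul_zero]
      positivity
    · have h3 : 1 ≤ c * |x| := by
        rw [not_lt, abs_mul, abs_of_pos hc] at hx
        exact hx
      have h4 : ‖S (c * x) - a‖ ≤ B + ‖a‖ := (norm_sub_le _ _).trans (by gcongr; exact h1 _)
      calc |x| ^ k * (‖S (c * x) - a‖ * ‖g x‖)
          ≤ (c * |x|) * (|x| ^ k * ((B + ‖a‖) * ‖g x‖)) := by
            refine le_trans ?_ (le_mul_of_one_le_left (by positivity) h3)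
            gcongr
        _ = (B + ‖a‖) * (|x| ^ (k + 1) * ‖g x‖) * c := by ring
        _ ≤ (B + ‖a‖) * D * c := by gcongr; exact h2 x
  | succ n ih =>
    intro S a hS g k
    have hS' : ∀ x, |x| < 1 → SchwartzMap.derivCLM ℂ ℂ S x = 0 := by
      intro x hx
      have h1 : S =ᶠ[𝓝 x] fun _ => a := by
        filter_upwards [(isOpen_lt continuous_abs continuous_const).mem_nhds hx] with y hy
        exact hS y hy
      rw [SchwartzMap.derivCLM_apply, h1.deriv_eq, deriv_const]
    obtain ⟨C₁, h₁, b₁⟩ := ih (SchwartzMap.derivCLM ℂ ℂ S) 0 hS' g k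
    obtain ⟨C₂, h₂, b₂⟩ := ih S a hS (SchwartzMap.derivCLM ℂ ℂ g) k
    refine ⟨C₁ + C₂, by positivity, fun c hc hc1 x => ?_⟩
    have hd : deriv (fun x => (S (c * x) - a) * g x) =
        (fun x => (c : ℂ) * ((SchwartzMap.derivCLM ℂ ℂ S (c * x) - 0) * g x)) +
          fun x => (S (c * x) - a) * SchwartzMap.derivCLM ℂ ℂ g x := by
      funext x
      have e1 : HasDerivAt (fun x => S (c * x)) (c • deriv S (c * x)) x :=
        ((S.hasDerivAt (c * x)).scomp x ((hasDerivAt_id x).const_mul c)).congr_deriv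
          (by rw [mul_one])
      rw [((e1.sub_const a).fun_mul (g.hasDerivAt x)).deriv]
      simp only [Pi.add_apply, SchwartzMap.derivCLM_apply, Complex.real_smul]
      ring
    have hcomp : ∀ T : SchwartzMap ℝ ℂ, ContDiff ℝ n fun x => T (c * x) := fun T =>
      (T.smooth n).comp (contDiff_const.mul contDiff_id)
    have c1 : ContDiff ℝ n fun x => (SchwartzMap.derivCLM ℂ ℂ S (c * x) - 0) * g x :=
      ((hcomp _).sub contDiff_const).mul (g.smooth n)
    have c2 : ContDiff ℝ n fun x => (S (c * x) - a) * SchwartzMap.derivCLM ℂ ℂ g x :=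
      ((hcomp _).sub contDiff_const).mul (SchwartzMap.smooth _ n)
    rw [iteratedDeriv_succ', hd, iteratedDeriv_add (contDiff_const.mul c1).contDiffAt
      c2.contDiffAt, iteratedDeriv_const_mul_field]
    have hn : ‖(c : ℂ)‖ ≤ 1 := by
      rw [Complex.norm_real, Real.norm_of_nonneg hc.le]
      exact hc1
    refine (mul_le_mul_of_nonneg_left (norm_add_le _ _) (by positivity)).trans ?_
    rw [mul_add, add_mul, norm_mul]
    refine add_le_add (le_trans ?_ (b₁ c hc hc1 x)) (b₂ c hc hc1 x)
    gcongr
    exact mul_le_of_le_one_left (norm_nonneg _) hn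

/-- Compactly supported smooth functions are dense in the Schwartz space. -/
theorem exists_hasCompactSupport_tendsto (g : SchwartzMap ℝ ℂ) :
    ∃ u : ℕ → SchwartzMap ℝ ℂ, (∀ j, HasCompactSupport (u j)) ∧ Tendsto u atTop (𝓝 g) := by
  let b : ContDiffBump (0 : ℝ) := ⟨1, 2, one_pos, one_lt_two⟩
  have hbc : HasCompactSupport fun x => (b x : ℂ) :=
    b.hasCompactSupport.comp_left Complex.ofReal_zero
  have hbs : ContDiff ℝ ∞ fun x => (b x : ℂ) := Complex.ofRealCLM.contDiff.comp b.contDiff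
  set S : SchwartzMap ℝ ℂ := hbc.toSchwartzMap hbs with hSdef
  have hS : ∀ x, |x| < 1 → S x = 1 := by
    intro x hx
    change (b x : ℂ) = 1
    rw [b.one_of_mem_closedBall (by simpa using hx.le), Complex.ofReal_one]
  set c : ℕ → ℝ := fun j => ((j : ℝ) + 1)⁻¹ with hcdef
  have hc0 : ∀ j, 0 < c j := fun j => by positivity
  have hc1 : ∀ j, c j ≤ 1 := fun j => inv_le_one_of_one_le₀ (by simp)
  have hct : Tendsto c atTop (𝓝 0) := by
    simpa only [one_div] using tendsto_one_div_add_atTop_nhds_zero_nat (𝕜 := ℝ)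
  have hcs : ∀ j, HasCompactSupport fun x => S (c j * x) * g x := fun j =>
    HasCompactSupport.mul_right (hbc.comp_homeomorph (Homeomorph.mulLeft₀ (c j) (hc0 j).ne'))
  have hsm : ∀ j, ContDiff ℝ ∞ fun x => S (c j * x) * g x := fun j =>
    ((S.smooth ⊤).comp (contDiff_const.mul contDiff_id)).mul (g.smooth ⊤)
  refine ⟨fun j => (hcs j).toSchwartzMap (hsm j), hcs, ?_⟩
  rw [(schwartz_withSeminorms ℂ ℝ ℂ).tendsto_nhds]
  rintro ⟨k, n⟩ ε hε
  obtain ⟨C, hC, hb⟩ := exists_bound_contraction n S 1 hS g k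
  have h1 : ∀ᶠ j in atTop, C * c j < ε := by
    have := hct.const_mul C
    rw [mul_zero] at this
    exact this.eventually_lt_const hε
  filter_upwards [h1] with j hj
  refine lt_of_le_of_lt (SchwartzMap.seminorm_le_bound' ℂ k n _ (by have := hc0 j; positivity)
    fun x => ?_) hj
  have e : ((((hcs j).toSchwartzMap (hsm j) - g : SchwartzMap ℝ ℂ)) : ℝ → ℂ) =
      fun x => (S (c j * x) - 1) * g x := by
    funext x
    change S (c j * x) * g x - g x = _
    ring
  rw [e]
  exact hb (c j) (hc0 j) (hc1 j) x

/-- The closed span contains every section with components `h(L) (1 - s) ζ(s) P(k/L)`,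
`s = 1/2 - 2πik/L`: approximate the inverse Fourier transform of `P` by functions of compact
support. -/
theorem sample_zetaMul_mem_spanClosure {h : ℝ → ℂ} (hh : IsBump h) (P : SchwartzMap ℝ ℂ) :
    hh.sample (zetaMul P) ∈ spanClosure := by
  obtain ⟨u, hc, hu⟩ := exists_hasCompactSupport_tendsto (𝓕⁻ P)
  have h1 : Tendsto (fun j => zetaMul (SchwartzMap.fourierTransformCLM ℂ (u j))) atTop
      (𝓝 (zetaMul P)) := by
    have := (zetaMul.continuous.comp (SchwartzMap.fourierTransformCLM ℂ).continuous).tendsto (𝓕⁻ P)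
    have e : (zetaMul ∘ SchwartzMap.fourierTransformCLM ℂ) (𝓕⁻ P) = zetaMul P := by
      rw [Function.comp_apply, SchwartzMap.fourierTransformCLM_apply,
        FourierTransform.fourier_fourierInv_eq]
    rw [e] at this
    exact this.comp hu
  refine spanClosure_of_tendsto (hh.tendsto_sample h1) (Eventually.of_forall fun j => ?_)
  exact @subset_closure _ frechetTopology _ _ (sample_mem_of_hasCompactSupport hh (hc j))

/-! ### Smooth cutoffs -/

theorem exists_smooth_step {p q : ℝ} (hpq : p < q) : ∃ s : ℝ → ℂ, ContDiff ℝ ∞ s ∧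
    (∀ x ≤ p, s x = 1) ∧ ∀ x, q ≤ x → s x = 0 := by
  have hd : 0 < q - p := sub_pos.2 hpq
  refine ⟨fun x => (Real.smoothTransition ((q - x) / (q - p)) : ℂ), ?_, fun x hx => ?_,
    fun x hx => ?_⟩
  · exact Complex.ofRealCLM.contDiff.comp
      (Real.smoothTransition.contDiff.comp ((contDiff_const.sub contDiff_id).div_const _))
  · simp only
    rw [Real.smoothTransition.one_of_one_le, Complex.ofReal_one]
    rw [le_div_iff₀ hd]
    linarith
  · simp only
    rw [Real.smoothTransition.zero_of_nonpos, Complex.ofReal_zero]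
    exact div_nonpos_of_nonpos_of_nonneg (by linarith) hd.le

/-- If `s` vanishes on `[1,∞)` then `s(c x) G(x)` is `O(1/c)` in every Fréchet seminorm. -/
theorem exists_bound_flat_cutoff (m : ℕ) : ∀ s : ℝ → ℂ, ContDiff ℝ ∞ s → (∀ x, 1 ≤ x → s x = 0) →
    ∀ G : ℝ → ℂ, IsFlat G → ∀ n : ℕ, ∃ C, 0 ≤ C ∧ ∀ c : ℝ, 1 ≤ c → ∀ L > 0,
      L⁻¹ ^ n * ‖iteratedDeriv m (fun x => s (c * x) * G x) L‖ ≤ C * c⁻¹ := by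
  induction m with
  | zero =>
    intro s hs h1 G hG n
    obtain ⟨B, hB⟩ := isCompact_Icc.exists_bound_of_continuousOn
      (hs.continuous.continuousOn (s := Icc 0 1))
    obtain ⟨D, hD, h2⟩ := hG.bound (n + 1) 1
    have hB0 : 0 ≤ B := (norm_nonneg _).trans (hB 0 (by simp))
    refine ⟨B * D, by positivity, fun c hc L hL => ?_⟩
    have hc0 : 0 < c := one_pos.trans_le hc
    rw [iteratedDeriv_zero]
    rcases le_or_gt 1 (c * L) with h | h
    · rw [h1 _ h, zero_mul, norm_zero, mul_zero]
      positivity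
    · have hL1 : L ≤ c⁻¹ := by
        rw [← one_div, le_div_iff₀ hc0, mul_comm]
        exact h.le
      have h3 := h2 L hL.le (hL1.trans (inv_le_one_of_one_le₀ hc))
      rw [norm_mul]
      calc L⁻¹ ^ n * (‖s (c * L)‖ * ‖G L‖)
          ≤ L⁻¹ ^ n * (B * (D * L ^ (n + 1))) := by
            gcongr
            exact hB _ ⟨by positivity, h.le⟩
        _ = B * D * L := by
            rw [inv_pow, pow_succ]
            field_simp
        _ ≤ B * D * c⁻¹ := by gcongr
  | succ m ih =>
    intro s hs h1 G hG n
    have hs' : ContDiff ℝ ∞ (deriv s) := (contDiff_infty_iff_deriv.1 hs).2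
    -- The derivative of `s(c x)` is `(c x) s'(c x) / x`; the factor `1 / x` is absorbed into `G`.
    have hG' : IsFlat (mulExt (fun x => ((x⁻¹ : ℝ) : ℂ)) G) := isFlat_mulExt isModerate_inv hG
    have ht : ContDiff ℝ ∞ fun y : ℝ => (y : ℂ) * deriv s y :=
      Complex.ofRealCLM.contDiff.mul hs'
    have ht1 : ∀ y : ℝ, 1 ≤ y → (y : ℂ) * deriv s y = 0 := by
      have h2 : EqOn (deriv s) 0 (Ioi 1) := by
        intro y hy
        have : s =ᶠ[𝓝 y] fun _ => 0 := by
          filter_upwards [Ioi_mem_nhds hy] with z hz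
          exact h1 z (le_of_lt hz)
        rw [this.deriv_eq, deriv_const, Pi.zero_apply]
      have h3 := h2.closure hs'.continuous continuous_const
      rw [closure_Ioi] at h3
      intro y hy
      rw [h3 hy, Pi.zero_apply, mul_zero]
    obtain ⟨C₁, hC₁, b₁⟩ := ih _ ht ht1 _ hG' n
    obtain ⟨C₂, hC₂, b₂⟩ := ih s hs h1 _ hG.deriv n
    refine ⟨C₁ + C₂, by positivity, fun c hc L hL => ?_⟩
    have hcm : ∀ t : ℝ → ℂ, ContDiff ℝ ∞ t → ContDiff ℝ ∞ fun x => t (c * x) := fun t ht =>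
      ht.comp (contDiff_const.mul contDiff_id)
    have hd : deriv (fun x => s (c * x) * G x) =
        (fun x => ((c * x : ℝ) : ℂ) * deriv s (c * x) * mulExt (fun x => ((x⁻¹ : ℝ) : ℂ)) G x) +
          fun x => s (c * x) * deriv G x := by
      funext x
      have e1 : HasDerivAt (fun x => s (c * x)) (c • deriv s (c * x)) x :=
        ((hs.differentiable (by simp) (c * x)).hasDerivAt.scomp x
          ((hasDerivAt_id x).const_mul c)).congr_deriv (by rw [mul_one])
      have e2 : HasDerivAt G (deriv G x) x := (hG.1.differentiable (by simp) x).hasDerivAt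
      rw [(e1.fun_mul e2).deriv, Pi.add_apply, Complex.real_smul]
      congr 1
      rcases le_or_gt x 0 with hx | hx
      · rw [hG.2 x hx, hG'.2 x hx, mul_zero, mul_zero]
      · have hx' : (x : ℂ) ≠ 0 := by exact_mod_cast hx.ne'
        rw [mulExt, if_pos hx]
        push_cast
        field_simp
    have c1 : ContDiff ℝ m fun x => ((c * x : ℝ) : ℂ) * deriv s (c * x) *
        mulExt (fun x => ((x⁻¹ : ℝ) : ℂ)) G x :=
      ((hcm _ ht).mul hG'.1).of_le (by exact_mod_cast le_top)
    have c2 : ContDiff ℝ m fun x => s (c * x) * deriv G x :=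
      ((hcm _ hs).mul hG.deriv.1).of_le (by exact_mod_cast le_top)
    rw [iteratedDeriv_succ', hd, iteratedDeriv_add c1.contDiffAt c2.contDiffAt, add_mul]
    refine (mul_le_mul_of_nonneg_left (norm_add_le _ _) (by positivity)).trans ?_
    rw [mul_add]
    exact add_le_add (b₁ c hc L hL) (b₂ c hc L hL)

/-- Sections that agree near every point of `[0,R]` for large indices converge. -/
theorem tendsto_frechetTopology_of_eventually_eq {V : Type*} [NormedAddCommGroup V]
    [NormedSpace ℂ V] {u : ℕ → C0inf V} {x : C0inf V}
    (h : ∀ R : ℝ, ∀ᶠ i in atTop, ∀ L : ℝ≥0, (L : ℝ) < R → (u i).1 L = x.1 L) :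
    Tendsto u atTop (@nhds _ frechetTopology x) := by
  rw [tendsto_frechetTopology_iff]
  intro n m R ε hε
  filter_upwards [h (R + 1)] with i hi L hL
  have h1 : zeroExt (u i - x).1 =ᶠ[𝓝 L] fun _ => 0 := by
    filter_upwards [Iio_mem_nhds (show L < R + 1 by linarith [hL.2])] with y hy
    by_cases h0 : 0 ≤ y
    · have := hi ⟨y, h0⟩ hy
      rw [zeroExt, if_pos h0]
      change (u i).1 _ - x.1 _ = 0
      rw [show y.toNNReal = ⟨y, h0⟩ from Real.toNNReal_of_nonneg h0, this, sub_self]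
    · rw [zeroExt, if_neg h0]
  rw [weightedDeriv, (h1.iteratedDeriv m).eq_of_nhds]
  simpa using hε.le

/-- The multiples `ζ · h`, with `h` supported in a compact subset of `(0,∞)`, are dense in the
multiples of `ζ`. -/
theorem exists_bump_tendsto {e : ℤ} {g : C0inf ℂ} (hg : g ∈ zetaMultiples e) :
    ∃ u : ℕ → C0inf ℂ, Tendsto u atTop (@nhds _ frechetTopology g) ∧ ∀ j, ∃ h : ℝ → ℂ, IsBump h ∧
      ∀ L : ℝ≥0, 0 < L → (u j).1 L = riemannZeta
        (1 / 2 - 2 * (Real.pi : ℂ) * Complex.I * (e : ℂ) / ((L : ℝ) : ℂ)) * h L := by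
  obtain ⟨f, hf⟩ := hg
  obtain ⟨s, hs, hs1, hs0⟩ := exists_smooth_step (show (1 / 2 : ℝ) < 1 by norm_num)
  set c : ℕ → ℝ := fun j => (j : ℝ) + 1 with hc
  have hc1 : ∀ j, 1 ≤ c j := fun j => by simp [hc]
  have hc0 : ∀ j, 0 < c j := fun j => one_pos.trans_le (hc1 j)
  -- The cutoff `χ j` equals `1` on `[1 / c, c]` and vanishes outside `[1 / (2c), 2c]`, `c = j + 1`.
  set χ : ℕ → ℝ → ℂ := fun j x => (1 - s (c j * x)) * s ((2 * c j)⁻¹ * x) with hχ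
  have hsc : ∀ a : ℝ, ContDiff ℝ ∞ fun x => s (a * x) := fun a =>
    hs.comp (contDiff_const.mul contDiff_id)
  have hb : ∀ F : ℝ → ℂ, ContDiff ℝ ∞ F → ∀ j, IsBump fun x => χ j x * F x := by
    intro F hF j
    refine ⟨((contDiff_const.sub (hsc _)).mul (hsc _)).mul hF, (2 * c j)⁻¹, 2 * c j,
      by have := hc0 j; positivity, fun x hx => ?_⟩
    have hcj := hc0 j
    rw [mem_Icc, not_and_or, not_le, not_le] at hx
    have h0 : χ j x = 0 := by
      rcases hx with hx | hx
      · have : c j * x ≤ 1 / 2 := by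
          rw [mul_inv] at hx
          calc c j * x ≤ c j * (2⁻¹ * (c j)⁻¹) := by gcongr
            _ = 1 / 2 := by field_simp
        simp only [hχ]
        rw [hs1 _ this, sub_self, zero_mul]
      · have : 1 ≤ (2 * c j)⁻¹ * x := by
          rw [inv_mul_eq_div, le_div_iff₀ (by positivity), one_mul]
          exact hx.le
        simp only [hχ]
        rw [hs0 _ this, mul_zero]
    simp only [h0, zero_mul]
  have hgF := isFlat_zeroExt g
  refine ⟨fun j => (hb _ hgF.1 j).isFlat.toC0inf, ?_, fun j =>
    ⟨_, hb _ (isFlat_zeroExt f).1 j, fun L hL => ?_⟩⟩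
  · rw [tendsto_frechetTopology_iff]
    intro n m R ε hε
    obtain ⟨C, hC, hbd⟩ := exists_bound_flat_cutoff m s hs hs0 _ hgF n
    have h1 : Tendsto (fun j => C * (c j)⁻¹) atTop (𝓝 0) := by
      have := (tendsto_one_div_add_atTop_nhds_zero_nat (𝕜 := ℝ)).const_mul C
      simpa only [one_div, mul_zero] using this
    filter_upwards [h1.eventually_lt_const hε, eventually_gt_atTop ⌈R⌉₊] with j hj hR L hL
    have hRj : L < c j := by
      have : R < j := (Nat.le_ceil R).trans_lt (by exact_mod_cast hR)
      simp only [hc]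
      linarith [hL.2]
    have h2 : zeroExt ((hb _ hgF.1 j).isFlat.toC0inf - g).1 =ᶠ[𝓝 L]
        fun x => (-1 : ℂ) * (s (c j * x) * zeroExt g.1 x) := by
      rw [show ((hb _ hgF.1 j).isFlat.toC0inf - g).1 =
        (hb _ hgF.1 j).isFlat.toC0inf.1 - g.1 from rfl, zeroExt_sub, IsFlat.zeroExt_toC0inf]
      filter_upwards [Iio_mem_nhds hRj] with x hx
      have hcj := hc0 j
      have h3 : (2 * c j)⁻¹ * x ≤ 1 / 2 := by
        rw [mul_inv]
        calc 2⁻¹ * (c j)⁻¹ * x ≤ 2⁻¹ * (c j)⁻¹ * c j := by gcongr; exact le_of_lt hx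
          _ = 1 / 2 := by field_simp
      simp only [Pi.sub_apply, hχ]
      rw [hs1 _ h3]
      ring
    rw [weightedDeriv, (h2.iteratedDeriv m).eq_of_nhds, iteratedDeriv_const_mul_field, norm_mul,
      norm_neg, norm_one, one_mul]
    exact (hbd (c j) (hc1 j) L hL.1).trans hj.le
  · change χ j L * zeroExt g.1 L = _ * (χ j L * zeroExt f.1 L)
    rw [zeroExt_coe, zeroExt_coe, hf L hL]
    ring

/-! ### Separating the Fourier components -/

/-- On a short interval of values of `L` the points `k / L`, for `k` fixed, are separated from the
points `j / L`, `j ≠ k`, by a bump function. -/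
theorem exists_single_mem_of_narrow {k : ℤ} {φ : ℝ → ℂ} (hφ : ContDiff ℝ ∞ φ) {a b : ℝ}
    (ha : 0 < a) (hab : a < b) (hk : |(k : ℝ)| * (b - a) < a)
    (hs : ∀ x, x ∉ Icc a b → φ x = 0) : ∃ F ∈ spanClosure, ∀ (L : ℝ≥0) (j : ℤ),
      F.1 L j = if j = k then φ L * zetaSymbol (k * (L : ℝ)⁻¹) else 0 := by
  have hb : 0 < b := ha.trans hab
  have hba : b⁻¹ < a⁻¹ := (inv_lt_inv₀ hb ha).2 hab
  have hb' : 0 < b⁻¹ := inv_pos.2 hb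
  set r : ℝ := |(k : ℝ)| * (a⁻¹ - b⁻¹) / 2 with hr
  have hr1 : 2 * r < b⁻¹ := by
    have h1 : |(k : ℝ)| * (a⁻¹ - b⁻¹) = |(k : ℝ)| * (b - a) * (a⁻¹ * b⁻¹) := by
      field_simp
    have h2 : |(k : ℝ)| * (b - a) * (a⁻¹ * b⁻¹) < a * (a⁻¹ * b⁻¹) := by gcongr
    have h3 : a * (a⁻¹ * b⁻¹) = b⁻¹ := by field_simp
    rw [hr]
    linarith
  -- For `L ∈ [a,b]` the point `k / L` is at distance at most `r` from the centre; the points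
  -- `j / L` are at distance at least `1 / L ≥ 1 / b` from it.
  let β : ContDiffBump ((k : ℝ) * ((a⁻¹ + b⁻¹) / 2)) :=
    ⟨b⁻¹ / 2, b⁻¹ - r, by positivity, by linarith⟩
  have hβc : HasCompactSupport fun x => (β x : ℂ) :=
    β.hasCompactSupport.comp_left Complex.ofReal_zero
  have hβs : ContDiff ℝ ∞ fun x => (β x : ℂ) := Complex.ofRealCLM.contDiff.comp β.contDiff
  have hbump : IsBump φ := ⟨hφ, a, b, ha, hs⟩
  refine ⟨hbump.sample (zetaMul (hβc.toSchwartzMap hβs)), sample_zetaMul_mem_spanClosure _ _,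
    fun L j => ?_⟩
  rw [hbump.sample_apply, zetaMul_apply]
  change φ L * (zetaSymbol _ * (β _ : ℂ)) = _
  by_cases hL : (L : ℝ) ∈ Icc a b
  · have hL0 : (0 : ℝ) < L := ha.trans_le hL.1
    have h1 : (L : ℝ)⁻¹ ≤ a⁻¹ := inv_anti₀ ha hL.1
    have h2 : b⁻¹ ≤ (L : ℝ)⁻¹ := inv_anti₀ hL0 hL.2
    have h3 : |(k : ℝ) * (L : ℝ)⁻¹ - k * ((a⁻¹ + b⁻¹) / 2)| ≤ r := by
      rw [← mul_sub, abs_mul, hr, mul_div_assoc]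
      gcongr
      rw [abs_le]
      constructor <;> linarith
    split_ifs with hjk
    · subst hjk
      rw [β.one_of_mem_closedBall, Complex.ofReal_one, mul_one]
      rw [Metric.mem_closedBall, Real.dist_eq]
      exact h3.trans (by change r ≤ b⁻¹ / 2; linarith)
    · rw [β.zero_of_le_dist, Complex.ofReal_zero, mul_zero, mul_zero]
      rw [Real.dist_eq]
      change b⁻¹ - r ≤ _
      have h4 : (1 : ℝ) ≤ |(j : ℝ) - k| := by
        exact_mod_cast Int.one_le_abs (sub_ne_zero.2 hjk)
      have h5 : (L : ℝ)⁻¹ ≤ |(j : ℝ) * (L : ℝ)⁻¹ - k * (L : ℝ)⁻¹| := by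
        rw [← sub_mul, abs_mul, abs_of_pos (inv_pos.2 hL0)]
        exact le_mul_of_one_le_left (inv_pos.2 hL0).le h4
      have h6 := abs_sub_le ((j : ℝ) * (L : ℝ)⁻¹) (k * ((a⁻¹ + b⁻¹) / 2)) (k * (L : ℝ)⁻¹)
      rw [abs_sub_comm ((k : ℝ) * ((a⁻¹ + b⁻¹) / 2))] at h6
      linarith
  · rw [hs _ hL]
    simp

/-- Induction on the length of the support, which is cut by smooth steps into pieces
`[p, p r²]`. -/
theorem exists_single_mem_of_pow {k : ℤ} {r : ℝ} (hr : 1 < r)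
    (hk : |(k : ℝ)| * (r ^ 2 - 1) < 1) (N : ℕ) : ∀ {φ : ℝ → ℂ}, ContDiff ℝ ∞ φ → ∀ {a : ℝ}, 0 < a →
    (∀ x, x ∉ Icc a (a * r ^ (N + 2)) → φ x = 0) → ∃ F ∈ spanClosure, ∀ (L : ℝ≥0) (j : ℤ),
      F.1 L j = if j = k then φ L * zetaSymbol (k * (L : ℝ)⁻¹) else 0 := by
  have hr0 : 0 < r := one_pos.trans hr
  have hnarrow : ∀ {φ : ℝ → ℂ}, ContDiff ℝ ∞ φ → ∀ {a : ℝ}, 0 < a →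
      (∀ x, x ∉ Icc a (a * r ^ 2) → φ x = 0) → ∃ F ∈ spanClosure, ∀ (L : ℝ≥0) (j : ℤ),
        F.1 L j = if j = k then φ L * zetaSymbol (k * (L : ℝ)⁻¹) else 0 := by
    intro φ hφ a ha hs
    have h1 : 1 < r ^ 2 := one_lt_pow₀ hr two_ne_zero
    refine exists_single_mem_of_narrow hφ ha (by nlinarith) ?_ hs
    calc |(k : ℝ)| * (a * r ^ 2 - a) = |(k : ℝ)| * (r ^ 2 - 1) * a := by ring
      _ < 1 * a := by gcongr
      _ = a := one_mul a
  induction N with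
  | zero => exact hnarrow
  | succ N ih =>
    intro φ hφ a ha hs
    have hpq : a * r ^ (N + 1) < a * r ^ (N + 2) := by gcongr; omega
    obtain ⟨s, hsd, hs1, hs0⟩ := exists_smooth_step hpq
    obtain ⟨F₁, m₁, h₁⟩ := ih (φ := fun x => φ x * s x) (hφ.mul hsd) ha (by
      intro x hx
      rcases le_or_gt (a * r ^ (N + 2)) x with h | h
      · simp only [hs0 x h, mul_zero]
      · have : x ∉ Icc a (a * r ^ (N + 1 + 2)) := fun h' => hx ⟨h'.1, h.le⟩
        simp only [hs x this, zero_mul])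
    obtain ⟨F₂, m₂, h₂⟩ := hnarrow (φ := fun x => φ x * (1 - s x)) (a := a * r ^ (N + 1))
      (hφ.mul (contDiff_const.sub hsd)) (by positivity) (by
        intro x hx
        rcases le_or_gt x (a * r ^ (N + 1)) with h | h
        · simp only [hs1 x h, sub_self, mul_zero]
        · have : x ∉ Icc a (a * r ^ (N + 1 + 2)) := fun h' => hx ⟨h.le, by
            rw [mul_assoc, ← pow_add]
            exact h'.2⟩
          simp only [hs x this, zero_mul])
    refine ⟨F₁ + F₂, spanClosure_add m₁ m₂, fun L j => ?_⟩
    change F₁.1 L j + F₂.1 L j = _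
    rw [h₁, h₂]
    split_ifs
    · ring
    · rw [add_zero]

/-- A section with one Fourier component only, which is a multiple of `ζ` with compact support in
`(0,∞)`, lies in the closed span. -/
theorem exists_single_mem (k : ℤ) {φ : ℝ → ℂ} (hφ : IsBump φ) : ∃ F ∈ spanClosure,
    ∀ (L : ℝ≥0) (j : ℤ), F.1 L j = if j = k then φ L * zetaSymbol (k * (L : ℝ)⁻¹) else 0 := by
  obtain ⟨hd, a, b, ha, hs⟩ := hφ
  -- With `r = 1 + δ` this gives `|k| (r² - 1) ≤ 3 |k| δ < 1`.
  set δ : ℝ := (3 * (|(k : ℝ)| + 1))⁻¹ with hδ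
  have hδ0 : 0 < δ := by positivity
  have hδ1 : 3 * (|(k : ℝ)| + 1) * δ = 1 := mul_inv_cancel₀ (by positivity)
  have hδ2 : δ ≤ 1 := inv_le_one_of_one_le₀ (by linarith [abs_nonneg (k : ℝ)])
  have hr : 1 < 1 + δ := by linarith
  obtain ⟨N, hN⟩ := pow_unbounded_of_one_lt (b / a) hr
  refine exists_single_mem_of_pow hr ?_ N hd ha fun x hx => hs x fun h => hx ⟨h.1, h.2.trans ?_⟩
  · have h1 : (1 + δ) ^ 2 - 1 ≤ 3 * δ := by nlinarith
    have h2 := mul_le_mul_of_nonneg_left h1 (abs_nonneg (k : ℝ))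
    nlinarith
  · rw [div_lt_iff₀ ha] at hN
    have h3 : (1 + δ) ^ N ≤ (1 + δ) ^ (N + 2) := pow_le_pow_right₀ hr.le (by omega)
    nlinarith

/-- Sections with finitely many nonzero components are sums of sections with one component. -/
theorem exists_finite_mem {d : ℤ → ℝ≥0 → ℂ} (h : ∀ k, ∃ F ∈ spanClosure, ∀ (L : ℝ≥0) (j : ℤ),
    F.1 L j = if j = k then d k L else 0) (s : Finset ℤ) : ∃ F ∈ spanClosure,
      ∀ (L : ℝ≥0) (j : ℤ), F.1 L j = if j ∈ s then d j L else 0 := by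
  induction s using Finset.induction_on with
  | empty => exact ⟨0, spanClosure_zero, fun L j => by simp⟩
  | insert k s hk ih =>
    obtain ⟨F₁, m₁, h₁⟩ := ih
    obtain ⟨F₂, m₂, h₂⟩ := h k
    refine ⟨F₁ + F₂, spanClosure_add m₁ m₂, fun L j => ?_⟩
    change F₁.1 L j + F₂.1 L j = _
    rw [h₁, h₂]
    by_cases hj : j = k
    · subst hj
      simp [hk]
    · simp [hj]

theorem IsBump.comp_inv_mul {h : ℝ → ℂ} (hh : IsBump h) {c : ℝ} (hc : 0 < c) :
    IsBump fun x => h (c⁻¹ * x) := by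
  obtain ⟨hd, a, b, ha, hs⟩ := hh
  refine ⟨hd.comp (contDiff_const.mul contDiff_id), c * a, c * b, by positivity, fun x hx =>
    hs _ fun h => hx ⟨?_, ?_⟩⟩
  · rw [← le_inv_mul_iff₀ hc]
    exact h.1
  · rw [← inv_mul_le_iff₀ hc]
    exact h.2

/-- The factor `1 - s` at `s = 1/2 - 2πik/x` is invertible for `x > 0`. -/
theorem contDiffOn_inv_one_sub (k : ℤ) : ContDiffOn ℝ ∞
    (fun x : ℝ => (1 / 2 + 2 * Real.pi * Complex.I * ((k * x⁻¹ : ℝ) : ℂ))⁻¹) (Ioi 0) := by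
  have h1 : ContDiffOn ℝ ∞ (fun x : ℝ => ((k * x⁻¹ : ℝ) : ℂ)) (Ioi 0) :=
    contDiffOn_comp_inv Complex.ofRealCLM.contDiff k
  refine (contDiffOn_const.add (contDiffOn_const.mul h1)).inv fun x _ h => ?_
  have := congrArg Complex.re h
  simp at this

/-- The dilates of a function supported in `[a,b]`, `a > 0`, are supported in `[|k| a, |k| b]`: for
bounded `L` only finitely many are nonzero. -/
theorem dilation_mem_of_isBump {e : ℤ} (he : e ≠ 0) {g : C0inf ℂ} {h : ℝ → ℂ} (hh : IsBump h)
    (hg : ∀ L : ℝ≥0, 0 < L → g.1 L = riemannZeta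
      (1 / 2 - 2 * (Real.pi : ℂ) * Complex.I * (e : ℂ) / ((L : ℝ) : ℂ)) * h L) :
    dilation e he g ∈ spanClosure := by
  have hsingle : ∀ k : ℤ, ∃ F ∈ spanClosure, ∀ (L : ℝ≥0) (j : ℤ),
      F.1 L j = if j = k then dilates e (zeroExt g.1) k L else 0 := by
    intro k
    by_cases hk : k.sign = e
    · have hk0 : (0 : ℝ) < |(k : ℝ)| := one_pos.trans_le (one_le_abs_of_sign he hk)
      have hb : IsBump fun x => h (|(k : ℝ)|⁻¹ * x) * ((((Real.sqrt |(k : ℝ)|)⁻¹ : ℝ) : ℂ) *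
          (1 / 2 + 2 * Real.pi * Complex.I * ((k * x⁻¹ : ℝ) : ℂ))⁻¹) :=
        (hh.comp_inv_mul hk0).mul (contDiffOn_const.mul (contDiffOn_inv_one_sub k))
      obtain ⟨F, m, hF⟩ := exists_single_mem k hb
      refine ⟨F, m, fun L j => ?_⟩
      rw [hF]
      split_ifs
      · rw [dilates, if_pos hk]
        rcases eq_or_lt_of_le (zero_le (a := L)) with h0 | h0
        · have h1 := hh.isFlat.2 0 le_rfl
          rw [← h0, NNReal.coe_zero, mul_zero, h1]
          have h2 := (isFlat_zeroExt g).2 0 le_rfl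
          rw [h2]
          ring
        · have hL : (0 : ℝ) < L := h0
          set M : ℝ≥0 := ⟨|(k : ℝ)|⁻¹ * L, by positivity⟩ with hM
          have hM0 : 0 < M := by
            have : (0 : ℝ) < |(k : ℝ)|⁻¹ * L := by positivity
            exact this
          have hz : zeroExt g.1 (|(k : ℝ)|⁻¹ * L) = g.1 M := zeroExt_coe g.1 M
          have hke : (e : ℝ) * |(k : ℝ)| = k := by
            rw [← hk]
            exact_mod_cast Int.sign_mul_abs k
          have harg : (1 / 2 - 2 * (Real.pi : ℂ) * Complex.I * (e : ℂ) / ((M : ℝ) : ℂ)) =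
              1 / 2 - 2 * Real.pi * Complex.I * ((k * (L : ℝ)⁻¹ : ℝ) : ℂ) := by
            have e1 : ((k * (L : ℝ)⁻¹ : ℝ) : ℂ) = (e : ℂ) / ((M : ℝ) : ℂ) := by
              rw [← hke]
              have : (M : ℝ) = |(k : ℝ)|⁻¹ * L := rfl
              rw [this]
              push_cast
              field_simp
            rw [e1]
            ring
          rw [hz, hg M hM0, harg, zetaSymbol]
          have hne : (1 / 2 + 2 * Real.pi * Complex.I * ((k * (L : ℝ)⁻¹ : ℝ) : ℂ)) ≠ 0 := by
            intro h'
            have := congrArg Complex.re h'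
            simp at this
          have e2 : (1 - (1 / 2 - 2 * Real.pi * Complex.I * ((k * (L : ℝ)⁻¹ : ℝ) : ℂ))) =
              1 / 2 + 2 * Real.pi * Complex.I * ((k * (L : ℝ)⁻¹ : ℝ) : ℂ) := by ring
          rw [e2]
          change h (M : ℝ) * (_ * _) * _ = _
          generalize (1 / 2 + 2 * Real.pi * Complex.I * ((k * (L : ℝ)⁻¹ : ℝ) : ℂ)) = w at hne
          field_simp
      · rfl
    · refine ⟨0, spanClosure_zero, fun L j => ?_⟩
      rw [dilates, if_neg hk, ite_self]
      rfl
  choose F m hF using fun N : ℕ => exists_finite_mem hsingle (Finset.Icc (-(N : ℤ)) N)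
  refine spanClosure_of_tendsto (u := F)
    (tendsto_frechetTopology_of_eventually_eq fun R => ?_) (Eventually.of_forall m)
  obtain ⟨-, a, b, ha, hs⟩ := hh
  have hz : ∀ x < a, zeroExt g.1 x = 0 := by
    intro x hx
    rcases le_or_gt x 0 with h0 | h0
    · exact (isFlat_zeroExt g).2 x h0
    · lift x to ℝ≥0 using h0.le
      rw [zeroExt_coe, hg x h0, hs _ fun h' => absurd hx (not_lt.2 h'.1), mul_zero]
  filter_upwards [eventually_gt_atTop ⌈R / a⌉₊] with N hN L hL
  have hRN : R < N * a := by
    rw [← div_lt_iff₀ ha]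
    exact (Nat.le_ceil _).trans_lt (by exact_mod_cast hN)
  refine lp.ext (funext fun j => ?_)
  rw [hF, dilation_apply]
  split_ifs with hj
  · rfl
  · rw [dilates]
    split_ifs with hk
    · have hj0 : (0 : ℝ) < |(j : ℝ)| := one_pos.trans_le (one_le_abs_of_sign he hk)
      have hjN : (N : ℝ) ≤ |(j : ℝ)| := by
        have : (N : ℤ) ≤ |j| := by
          by_contra! h'
          rw [abs_lt] at h'
          exact hj (Finset.mem_Icc.2 ⟨h'.1.le, h'.2.le⟩)
        exact_mod_cast this
      have hlt : |(j : ℝ)|⁻¹ * L < a := by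
        rw [inv_mul_lt_iff₀ hj0]
        nlinarith
      rw [hz _ hlt, mul_zero]
    · rfl

theorem dilation_mem_spanClosure {e : ℤ} (he : e ≠ 0) {g : C0inf ℂ} (hg : g ∈ zetaClosedIdeal e) :
    dilation e he g ∈ spanClosure := by
  have hc : @Continuous _ _ frechetTopology frechetTopology (dilation e he) :=
    (@continuous_iff_continuousAt _ _ frechetTopology frechetTopology _).2 fun g =>
      tendsto_dilation (u := id) he tendsto_id
  have h1 := @map_mem_closure _ _ frechetTopology frechetTopology (dilation e he)
    (zetaMultiples e) g spanClosure hc hg fun g hg => by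
      obtain ⟨u, hu, hb⟩ := exists_bump_tendsto hg
      refine spanClosure_of_tendsto (tendsto_dilation he hu) (Eventually.of_forall fun j => ?_)
      obtain ⟨h, hh, hj⟩ := hb j
      exact dilation_mem_of_isBump he hh hj
  rwa [spanClosure, @closure_closure _ frechetTopology] at h1

theorem gammaInv_mem_SigmaEClosure {g₁ g₂ : C0inf ℂ} (h₁ : g₁ ∈ zetaClosedIdeal 1)
    (h₂ : g₂ ∈ zetaClosedIdeal (-1)) : gammaInv g₁ g₂ ∈ SigmaEClosure := by
  rw [mem_SigmaEClosure_iff, gammaInv, trivialize_ofHat]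
  exact spanClosure_add (dilation_mem_spanClosure _ h₁) (dilation_mem_spanClosure _ h₂)

theorem gamma_image_H0SigmaE : gamma '' H0SigmaE = zetaClosedIdeal 1 ×ˢ zetaClosedIdeal (-1) := by
  refine Subset.antisymm ?_ fun g hg =>
    ⟨⟨gammaInv g.1 g.2, gammaInv_mem_H0 g.1 g.2⟩, gammaInv_mem_SigmaEClosure hg.1 hg.2,
      gamma_gammaInv g.1 g.2⟩
  rintro _ ⟨ξ, hξ, rfl⟩
  exact ⟨component_mem_zetaClosedIdeal 1 hξ, component_mem_zetaClosedIdeal (-1) hξ⟩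

end ScalingSite

end

theorem mainTheorem7 :
    Function.Bijective ScalingSite.gamma ∧
    ScalingSite.gamma '' ScalingSite.H0SigmaE =
      ScalingSite.zetaClosedIdeal 1 ×ˢ ScalingSite.zetaClosedIdeal (-1) :=
  ⟨ScalingSite.gamma_bijective, ScalingSite.gamma_image_H0SigmaE⟩
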